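/- **Notation.** Let $R$ be a $\mathbb{Z}^q$-graded commutative ring. Call a homogeneous $f\in R$ *relevant* if the group of degrees of homogeneous units of $R[f^{-1}]$ has finite index in $\mathbb{Z}^q$; let $R_\#$ be the ideal generated by the relevant elements. $\operatorname{Proj} R$ is the scheme whose points are the homogeneous prime ideals not containing $R_\#$, with the Zariski topology and the sheaf of functions that are locally fractions of homogeneous elements of equal degree; it is covered by the open sets $D_+(f)=\{p: f\notin p\}\cong\operatorname{Spec}(R[f^{-1}]_0)$, $f$ relevant. $\mathcal{O}(a)$ is the $\mathcal{O}$-module whose sections are locally fractions $r/t$ of homogeneous elements with $\deg r=\deg t+a$; each $r\in R_a$ is a global section of it. For a homogeneous ideal $I$ put $V(I)=\{p\in \operatorname{Proj}R : I\subset p\}$. For $a\in\mathbb{Z}^q$ let $P_a\subset\operatorname{Proj}R$ be the open union of the $D_+(f)$ over the homogeneous $f\in R_\#$ such that $a$ is the degree of a homogeneous unit of $R[f^{-1}]$. (On $P_a$ the sheaf $\mathcal{O}(a)$ is invertible. If the grading is standard, i.e. $R_\#$ is generated by finitely many homogeneous $f_i$ such that every $a\in\mathbb{Z}^q$ is the degree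 of a homogeneous unit of $R[f_i^{-1}]$, then $P_a=\operatorname{Proj}R$ for all $a$.) **Theorem.** Let $R$ be a $\mathbb{Z}^q$-graded ring, $X$ a scheme, $L_1,\dots,L_q$ invertible sheaves on $X$, $L^{a}=L_1^{\otimes a_1}\otimes\cdots\otimes L_q^{\otimes a_q}$, and $U\subset\operatorname{Proj}R$ an open subset. Let $J$ be the largest homogeneous ideal of $R$ with $V(J)=\operatorname{Proj}R-U$. Let $a\mapsto a'$ be an endomorphism of the group $\mathbb{Z}^q$ and $$s:R\to\bigoplus_{a\in\mathbb{Z}^q}\Gamma(X,L^{a})$$ a ring homomorphism with $s(R_a)\subset\Gamma(X,L^{a'})$ for all $a$. Put $B=V(s(R_\#))\cup V(s(J))\subset X$, where $V(s(I))$ is the closed set of points at which all homogeneous components of all elements of $s(I)$ vanish. Then there is exactly one morphism of schemes $$\varphi:X-B\to U$$ such that, for each $a\in\mathbb{Z}^q$, there is a homomorphism of $\mathcal{O}_{X-B}$-modules $$e_a:\varphi^*\mathcal{O}(a)\to L^{a'}|_{X-B}$$ which (1) is an isomorphism over $\varphi^{-1}(P_a)$ (so $\mathcal{O}(a)$ pulls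 back to $L^{a'}$ there; everywhere, if the grading is standard), and (2) satisfies $e_a(\varphi^*r)=s(r)|_{X-B}$ for all $r\in R_a$. -/

import Mathlib

universe u

open CategoryTheory TopologicalSpace Opposite AlgebraicGeometry
open scoped DirectSum

noncomputable section

namespace MultiProj

section Graded

variable {q : ℕ} {R : Type u} {σ : Type*} [CommRing R] [SetLike σ R] [AddSubgroupClass σ R]
  (𝒜 : (Fin q → ℤ) → σ)

/-- The degrees of the homogeneous units of `R[f⁻¹]`: a homogeneous element of degree `d` of
`R[f⁻¹]` is a fraction `r / f ^ n` with `deg r = d + n • deg f`. -/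
def unitDegrees (f : R) : Set (Fin q → ℤ) :=
  {d | ∃ (e : Fin q → ℤ) (n : ℕ) (r : R), f ∈ 𝒜 e ∧ r ∈ 𝒜 (d + n • e) ∧
    IsUnit (Localization.mk r ⟨f ^ n, n, rfl⟩ : Localization.Away f)}

/-- A homogeneous element `f` is relevant if the group of the degrees of the homogeneous units
of `R[f⁻¹]` has finite index in `ℤ^q`. -/
def IsRelevant (f : R) : Prop :=
  SetLike.IsHomogeneousElem 𝒜 f ∧ (AddSubgroup.closure (unitDegrees 𝒜 f)).FiniteIndex

variable [GradedRing 𝒜]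

/-- The irrelevant ideal `R_#`, generated by the relevant homogeneous elements. -/
def irrelevant : HomogeneousIdeal 𝒜 :=
  ⟨Ideal.span {f | IsRelevant 𝒜 f}, Ideal.homogeneous_span 𝒜 _ fun _ h => h.1⟩

variable {𝒜} in
/-- Inverses of homogeneous units are homogeneous. -/
lemma neg_mem_unitDegrees {f : R} {d : Fin q → ℤ} (h : d ∈ unitDegrees 𝒜 f) :
    -d ∈ unitDegrees 𝒜 f := by
  obtain ⟨e, n, r, hf, hr, hu⟩ := h
  obtain ⟨y, hy⟩ := hu.exists_right_inv
  obtain ⟨⟨t, ⟨_, m, rfl⟩⟩, rfl⟩ := IsLocalization.mk'_surjective (Submonoid.powers f) y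
  rw [← Localization.mk_eq_mk', Localization.mk_mul, ← Localization.mk_one,
    Localization.mk_eq_mk_iff, Localization.r_iff_exists] at hy
  obtain ⟨⟨_, c, rfl⟩, hc⟩ := hy
  simp only [Submonoid.coe_mul, OneMemClass.coe_one, one_mul, mul_one] at hc
  have h1 : f ^ c * r ∈ 𝒜 (c • e + (d + n • e)) :=
    SetLike.mul_mem_graded (SetLike.pow_mem_graded c hf) hr
  have h2 : f ^ c * (f ^ n * f ^ m) ∈ 𝒜 ((c • e + (d + n • e)) + (-d + m • e)) := by
    have : f ^ c * (f ^ n * f ^ m) = f ^ (c + (n + m)) := by ring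
    rw [this]
    convert SetLike.pow_mem_graded (A := 𝒜) (c + (n + m)) hf using 2
    simp only [add_smul]; abel
  have h3 := DirectSum.coe_decompose_mul_add_of_left_mem 𝒜 (j := -d + m • e) (b := t) h1
  rw [mul_assoc, hc, DirectSum.decompose_of_mem_same 𝒜 h2] at h3
  refine ⟨e, m, DirectSum.decompose 𝒜 t (-d + m • e), hf, SetLike.coe_mem _, ?_⟩
  refine IsUnit.of_mul_eq_one (Localization.mk r ⟨f ^ n, n, rfl⟩) ?_
  rw [Localization.mk_mul, ← Localization.mk_one, Localization.mk_eq_mk_iff,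
    Localization.r_iff_exists]
  refine ⟨⟨f ^ c, c, rfl⟩, ?_⟩
  simp only [Submonoid.coe_mul, OneMemClass.coe_one, one_mul, mul_one]
  rw [mul_comm (f ^ m), h3]; ring

variable {𝒜} in
/-- The degrees of the homogeneous units form a group. -/
lemma mem_unitDegrees_of_mem_closure {f : R} (hf : SetLike.IsHomogeneousElem 𝒜 f)
    {d : Fin q → ℤ} (h : d ∈ AddSubgroup.closure (unitDegrees 𝒜 f)) : d ∈ unitDegrees 𝒜 f := by
  obtain ⟨e₀, he₀⟩ := hf
  induction h using AddSubgroup.closure_induction with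
  | mem x hx => exact hx
  | zero => exact ⟨e₀, 0, 1, he₀, by simpa using SetLike.one_mem_graded 𝒜,
      by
        convert isUnit_one
        rw [← Localization.mk_one]; congr 1; exact Subtype.ext (pow_zero f)⟩
  | neg x _ hx => exact neg_mem_unitDegrees hx
  | add x y _ _ hx hy =>
    obtain ⟨e, n, r, hf, hr, hu⟩ := hx
    obtain ⟨e', n', r', hf', hr', hu'⟩ := hy
    by_cases h0 : f = 0
    · subst h0
      refine ⟨e, 0, 0, hf, zero_mem _, ?_⟩
      have : Subsingleton (Localization.Away (0 : R)) :=
        IsLocalization.subsingleton (M := Submonoid.powers (0 : R)) ⟨1, by simp⟩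
      exact isUnit_of_subsingleton _
    · obtain rfl : e' = e := DirectSum.degree_eq_of_mem_mem 𝒜 hf' hf h0
      refine ⟨e', n + n', r * r', hf, ?_, ?_⟩
      · convert SetLike.mul_mem_graded hr hr' using 2
        simp only [add_smul]; abel
      · have := hu.mul hu'
        rw [Localization.mk_mul] at this
        convert this using 2
        exact Subtype.ext (pow_add _ _ _)

variable {𝒜} in
/-- For relevant `f` and every degree `i` there are `N > 0` and an element `u` of `R`, of degree
`k • deg f - N • i`, which is a unit in `R[f⁻¹]`. -/
lemma IsRelevant.exists_unit {f : R} (hf : IsRelevant 𝒜 f) {e : Fin q → ℤ} (he : f ∈ 𝒜 e)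
    (i : Fin q → ℤ) :
    ∃ (N k : ℕ) (u : R), u ∈ 𝒜 (k • e - (N + 1) • i) ∧
      IsUnit (algebraMap R (Localization.Away f) u) := by
  by_cases h0 : f = 0
  · subst h0
    have : Subsingleton (Localization.Away (0 : R)) :=
      IsLocalization.subsingleton (M := Submonoid.powers (0 : R)) ⟨1, by simp⟩
    exact ⟨0, 0, 0, zero_mem _, isUnit_of_subsingleton _⟩
  have := hf.2
  set H := AddSubgroup.closure (unitDegrees 𝒜 f)
  have h1 : -(H.index • i) ∈ H := neg_mem (H.nsmul_index_mem i)
  obtain ⟨e', n, r, he', hr, hu⟩ := mem_unitDegrees_of_mem_closure hf.1 h1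
  obtain rfl : e' = e := DirectSum.degree_eq_of_mem_mem 𝒜 he' he h0
  obtain ⟨N, hN⟩ := Nat.exists_eq_succ_of_ne_zero (AddSubgroup.FiniteIndex.index_ne_zero (H := H))
  refine ⟨N, n, r, ?_, ?_⟩
  · rw [hN] at hr
    convert hr using 1
    rw [Nat.succ_eq_add_one, sub_eq_neg_add]
  · have h2 : algebraMap R (Localization.Away f) r =
        (Localization.mk r ⟨f ^ n, n, rfl⟩ : Localization.Away f) *
          algebraMap R (Localization.Away f) (f ^ n) := by
      rw [← Localization.mk_one_eq_algebraMap, ← Localization.mk_one_eq_algebraMap,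
        Localization.mk_mul, Localization.mk_eq_mk_iff, Localization.r_iff_exists]
      exact ⟨1, by simp [mul_comm]⟩
    rw [h2]
    exact hu.mul (IsLocalization.map_units (M := Submonoid.powers f) (Localization.Away f)
      (⟨f ^ n, n, rfl⟩ : Submonoid.powers f))

variable {𝒜} in
lemma not_mem_of_isUnit_away {f u : R} (hu : IsUnit (algebraMap R (Localization.Away f) u))
    {p : Ideal R} [hp : p.IsPrime] (hf : f ∉ p) : u ∉ p := by
  obtain ⟨y, hy⟩ := hu.exists_right_inv
  obtain ⟨⟨t, ⟨_, m, rfl⟩⟩, rfl⟩ := IsLocalization.mk'_surjective (Submonoid.powers f) y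
  rw [← Localization.mk_eq_mk', ← Localization.mk_one_eq_algebraMap, Localization.mk_mul,
    ← Localization.mk_one, Localization.mk_eq_mk_iff, Localization.r_iff_exists] at hy
  obtain ⟨⟨_, c, rfl⟩, hc⟩ := hy
  simp only [OneMemClass.coe_one, one_mul, mul_one] at hc
  intro hup
  have : f ^ c * f ^ m ∈ p := by
    rw [← hc]; exact p.mul_mem_left _ (p.mul_mem_right _ hup)
  rw [← pow_add] at this
  exact hf (hp.mem_of_pow_mem _ this)

/-- The points of `Proj R`: homogeneous prime ideals not containing `R_#`. -/
@[ext]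
structure Point where
  asIdeal : Ideal R
  isPrime : asIdeal.IsPrime
  isHomogeneous : asIdeal.IsHomogeneous 𝒜
  not_irrelevant_le : ¬ (irrelevant 𝒜).toIdeal ≤ asIdeal

attribute [instance] Point.isPrime

/-- The Zariski topology, induced from `Spec R`. -/
instance : TopologicalSpace (Point 𝒜) :=
  TopologicalSpace.induced (fun p => (⟨p.asIdeal, p.isPrime⟩ : PrimeSpectrum R)) inferInstance

/-- The underlying space of `Proj R`. -/
abbrev space : TopCat.{u} := TopCat.of (Point 𝒜)

variable {𝒜} in
/-- The locus where `f` does not vanish. -/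
def basicOpen (f : R) : Opens (space 𝒜) :=
  ⟨{p | f ∉ p.asIdeal}, by
    rw [isOpen_induced_iff]
    exact ⟨_, (PrimeSpectrum.basicOpen f).2, rfl⟩⟩

@[simp] lemma mem_basicOpen {f : R} {p : space 𝒜} :
    p ∈ basicOpen f ↔ f ∉ Point.asIdeal p := Iff.rfl

lemma isTopologicalBasis_basicOpen :
    TopologicalSpace.IsTopologicalBasis
      {s : Set (space 𝒜) | ∃ f : R, SetLike.IsHomogeneousElem 𝒜 f ∧ s = (basicOpen f : Opens (space 𝒜))} := by
  refine isTopologicalBasis_of_isOpen_of_nhds ?_ ?_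
  · rintro _ ⟨f, -, rfl⟩
    exact (basicOpen f).2
  · intro p U hp hU
    obtain ⟨V, hV, rfl⟩ := isOpen_induced_iff.mp hU
    obtain ⟨_, ⟨f, rfl⟩, hf, hfV⟩ :=
      PrimeSpectrum.isTopologicalBasis_basic_opens.exists_subset_of_mem_open hp hV
    have hf' : f ∉ Point.asIdeal p := hf
    obtain ⟨i, hi⟩ := not_forall.mp ((p.isHomogeneous.mem_iff 𝒜).not.mp hf')
    refine ⟨_, ⟨_, ⟨i, SetLike.coe_mem (DirectSum.decompose 𝒜 f i)⟩, rfl⟩, hi, fun p' hp' => ?_⟩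
    refine hfV fun h => hp' ?_
    exact (p'.isHomogeneous.mem_iff 𝒜).mp h i

lemma Point.exists_relevant (p : Point 𝒜) : ∃ f, IsRelevant 𝒜 f ∧ f ∉ p.asIdeal := by
  by_contra! h
  exact p.not_irrelevant_le (Ideal.span_le.mpr fun f hf => h f hf)

end Graded

section Sheaf

variable {q : ℕ} {R : Type u} {σ : Type*} [CommRing R] [SetLike σ R] [AddSubgroupClass σ R]
  (𝒜 : (Fin q → ℤ) → σ) [GradedRing 𝒜]

/-- The degree zero part of the homogeneous localization of `R` at the point `p`. -/
abbrev localRing (p : space 𝒜) : Type u := HomogeneousLocalization.AtPrime 𝒜 (Point.asIdeal p)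

/-- The functions that are locally fractions of homogeneous elements of the same degree. -/
abbrev isLocallyFraction : TopCat.LocalPredicate (localRing 𝒜) :=
  TopCat.PrelocalPredicate.sheafify
    { pred := fun {U} s => ∃ (i : Fin q → ℤ) (r t : 𝒜 i) (h : ∀ x : U, t.1 ∉ Point.asIdeal x.1),
        ∀ x : U, s x = .mk ⟨i, r, t, h x⟩
      res := by
        rintro V U i f ⟨j, r, s, h, w⟩
        exact ⟨j, r, s, fun x => h ⟨x.1, leOfHom i x.2⟩, fun x => w ⟨x.1, leOfHom i x.2⟩⟩ }

/-- The sections of the structure sheaf. -/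
def sections (U : Opens (space 𝒜)) : Subring (∀ x : U, localRing 𝒜 x) where
  carrier := {f | (isLocallyFraction 𝒜).pred f}
  zero_mem' := fun x => ⟨U, x.2, 𝟙 U, 0, ⟨0, zero_mem _⟩, ⟨1, SetLike.one_mem_graded 𝒜⟩,
    fun y => (Ideal.ne_top_iff_one _).mp (Point.isPrime y.1).ne_top, fun _ => rfl⟩
  one_mem' := fun x => ⟨U, x.2, 𝟙 U, 0, ⟨1, SetLike.one_mem_graded 𝒜⟩,
    ⟨1, SetLike.one_mem_graded 𝒜⟩,
    fun y => (Ideal.ne_top_iff_one _).mp (Point.isPrime y.1).ne_top, fun _ => rfl⟩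
  add_mem' := by
    intro a b ha hb x
    rcases ha x with ⟨Va, ma, ia, ja, ⟨ra, ra_mem⟩, ⟨sa, sa_mem⟩, hwa, wa⟩
    rcases hb x with ⟨Vb, mb, ib, jb, ⟨rb, rb_mem⟩, ⟨sb, sb_mem⟩, hwb, wb⟩
    refine
      ⟨Va ⊓ Vb, ⟨ma, mb⟩, Opens.infLELeft _ _ ≫ ia, ja + jb,
        ⟨sb * ra + sa * rb,
          add_mem (add_comm jb ja ▸ SetLike.mul_mem_graded sb_mem ra_mem : sb * ra ∈ 𝒜 (ja + jb))
            (SetLike.mul_mem_graded sa_mem rb_mem)⟩,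
        ⟨sa * sb, SetLike.mul_mem_graded sa_mem sb_mem⟩, fun y ↦
          (Point.asIdeal y.1).primeCompl.mul_mem (hwa ⟨y.1, y.2.1⟩) (hwb ⟨y.1, y.2.2⟩), ?_⟩
    rintro ⟨y, hy⟩
    have h1 := wa ⟨y, hy.1⟩
    have h2 := wb ⟨y, hy.2⟩
    change a _ + b _ = _
    refine (congrArg₂ (· + ·) h1 h2).trans (HomogeneousLocalization.val_injective _ ?_)
    simp only [HomogeneousLocalization.val_add, HomogeneousLocalization.val_mk,
      Localization.add_mk]
    congr 1
    simp [add_comm (sa * rb), mul_comm]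
  neg_mem' := by
    intro a ha x
    rcases ha x with ⟨V, m, i, j, ⟨r, r_mem⟩, ⟨s, s_mem⟩, nin, hy⟩
    refine ⟨V, m, i, j, ⟨-r, neg_mem r_mem⟩, ⟨s, s_mem⟩, nin, fun y => ?_⟩
    exact (congrArg (- ·) (hy y)).trans rfl
  mul_mem' := by
    intro a b ha hb x
    rcases ha x with ⟨Va, ma, ia, ja, ⟨ra, ra_mem⟩, ⟨sa, sa_mem⟩, hwa, wa⟩
    rcases hb x with ⟨Vb, mb, ib, jb, ⟨rb, rb_mem⟩, ⟨sb, sb_mem⟩, hwb, wb⟩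
    refine
      ⟨Va ⊓ Vb, ⟨ma, mb⟩, Opens.infLELeft _ _ ≫ ia, ja + jb,
        ⟨ra * rb, SetLike.mul_mem_graded ra_mem rb_mem⟩,
        ⟨sa * sb, SetLike.mul_mem_graded sa_mem sb_mem⟩, fun y =>
        (Point.asIdeal y.1).primeCompl.mul_mem (hwa ⟨y.1, y.2.1⟩) (hwb ⟨y.1, y.2.2⟩), ?_⟩
    rintro ⟨y, hy⟩
    exact (congrArg₂ (· * ·) (wa ⟨y, hy.1⟩) (wb ⟨y, hy.2⟩)).trans rfl

/-- The structure sheaf of `Proj R`, as a presheaf of rings. -/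
abbrev structurePresheaf : TopCat.Presheaf CommRingCat.{u} (space 𝒜) where
  obj U := CommRingCat.of (sections 𝒜 U.unop)
  map {U V} i := CommRingCat.ofHom
    { toFun := fun s => ⟨fun x => s.1 ⟨x.1, leOfHom i.unop x.2⟩, (isLocallyFraction 𝒜).res i.unop _ s.2⟩
      map_zero' := rfl
      map_add' := fun _ _ => rfl
      map_one' := rfl
      map_mul' := fun _ _ => rfl }

/-- The structure sheaf of `Proj R`. -/
def structureSheaf : TopCat.Sheaf CommRingCat.{u} (space 𝒜) :=
  ⟨structurePresheaf 𝒜, (TopCat.Presheaf.isSheaf_iff_isSheaf_comp (forget CommRingCat) _).mpr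
    (TopCat.Presheaf.isSheaf_of_iso (NatIso.ofComponents (fun _ => Iso.refl _) (by intros; rfl))
      (TopCat.subsheafToTypes (isLocallyFraction 𝒜)).property)⟩

/-- `Proj R` as a sheafed space. -/
abbrev toSheafedSpace : SheafedSpace CommRingCat.{u} where
  carrier := space 𝒜
  presheaf := structurePresheaf 𝒜
  IsSheaf := (structureSheaf 𝒜).2

variable {𝒜}

@[ext] lemma sections_ext {U : Opens (space 𝒜)} {s t : sections 𝒜 U} (h : ∀ x, s.1 x = t.1 x) :
    s = t := Subtype.ext (funext h)

/-- Evaluation of a section at a point. -/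
def evalHom {U : Opens (space 𝒜)} {x : space 𝒜} (hx : x ∈ U) :
    (structurePresheaf 𝒜).obj (op U) ⟶ CommRingCat.of (localRing 𝒜 x) :=
  CommRingCat.ofHom
    { toFun := fun s => s.1 ⟨x, hx⟩
      map_one' := rfl
      map_mul' _ _ := rfl
      map_zero' := rfl
      map_add' _ _ := rfl }

variable (𝒜) in
/-- The stalk maps to the homogeneous localization. -/
def stalkToLocal (x : space 𝒜) :
    (structurePresheaf 𝒜).stalk x ⟶ CommRingCat.of (localRing 𝒜 x) :=
  Limits.colimit.desc ((OpenNhds.inclusion x).op ⋙ structurePresheaf 𝒜)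
    { pt := _
      ι := { app := fun U => evalHom U.unop.2, naturality := by intros; rfl } }

@[simp]
lemma stalkToLocal_germ {U : Opens (space 𝒜)} {x : space 𝒜} (hx : x ∈ U)
    (s : (structurePresheaf 𝒜).obj (op U)) :
    (stalkToLocal 𝒜 x).hom ((structurePresheaf 𝒜).germ U x hx s) = s.1 ⟨x, hx⟩ := by
  have : (structurePresheaf 𝒜).germ U x hx ≫ stalkToLocal 𝒜 x = evalHom hx :=
    Limits.colimit.ι_desc _ _
  exact congr($(this).hom s)

/-- The section given by a homogeneous fraction on the locus where the denominator is
nonzero. -/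
def fractionSection {i : Fin q → ℤ} (r t : 𝒜 i) : sections 𝒜 (basicOpen t.1) :=
  ⟨fun y => .mk ⟨i, r, t, y.2⟩, fun y => ⟨_, y.2, 𝟙 _, i, r, t, fun z => z.2, fun _ => rfl⟩⟩

lemma stalkToLocal_bijective (x : space 𝒜) : Function.Bijective (stalkToLocal 𝒜 x).hom := by
  constructor
  · rw [injective_iff_map_eq_zero]
    intro z hz
    obtain ⟨U, hxU, s, rfl⟩ := (structurePresheaf 𝒜).exists_germ_eq z
    rw [stalkToLocal_germ] at hz
    obtain ⟨V, hxV, i, n, a, b, h, e⟩ := s.2 ⟨x, hxU⟩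
    have e' := e ⟨x, hxV⟩
    have hz' : (HomogeneousLocalization.mk ⟨n, a, b, h ⟨x, hxV⟩⟩ : localRing 𝒜 x) = 0 :=
      e'.symm.trans hz
    rw [HomogeneousLocalization.ext_iff_val, HomogeneousLocalization.val_mk,
      HomogeneousLocalization.val_zero, Localization.mk_eq_mk', IsLocalization.mk'_eq_zero_iff]
      at hz'
    obtain ⟨⟨c, hc⟩, hc'⟩ := hz'
    rw [← map_zero ((structurePresheaf 𝒜).germ U x hxU).hom]
    refine TopCat.Presheaf.germ_ext (structurePresheaf 𝒜) (V ⊓ basicOpen c) ⟨hxV, hc⟩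
      (Opens.infLELeft _ _ ≫ i) (Opens.infLELeft _ _ ≫ i) ?_
    refine sections_ext fun y => ?_
    refine (e ⟨y.1, y.2.1⟩).trans ?_
    change _ = (0 : localRing 𝒜 y.1)
    rw [HomogeneousLocalization.ext_iff_val, HomogeneousLocalization.val_mk,
      HomogeneousLocalization.val_zero, Localization.mk_eq_mk', IsLocalization.mk'_eq_zero_iff]
    exact ⟨⟨c, y.2.2⟩, hc'⟩
  · intro z
    obtain ⟨⟨i, r, t, ht⟩, rfl⟩ := HomogeneousLocalization.mk_surjective z
    exact ⟨(structurePresheaf 𝒜).germ (basicOpen t.1) x ht (fractionSection r t),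
      stalkToLocal_germ (U := basicOpen t.1) ht (fractionSection r t)⟩

/-- The stalks of the structure sheaf are the homogeneous localizations. -/
def stalkEquiv (x : space 𝒜) : (structurePresheaf 𝒜).stalk x ≃+* localRing 𝒜 x :=
  RingEquiv.ofBijective (stalkToLocal 𝒜 x).hom (stalkToLocal_bijective x)

variable (𝒜) in
/-- `Proj R` as a locally ringed space. -/
abbrev toLocallyRingedSpace : LocallyRingedSpace.{u} :=
  { toSheafedSpace 𝒜 with
    isLocalRing := fun x => (stalkEquiv (𝒜 := 𝒜) x).symm.isLocalRing }

end Sheaf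

section Affine

open HomogeneousLocalization

variable {q : ℕ} {R : Type u} {σ : Type*} [CommRing R] [SetLike σ R] [AddSubgroupClass σ R]
  {𝒜 : (Fin q → ℤ) → σ} [GradedRing 𝒜]

lemma isPrime_homogeneousCore_aux {ι : Type} [AddCommMonoid ι] [d : DecidableEq ι]
    [o : LinearOrder ι] [IsOrderedCancelAddMonoid ι] {ℬ : ι → σ} [GradedRing ℬ] {P : Ideal R}
    (hP : P.IsPrime) : (P.homogeneousCore ℬ).toIdeal.IsPrime := by
  obtain rfl : d = o.toDecidableEq := Subsingleton.elim _ _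
  exact hP.homogeneousCore

/-- In a `ℤ^q`-graded ring, the homogeneous core of a prime ideal is prime. -/
lemma isPrime_homogeneousCore {P : Ideal R} (hP : P.IsPrime) :
    (P.homogeneousCore 𝒜).toIdeal.IsPrime :=
  @isPrime_homogeneousCore_aux R σ _ _ _ (Lex (Fin q → ℤ)) _
    (inferInstanceAs (DecidableEq (Fin q → ℤ))) _ _ 𝒜 ‹GradedRing 𝒜› P hP

/-- Every prime of `R[f⁻¹]₀` comes from a prime of `R`. -/
lemma exists_prime_over {f : R} {e : Fin q → ℤ} (he : f ∈ 𝒜 e) (Q : Ideal (Away 𝒜 f))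
    [hQ : Q.IsPrime] : ∃ P : Ideal R, P.IsPrime ∧ f ∉ P ∧
      ∀ (n : ℕ) (s : R) (hs : s ∈ 𝒜 (n • e)), Away.mk 𝒜 he n s hs ∈ Q ↔ s ∈ P := by
  let I : Ideal R := Ideal.span {s | ∃ (n : ℕ) (hs : s ∈ 𝒜 (n • e)), Away.mk 𝒜 he n s hs ∈ Q}
  have hI : ∀ t ∈ I, ∀ (b : R) (n : ℕ), Away.mk 𝒜 he n (DirectSum.decompose 𝒜 (b * t) (n • e))
      (SetLike.coe_mem _) ∈ Q := by
    intro t ht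
    induction ht using Submodule.span_induction with
    | mem s hs =>
      obtain ⟨m, hs, hsQ⟩ := hs
      intro b n
      have h1 : ((DirectSum.decompose 𝒜 (b * s) (n • e) : 𝒜 (n • e)) : R) =
          (DirectSum.decompose 𝒜 b (n • e - m • e) : R) * s := by
        conv_lhs => rw [← sub_add_cancel (n • e) (m • e)]
        exact DirectSum.coe_decompose_mul_add_of_right_mem 𝒜 hs
      have h2 : (DirectSum.decompose 𝒜 b (n • e - m • e) : R) * f ^ m ∈ 𝒜 (n • e) := by
        have := SetLike.mul_mem_graded (SetLike.coe_mem (DirectSum.decompose 𝒜 b (n • e - m • e)))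
          (SetLike.pow_mem_graded m he)
        rwa [sub_add_cancel] at this
      convert Q.mul_mem_left (Away.mk 𝒜 he n _ h2) hsQ using 1
      apply val_injective
      rw [val_mul, Away.val_mk, Away.val_mk, Away.val_mk, Localization.mk_mul,
        Localization.mk_eq_mk_iff, Localization.r_iff_exists]
      refine ⟨1, ?_⟩
      simp only [h1, OneMemClass.coe_one, one_mul, Submonoid.coe_mul]
      ring
    | zero =>
      intro b n
      convert Q.zero_mem
      apply val_injective
      simp [Away.val_mk, Localization.mk_zero]
    | add x y _ _ hx hy =>
      intro b n
      convert Q.add_mem (hx b n) (hy b n) using 1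
      apply val_injective
      simp [Away.val_mk, mul_add, Localization.add_mk_self]
    | smul a x _ hx =>
      intro b n
      have := hx (b * a) n
      convert this using 2
      simp [mul_assoc]
  let M : Submonoid R :=
    { carrier := {t | ∃ (n : ℕ) (ht : t ∈ 𝒜 (n • e)), Away.mk 𝒜 he n t ht ∉ Q}
      one_mem' := by
        refine ⟨0, by simpa using SetLike.one_mem_graded 𝒜, fun h => hQ.ne_top ?_⟩
        rw [Ideal.eq_top_iff_one]
        convert h
        apply val_injective
        rw [val_one, Away.val_mk, ← Localization.mk_one]
        congr 1
        exact Subtype.ext (pow_zero f).symm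
      mul_mem' := by
        rintro a b ⟨n, ha, ha'⟩ ⟨m, hb, hb'⟩
        refine ⟨n + m, by rw [add_smul]; exact SetLike.mul_mem_graded ha hb, fun h => ?_⟩
        refine (hQ.mem_or_mem (x := Away.mk 𝒜 he n a ha) (y := Away.mk 𝒜 he m b hb) ?_).elim ha' hb'
        convert h using 1
        apply val_injective
        rw [val_mul, Away.val_mk, Away.val_mk, Away.val_mk, Localization.mk_mul]
        congr 1
        exact Subtype.ext (pow_add f n m).symm }
  have hd : Disjoint (I : Set R) (M : Set R) := by
    rw [Set.disjoint_left]
    rintro t ht ⟨n, hn, hnQ⟩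
    apply hnQ
    have := hI t ht 1 n
    convert this using 2
    rw [one_mul, DirectSum.decompose_of_mem_same 𝒜 hn]
  obtain ⟨P, hP, hIP, hPM⟩ := Ideal.exists_le_prime_disjoint I M hd
  refine ⟨P, hP, fun hf => ?_, fun n s hs => ⟨fun h => hIP (Ideal.subset_span ⟨n, hs, h⟩),
    fun h => by_contra fun h' => Set.disjoint_left.mp hPM h ⟨n, hs, h'⟩⟩⟩
  refine Set.disjoint_left.mp hPM hf ⟨1, by simpa using he, fun h => hQ.ne_top ?_⟩
  rw [Ideal.eq_top_iff_one]
  convert h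
  apply val_injective
  rw [val_one, Away.val_mk, ← Localization.mk_self (⟨f ^ 1, 1, rfl⟩ : Submonoid.powers f)]
  congr 1
  exact pow_one f

/-- Every prime of `R[f⁻¹]₀` comes from a point of `Proj R`. -/
lemma exists_point_over {f : R} (hf : IsRelevant 𝒜 f) {e : Fin q → ℤ} (he : f ∈ 𝒜 e)
    (Q : Ideal (Away 𝒜 f)) [hQ : Q.IsPrime] : ∃ p : Point 𝒜, f ∉ p.asIdeal ∧
      ∀ (n : ℕ) (s : R) (hs : s ∈ 𝒜 (n • e)), Away.mk 𝒜 he n s hs ∈ Q ↔ s ∈ p.asIdeal := by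
  obtain ⟨P, hP, hfP, h⟩ := exists_prime_over he Q
  have hmem : ∀ {i : Fin q → ℤ} {a : R}, a ∈ 𝒜 i → (a ∈ (P.homogeneousCore 𝒜).toIdeal ↔ a ∈ P) :=
    fun ha => ⟨fun h' => Ideal.toIdeal_homogeneousCore_le 𝒜 P h',
      fun h' => Ideal.mem_homogeneousCore_of_homogeneous_of_mem ⟨_, ha⟩ h'⟩
  refine ⟨⟨_, isPrime_homogeneousCore hP, HomogeneousIdeal.isHomogeneous _, fun h' => ?_⟩, ?_, ?_⟩
  · exact hfP ((hmem he).mp (h' (Ideal.subset_span hf)))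
  · exact fun h' => hfP ((hmem he).mp h')
  · intro n s hs
    rw [h n s hs]
    exact (hmem hs).symm

/-- The map from `R[f⁻¹]₀` to the local ring of a point of `D₊(f)`. -/
def awayToLocal {f : R} {x : space 𝒜} (hx : x ∈ basicOpen f) : Away 𝒜 f →+* localRing 𝒜 x :=
  mapId 𝒜 (Submonoid.powers_le.mpr (show f ∈ (Point.asIdeal x).primeCompl from hx))

lemma isUnit_mk_iff {x : space 𝒜} (z : NumDenSameDeg 𝒜 (Point.asIdeal x).primeCompl) :
    IsUnit (HomogeneousLocalization.mk z : localRing 𝒜 x) ↔ z.num.1 ∉ Point.asIdeal x := by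
  rw [← HomogeneousLocalization.isUnit_iff_isUnit_val,
    HomogeneousLocalization.val_mk, Localization.mk_eq_mk',
    IsLocalization.AtPrime.isUnit_mk'_iff]
  rfl

/-- The section on `D₊(f)` defined by an element of `R[f⁻¹]₀`. -/
def awayToSection (f : R) : Away 𝒜 f →+* sections 𝒜 (basicOpen f) where
  toFun s := ⟨fun x => awayToLocal x.2 s, fun x => by
    obtain ⟨s, rfl⟩ := mk_surjective s
    obtain ⟨n, hn : f ^ n = s.den.1⟩ := s.den_mem
    exact ⟨_, x.2, 𝟙 _, s.1, s.2, s.3,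
      fun x hsx => x.2 ((Point.isPrime x.1).mem_of_pow_mem n (hn ▸ hsx)), fun _ => rfl⟩⟩
  map_one' := by ext x; exact congrArg _ (map_one _)
  map_mul' a b := by ext x; exact congrArg _ (map_mul _ _ _)
  map_zero' := by ext x; exact congrArg _ (map_zero _)
  map_add' a b := by ext x; exact congrArg _ (map_add _ _ _)

/-- The open subspace `D₊(f)` of `Proj R`. -/
abbrev chart (f : R) : LocallyRingedSpace.{u} :=
  (toLocallyRingedSpace 𝒜).restrict (Opens.isOpenEmbedding (X := space 𝒜) (basicOpen f))

variable (𝒜) in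
/-- The map `R[f⁻¹]₀ → Γ(D₊(f), 𝒪)`. -/
def awayToΓ (f : R) :
    CommRingCat.of (Away 𝒜 f) ⟶ (chart (𝒜 := 𝒜) f).presheaf.obj (op ⊤) :=
  CommRingCat.ofHom (awayToSection f) ≫ (structurePresheaf 𝒜).map
    (homOfLE (Opens.isOpenEmbedding_obj_top (basicOpen f)).le).op

variable (𝒜) in
/-- The stalks of the charts. -/
def chartStalkIso {f : R} (x : space 𝒜) (hx : x ∈ basicOpen f) :
    (chart (𝒜 := 𝒜) f).presheaf.stalk ⟨x, hx⟩ ≅ CommRingCat.of (localRing 𝒜 x) :=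
  (toLocallyRingedSpace 𝒜).restrictStalkIso (Opens.isOpenEmbedding (X := space 𝒜) (basicOpen f))
    ⟨x, hx⟩ ≪≫ (stalkEquiv (𝒜 := 𝒜) x).toCommRingCatIso

lemma germ_chartStalkIso {f : R} (x : space 𝒜) (hx : x ∈ basicOpen f)
    (V : Opens (chart (𝒜 := 𝒜) f)) (hV : ⟨x, hx⟩ ∈ V) :
    (chart (𝒜 := 𝒜) f).presheaf.germ V ⟨x, hx⟩ hV ≫ (chartStalkIso 𝒜 x hx).hom =
      evalHom (U := (Opens.isOpenEmbedding (X := space 𝒜) (basicOpen f)).functor.obj V) (x := x)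
        ⟨⟨x, hx⟩, hV, rfl⟩ := by
  refine (Category.assoc _ _ _).symm.trans ?_
  have h1 := (toLocallyRingedSpace 𝒜).restrictStalkIso_hom_eq_germ
    (Opens.isOpenEmbedding (X := space 𝒜) (basicOpen f)) V ⟨x, hx⟩ hV
  refine (congrArg (· ≫ _) h1).trans ?_
  ext s
  exact congrArg val (stalkToLocal_germ (𝒜 := 𝒜)
    (U := (Opens.isOpenEmbedding (X := space 𝒜) (basicOpen f)).functor.obj V) ⟨⟨x, hx⟩, hV, rfl⟩ s)

lemma awayToΓ_germ {f : R} (x : space 𝒜) (hx : x ∈ basicOpen f) :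
    awayToΓ 𝒜 f ≫ (chart (𝒜 := 𝒜) f).presheaf.germ ⊤ ⟨x, hx⟩ trivial ≫ (chartStalkIso 𝒜 x hx).hom =
      CommRingCat.ofHom (awayToLocal hx) := by
  exact (congrArg (awayToΓ 𝒜 f ≫ ·) (germ_chartStalkIso x hx ⊤ trivial)).trans rfl

variable (𝒜) in
/-- The morphism `D₊(f) → Spec R[f⁻¹]₀`. -/
def toSpec (f : R) : chart (𝒜 := 𝒜) f ⟶ Spec.locallyRingedSpaceObj (CommRingCat.of (Away 𝒜 f)) :=
  ΓSpec.locallyRingedSpaceAdjunction.homEquiv (chart f) (op (CommRingCat.of <| Away 𝒜 f))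
    (awayToΓ 𝒜 f).op

lemma toSpec_base_apply {f : R} (x : space 𝒜) (hx : x ∈ basicOpen f) :
    (toSpec 𝒜 f).base ⟨x, hx⟩ = PrimeSpectrum.comap (awayToLocal hx)
      (IsLocalRing.closedPoint (localRing 𝒜 x)) := by
  change PrimeSpectrum.comap
      (awayToΓ 𝒜 f ≫ (chart (𝒜 := 𝒜) f).presheaf.germ ⊤ ⟨x, hx⟩ trivial).hom
        (@IsLocalRing.closedPoint ((chart (𝒜 := 𝒜) f).presheaf.stalk ⟨x, hx⟩) _ ((chart (𝒜 := 𝒜) f).isLocalRing ⟨x, hx⟩)) = _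
  have := (chart (𝒜 := 𝒜) f).isLocalRing ⟨x, hx⟩
  have h := awayToΓ_germ (𝒜 := 𝒜) x hx
  rw [← Category.assoc, ← Iso.eq_comp_inv] at h
  rw [h, CommRingCat.hom_comp, PrimeSpectrum.comap_comp]
  exact congr(PrimeSpectrum.comap _ $(@IsLocalRing.comap_closedPoint
    (localRing 𝒜 x) _ _
    ((chart (𝒜 := 𝒜) f).presheaf.stalk ⟨x, hx⟩) _ _ _ (isLocalHom_of_isIso _)))

lemma mk_mem_toSpec_base {f : R} (x : space 𝒜) (hx : x ∈ basicOpen f)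
    (z : NumDenSameDeg 𝒜 (.powers f)) :
    HomogeneousLocalization.mk z ∈ PrimeSpectrum.asIdeal ((toSpec 𝒜 f).base ⟨x, hx⟩) ↔
      z.num.1 ∈ Point.asIdeal x := by
  rw [toSpec_base_apply]
  exact (isUnit_mk_iff (x := x) ⟨z.deg, z.num, z.den, _⟩).not.trans not_not

lemma toSpec_injective {f : R} (hf : IsRelevant 𝒜 f) :
    Function.Injective (toSpec 𝒜 f).base := by
  rintro ⟨x, hx⟩ ⟨y, hy⟩ h
  obtain ⟨e, he⟩ := hf.1
  refine Subtype.ext (Point.ext ?_)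
  have key : ∀ i, ∀ a ∈ 𝒜 i, (a ∈ Point.asIdeal x ↔ a ∈ Point.asIdeal y) := by
    intro i a ha
    obtain ⟨N, k, u, hu, hunit⟩ := hf.exists_unit he i
    have hau : a ^ (N + 1) * u ∈ 𝒜 (k • e) := by
      have := SetLike.mul_mem_graded (SetLike.pow_mem_graded (N + 1) ha) hu
      rwa [add_sub_cancel] at this
    have hmem : ∀ z : space 𝒜, z ∈ basicOpen f →
        (a ^ (N + 1) * u ∈ Point.asIdeal z ↔ a ∈ Point.asIdeal z) := fun z hz => by
      rw [(Point.isPrime z).mul_mem_iff_mem_or_mem, (Point.isPrime z).pow_mem_iff_mem _ (by simp),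
        or_iff_left (not_mem_of_isUnit_away hunit hz)]
    let z : NumDenSameDeg 𝒜 (.powers f) :=
      ⟨k • e, ⟨_, hau⟩, ⟨f ^ k, SetLike.pow_mem_graded k he⟩, k, rfl⟩
    have h1 := mk_mem_toSpec_base x hx z
    have h2 := mk_mem_toSpec_base y hy z
    rw [h] at h1
    rw [← hmem x hx, ← hmem y hy]
    exact h1.symm.trans h2
  ext a
  rw [x.isHomogeneous.mem_iff 𝒜, y.isHomogeneous.mem_iff 𝒜]
  exact forall_congr' fun i => key i _ (SetLike.coe_mem _)

lemma toSpec_surjective {f : R} (hf : IsRelevant 𝒜 f) :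
    Function.Surjective (toSpec 𝒜 f).base := by
  rintro ⟨Q, hQ⟩
  obtain ⟨e, he⟩ := hf.1
  obtain ⟨p, hp, h⟩ := exists_point_over hf he Q
  refine ⟨⟨p, hp⟩, PrimeSpectrum.ext (Ideal.ext fun z => ?_)⟩
  obtain ⟨n, s, hs, rfl⟩ := Away.mk_surjective 𝒜 he z
  exact (mk_mem_toSpec_base (𝒜 := 𝒜) p hp _).trans (h n s hs).symm

lemma toSpec_isOpenMap {f : R} (hf : IsRelevant 𝒜 f) : IsOpenMap (toSpec 𝒜 f).base := by
  obtain ⟨e, he⟩ := hf.1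
  have hb := (isTopologicalBasis_basicOpen 𝒜).isInducing (f := (Subtype.val : basicOpen f → _))
    ⟨rfl⟩
  refine hb.isOpenMap_iff.mpr ?_
  rintro _ ⟨_, ⟨a, ⟨i, ha⟩, rfl⟩, rfl⟩
  obtain ⟨N, k, u, hu, hunit⟩ := hf.exists_unit he i
  have hau : a ^ (N + 1) * u ∈ 𝒜 (k • e) := by
    have := SetLike.mul_mem_graded (SetLike.pow_mem_graded (N + 1) ha) hu
    rwa [add_sub_cancel] at this
  let z : NumDenSameDeg 𝒜 (.powers f) :=
    ⟨k • e, ⟨_, hau⟩, ⟨f ^ k, SetLike.pow_mem_graded k he⟩, k, rfl⟩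
  have hmem : ∀ (x : space 𝒜) (hx : x ∈ basicOpen f),
      (HomogeneousLocalization.mk z ∈ PrimeSpectrum.asIdeal ((toSpec 𝒜 f).base ⟨x, hx⟩) ↔
        a ∈ Point.asIdeal x) := by
    intro x hx
    rw [mk_mem_toSpec_base]
    change a ^ (N + 1) * u ∈ _ ↔ _
    rw [(Point.isPrime x).mul_mem_iff_mem_or_mem, (Point.isPrime x).pow_mem_iff_mem _ (by simp),
      or_iff_left (not_mem_of_isUnit_away hunit hx)]
  refine Eq.mp (congrArg IsOpen ?_) (PrimeSpectrum.basicOpen (HomogeneousLocalization.mk z)).2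
  refine Set.Subset.antisymm ?_ ?_
  · intro y hy
    obtain ⟨⟨x, hx⟩, rfl⟩ := toSpec_surjective hf y
    exact ⟨⟨x, hx⟩, fun h => hy ((hmem x hx).mpr h), rfl⟩
  · rintro _ ⟨⟨x, hx⟩, hxa, rfl⟩
    exact fun h => hxa ((hmem x hx).mp h)

lemma isLocalization_awayToLocal {f : R} (hf : IsRelevant 𝒜 f) (x : space 𝒜)
    (hx : x ∈ basicOpen f) :
    @IsLocalization (Away 𝒜 f) _
      (Ideal.primeCompl _ (hp := PrimeSpectrum.isPrime ((toSpec 𝒜 f).base ⟨x, hx⟩)))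
      (localRing 𝒜 x) _ (awayToLocal hx).toAlgebra := by
  obtain ⟨e, he⟩ := hf.1
  let : Algebra (Away 𝒜 f) (localRing 𝒜 x) := (awayToLocal hx).toAlgebra
  constructor; constructor
  · rintro ⟨y, hy⟩
    obtain ⟨y, rfl⟩ := HomogeneousLocalization.mk_surjective y
    exact (isUnit_mk_iff (x := x) ⟨y.deg, y.num, y.den, _⟩).mpr
      ((mk_mem_toSpec_base x hx y).not.mp hy)
  · intro z
    obtain ⟨⟨i, ⟨a, ha⟩, ⟨b, hb⟩, (hb' : b ∉ Point.asIdeal x)⟩, rfl⟩ := z.mk_surjective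
    obtain ⟨N, k, u, hu, hunit⟩ := hf.exists_unit he i
    have hu' := not_mem_of_isUnit_away hunit hx
    have hfk : f ^ k ∈ 𝒜 (k • e) := SetLike.pow_mem_graded k he
    have h1 : a * b ^ N * u ∈ 𝒜 (k • e) := by
      have := SetLike.mul_mem_graded (SetLike.mul_mem_graded ha (SetLike.pow_mem_graded N hb)) hu
      rwa [show i + N • i = (N + 1) • i by rw [add_smul, one_smul, add_comm], add_sub_cancel]
        at this
    have h2 : b ^ (N + 1) * u ∈ 𝒜 (k • e) := by
      have := SetLike.mul_mem_graded (SetLike.pow_mem_graded (N + 1) hb) hu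
      rwa [add_sub_cancel] at this
    refine ⟨⟨HomogeneousLocalization.mk ⟨k • e, ⟨_, h1⟩, ⟨_, hfk⟩, ⟨k, rfl⟩⟩,
      ⟨HomogeneousLocalization.mk ⟨k • e, ⟨_, h2⟩, ⟨_, hfk⟩, ⟨k, rfl⟩⟩,
        (mk_mem_toSpec_base x hx _).not.mpr ?_⟩⟩, val_injective _ ?_⟩
    · intro h
      exact ((Point.isPrime x).mem_or_mem h).elim
        (fun h => hb' ((Point.isPrime x).mem_of_pow_mem _ h)) hu'
    · have hfx : f ^ k ∉ Point.asIdeal x := fun h => hx ((Point.isPrime x).mem_of_pow_mem _ h)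
      refine (val_mul _ _).trans ?_
      change (Localization.mk a ⟨b, hb'⟩ : Localization (Point.asIdeal x).primeCompl) *
        Localization.mk (b ^ (N + 1) * u) ⟨f ^ k, hfx⟩ =
          Localization.mk (a * b ^ N * u) ⟨f ^ k, hfx⟩
      rw [Localization.mk_mul, Localization.mk_eq_mk_iff, Localization.r_iff_exists]
      refine ⟨1, ?_⟩
      simp only [Submonoid.coe_mul, OneMemClass.coe_one]
      ring
  · intro y z h
    obtain ⟨n, s, hs, rfl⟩ := Away.mk_surjective 𝒜 he y
    obtain ⟨m, t, ht, rfl⟩ := Away.mk_surjective 𝒜 he z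
    obtain ⟨i, c, hc, hc', e1⟩ : ∃ i, ∃ c ∈ 𝒜 i, c ∉ Point.asIdeal x ∧
        c * (f ^ m * s) = c * (f ^ n * t) := by
      have hfx : ∀ k, f ^ k ∉ Point.asIdeal x :=
        fun k h => hx ((Point.isPrime x).mem_of_pow_mem _ h)
      have h' : (Localization.mk s ⟨f ^ n, hfx n⟩ : Localization (Point.asIdeal x).primeCompl) =
          Localization.mk t ⟨f ^ m, hfx m⟩ :=
        congrArg HomogeneousLocalization.val h
      rw [Localization.mk_eq_mk_iff, Localization.r_iff_exists] at h'
      obtain ⟨⟨c, hcx⟩, hc⟩ := h'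
      obtain ⟨i, hi⟩ := not_forall.mp ((x.isHomogeneous.mem_iff 𝒜).not.mp hcx)
      refine ⟨i, _, (DirectSum.decompose 𝒜 c i).2, hi, ?_⟩
      have hc2 : c * (f ^ m * s) = c * (f ^ n * t) := hc
      have d1 : f ^ m * s ∈ 𝒜 ((m + n) • e) := by
        rw [add_smul]; exact SetLike.mul_mem_graded (SetLike.pow_mem_graded m he) hs
      have d2 : f ^ n * t ∈ 𝒜 ((m + n) • e) := by
        rw [add_comm, add_smul]; exact SetLike.mul_mem_graded (SetLike.pow_mem_graded n he) ht
      have := DirectSum.coe_decompose_mul_add_of_right_mem 𝒜 (i := i) (a := c) d1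
      rw [hc2, DirectSum.coe_decompose_mul_add_of_right_mem 𝒜 d2] at this
      exact this.symm
    obtain ⟨N, k, u, hu, hunit⟩ := hf.exists_unit he i
    have hu' := not_mem_of_isUnit_away hunit hx
    have h2 : c ^ (N + 1) * u ∈ 𝒜 (k • e) := by
      have := SetLike.mul_mem_graded (SetLike.pow_mem_graded (N + 1) hc) hu
      rwa [add_sub_cancel] at this
    refine ⟨⟨HomogeneousLocalization.mk ⟨k • e, ⟨_, h2⟩, ⟨f ^ k, SetLike.pow_mem_graded k he⟩,
      ⟨k, rfl⟩⟩, (mk_mem_toSpec_base x hx _).not.mpr ?_⟩, val_injective _ ?_⟩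
    · intro h
      exact ((Point.isPrime x).mem_or_mem h).elim
        (fun h => hc' ((Point.isPrime x).mem_of_pow_mem _ h)) hu'
    · simp only [val_mul, Away.mk, val_mk, Localization.mk_eq_mk', ← IsLocalization.mk'_mul,
        IsLocalization.mk'_eq_iff_eq]
      congr 1
      simp only [Submonoid.coe_mul]
      linear_combination (c ^ N * u * f ^ k) * e1

lemma toStalk_stalkMap_toSpec {f : R} (x : space 𝒜) (hx : x ∈ basicOpen f) :
    StructureSheaf.toStalk (Away 𝒜 f) ((toSpec 𝒜 f).base ⟨x, hx⟩) ≫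
      (toSpec 𝒜 f).stalkMap ⟨x, hx⟩ =
    awayToΓ 𝒜 f ≫ (chart (𝒜 := 𝒜) f).presheaf.germ ⊤ ⟨x, hx⟩ trivial := by
  have h1 := LocallyRingedSpace.stalkMap_germ (toSpec 𝒜 f) ⊤ ⟨x, hx⟩ trivial
  have h2 := ΓSpec.toOpen_comp_locallyRingedSpaceAdjunction_homEquiv_app
    (X := chart (𝒜 := 𝒜) f) (R := Away 𝒜 f) (awayToΓ 𝒜 f).op (op ⊤)
  refine (Category.assoc _ _ _).trans ((congrArg (_ ≫ ·) h1).trans ?_)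
  refine (Category.assoc _ _ _).symm.trans ((congrArg (· ≫ _) h2).trans ?_)
  refine (Category.assoc _ _ _).trans (congrArg (awayToΓ 𝒜 f ≫ ·) ?_)
  exact TopCat.Presheaf.germ_res _ _ _ _

lemma isIso_stalkMap_toSpec {f : R} (hf : IsRelevant 𝒜 f) (x : space 𝒜)
    (hx : x ∈ basicOpen f) : IsIso ((toSpec 𝒜 f).stalkMap ⟨x, hx⟩) := by
  let y : PrimeSpectrum (Away 𝒜 f) := (toSpec 𝒜 f).base ⟨x, hx⟩
  let : Algebra (Away 𝒜 f) (localRing 𝒜 x) := (awayToLocal hx).toAlgebra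
  have h1 : IsLocalization y.asIdeal.primeCompl (localRing 𝒜 x) :=
    isLocalization_awayToLocal hf x hx
  let S := (Spec.structureSheaf (Away 𝒜 f)).presheaf.stalk y
  let E : S ≅ CommRingCat.of (localRing 𝒜 x) :=
    (IsLocalization.algEquiv (R := Away 𝒜 f) y.asIdeal.primeCompl S
      (localRing 𝒜 x)).toRingEquiv.toCommRingCatIso
  have hE : StructureSheaf.toStalk (Away 𝒜 f) y ≫ E.hom = CommRingCat.ofHom (awayToLocal hx) :=
    CommRingCat.hom_ext (IsLocalization.algEquiv (R := Away 𝒜 f) y.asIdeal.primeCompl S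
      (localRing 𝒜 x)).toAlgHom.comp_algebraMap
  have key : (toSpec 𝒜 f).stalkMap ⟨x, hx⟩ ≫ (chartStalkIso 𝒜 x hx).hom = E.hom := by
    refine CommRingCat.hom_ext (IsLocalization.ringHom_ext (R := Away 𝒜 f) y.asIdeal.primeCompl
      (S := S) ?_)
    refine Eq.trans (congrArg CommRingCat.Hom.hom ?_) (congrArg CommRingCat.Hom.hom hE.symm)
    refine (Category.assoc _ _ _).symm.trans
      ((congrArg (· ≫ _) (toStalk_stalkMap_toSpec x hx)).trans ?_)
    exact (Category.assoc _ _ _).trans (awayToΓ_germ x hx)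
  have h2 : (toSpec 𝒜 f).stalkMap ⟨x, hx⟩ = E.hom ≫ (chartStalkIso 𝒜 x hx).inv :=
    (Iso.eq_comp_inv _).mpr key
  exact Eq.mpr (congrArg IsIso h2)
    (@IsIso.comp_isIso' _ _ _ _ _ _ _ E.isIso_hom (chartStalkIso 𝒜 x hx).isIso_inv)

lemma isIso_toSpec {f : R} (hf : IsRelevant 𝒜 f) : IsIso (toSpec 𝒜 f) := by
  have : ∀ x, IsIso ((toSpec 𝒜 f).stalkMap x) := fun x => isIso_stalkMap_toSpec hf x.1 x.2
  have hc : Continuous (toSpec 𝒜 f).base := (toSpec 𝒜 f).base.hom.continuous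
  let h := (Equiv.ofBijective _ ⟨toSpec_injective hf, toSpec_surjective hf⟩).toHomeomorphOfContinuousOpen
    hc (toSpec_isOpenMap hf)
  have : IsIso (toSpec 𝒜 f).base := (TopCat.isoOfHomeo h).isIso_hom
  have : LocallyRingedSpace.IsOpenImmersion (toSpec 𝒜 f) :=
    LocallyRingedSpace.IsOpenImmersion.of_stalk_iso (toSpec 𝒜 f) h.isOpenEmbedding
  exact LocallyRingedSpace.IsOpenImmersion.to_iso _

variable (𝒜) in
/-- The scheme `Proj R` of a `ℤ^q`-graded ring `R`. -/
def multiProj : Scheme.{u} where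
  __ := toLocallyRingedSpace 𝒜
  local_affine x := by
    obtain ⟨f, hf, hx⟩ := Point.exists_relevant 𝒜 x

    exact ⟨⟨basicOpen f, hx⟩, .of (Away 𝒜 f), ⟨@asIso _ _ _ _ (toSpec 𝒜 f) (isIso_toSpec hf)⟩⟩

end Affine

/-- A sheaf of modules on a scheme, from a presheaf of abelian groups whose underlying presheaf
of sets is a sheaf and compatible module structures on its sections. -/
def mkModules (X : Scheme.{u}) (M : TopCat.Presheaf AddCommGrpCat.{u} X)
    [inst : ∀ U : X.Opens, Module Γ(X, U) (M.obj (op U))]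
    (hM : ∀ ⦃U V : X.Opens⦄ (i : V ⟶ U) (r : Γ(X, U)) (m : M.obj (op U)),
      M.map i.op (r • m) = X.presheaf.map i.op r • M.map i.op m)
    (h : TopCat.Presheaf.IsSheaf (M ⋙ forget AddCommGrpCat)) : X.Modules :=
  letI : ∀ U, Module (X.ringCatSheaf.obj.obj U) (M.obj U) := fun U => inst U.unop
  { val := PresheafOfModules.ofPresheaf M fun _ _ i => hM i.unop
    isSheaf := (TopCat.Presheaf.isSheaf_iff_isSheaf_comp (forget AddCommGrpCat) M).mpr h }

/-- The sections of `mkModules`. -/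
lemma mkModules_obj (X : Scheme.{u}) (M : TopCat.Presheaf AddCommGrpCat.{u} X)
    [inst : ∀ U : X.Opens, Module Γ(X, U) (M.obj (op U))]
    (hM : ∀ ⦃U V : X.Opens⦄ (i : V ⟶ U) (r : Γ(X, U)) (m : M.obj (op U)),
      M.map i.op (r • m) = X.presheaf.map i.op r • M.map i.op m)
    (h : TopCat.Presheaf.IsSheaf (M ⋙ forget AddCommGrpCat)) (U) :
    Γ(mkModules X M hM h, U) = M.obj (op U) := rfl

section Twist

variable {q : ℕ} {R : Type u} {σ : Type*} [CommRing R] [SetLike σ R] [AddSubgroupClass σ R]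
  (𝒜 : (Fin q → ℤ) → σ) [GradedRing 𝒜]

/-- The functions that are locally homogeneous fractions of degree `a`. -/
abbrev isLocallyFractionOfDegree (a : Fin q → ℤ) :
    TopCat.LocalPredicate (fun x : space 𝒜 => Localization.AtPrime (Point.asIdeal x)) :=
  TopCat.PrelocalPredicate.sheafify
    { pred := fun {U} s => ∃ (i : Fin q → ℤ) (r : 𝒜 (i + a)) (t : 𝒜 i)
        (h : ∀ x : U, t.1 ∉ Point.asIdeal x.1),
        ∀ x : U, s x = Localization.mk r.1 ⟨t.1, h x⟩
      res := by
        rintro V U i f ⟨j, r, s, h, w⟩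
        exact ⟨j, r, s, fun x => h ⟨x.1, leOfHom i x.2⟩, fun x => w ⟨x.1, leOfHom i x.2⟩⟩ }

/-- The sections of `𝒪(a)`. -/
def twistSections (a : Fin q → ℤ) (U : Opens (space 𝒜)) :
    AddSubgroup (∀ x : U, Localization.AtPrime (Point.asIdeal x.1)) where
  carrier := {f | (isLocallyFractionOfDegree 𝒜 a).pred f}
  zero_mem' := fun x => ⟨U, x.2, 𝟙 U, 0, ⟨0, zero_mem _⟩, ⟨1, SetLike.one_mem_graded 𝒜⟩,
    fun y => (Ideal.ne_top_iff_one _).mp (Point.isPrime y.1).ne_top,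
    fun _ => (Localization.mk_zero _).symm⟩
  add_mem' := by
    intro f g hf hg x
    rcases hf x with ⟨Va, ma, ia, ja, ⟨ra, ra_mem⟩, ⟨sa, sa_mem⟩, hwa, wa⟩
    rcases hg x with ⟨Vb, mb, ib, jb, ⟨rb, rb_mem⟩, ⟨sb, sb_mem⟩, hwb, wb⟩
    refine
      ⟨Va ⊓ Vb, ⟨ma, mb⟩, Opens.infLELeft _ _ ≫ ia, ja + jb,
        ⟨sa * rb + sb * ra, add_mem ?_ ?_⟩,
        ⟨sa * sb, SetLike.mul_mem_graded sa_mem sb_mem⟩, fun y ↦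
          (Point.asIdeal y.1).primeCompl.mul_mem (hwa ⟨y.1, y.2.1⟩) (hwb ⟨y.1, y.2.2⟩), ?_⟩
    · rw [add_assoc]; exact SetLike.mul_mem_graded sa_mem rb_mem
    · rw [add_comm ja, add_assoc]; exact SetLike.mul_mem_graded sb_mem ra_mem
    rintro ⟨y, hy⟩
    exact (congrArg₂ (· + ·) (wa ⟨y, hy.1⟩) (wb ⟨y, hy.2⟩)).trans (Localization.add_mk _ _ _ _)
  neg_mem' := by
    intro f hf x
    rcases hf x with ⟨V, m, i, j, ⟨r, r_mem⟩, ⟨s, s_mem⟩, nin, hy⟩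
    exact ⟨V, m, i, j, ⟨-r, neg_mem r_mem⟩, ⟨s, s_mem⟩, nin, fun y =>
      (congrArg (- ·) (hy y)).trans (Localization.neg_mk _ _)⟩

/-- A homogeneous fraction of degree `0` times one of degree `a` has degree `a`. -/
instance (a : Fin q → ℤ) (U : Opens (space 𝒜)) : SMul (sections 𝒜 U) (twistSections 𝒜 a U) where
  smul f g := ⟨fun x => (f.1 x).val * g.1 x, by
    intro x
    rcases f.2 x with ⟨Va, ma, ia, ja, ⟨ra, ra_mem⟩, ⟨sa, sa_mem⟩, hwa, wa⟩
    rcases g.2 x with ⟨Vb, mb, ib, jb, ⟨rb, rb_mem⟩, ⟨sb, sb_mem⟩, hwb, wb⟩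
    refine
      ⟨Va ⊓ Vb, ⟨ma, mb⟩, Opens.infLELeft _ _ ≫ ia, ja + jb, ⟨ra * rb, ?_⟩,
        ⟨sa * sb, SetLike.mul_mem_graded sa_mem sb_mem⟩, fun y ↦
          (Point.asIdeal y.1).primeCompl.mul_mem (hwa ⟨y.1, y.2.1⟩) (hwb ⟨y.1, y.2.2⟩), ?_⟩
    · rw [add_assoc]; exact SetLike.mul_mem_graded ra_mem rb_mem
    rintro ⟨y, hy⟩
    exact (congrArg₂ (fun s t => HomogeneousLocalization.val s * t)
      (wa ⟨y, hy.1⟩) (wb ⟨y, hy.2⟩)).trans (Localization.mk_mul _ _ _ _)⟩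

instance twistModule (a : Fin q → ℤ) (U : Opens (space 𝒜)) :
    Module (sections 𝒜 U) (twistSections 𝒜 a U) where
  one_smul f := Subtype.ext <| funext fun x =>
    (congrArg (· * f.1 x) HomogeneousLocalization.val_one).trans (one_mul _)
  mul_smul _ _ f := Subtype.ext <| funext fun x =>
    (congrArg (· * f.1 x) (HomogeneousLocalization.val_mul _ _)).trans (mul_assoc _ _ _)
  smul_zero _ := Subtype.ext <| funext fun _ => mul_zero _
  smul_add _ _ _ := Subtype.ext <| funext fun _ => mul_add _ _ _
  add_smul _ _ f := Subtype.ext <| funext fun x =>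
    (congrArg (· * f.1 x) (HomogeneousLocalization.val_add _ _)).trans (add_mul _ _ _)
  zero_smul f := Subtype.ext <| funext fun x =>
    (congrArg (· * f.1 x) HomogeneousLocalization.val_zero).trans (zero_mul _)

/-- The presheaf of abelian groups `𝒪(a)`. -/
abbrev twistPresheaf (a : Fin q → ℤ) : TopCat.Presheaf AddCommGrpCat.{u} (space 𝒜) where
  obj U := AddCommGrpCat.of (twistSections 𝒜 a U.unop)
  map {U V} i := AddCommGrpCat.ofHom
    { toFun := fun s => ⟨fun x => s.1 ⟨x.1, leOfHom i.unop x.2⟩,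
        (isLocallyFractionOfDegree 𝒜 a).res i.unop _ s.2⟩
      map_zero' := rfl
      map_add' := fun _ _ => rfl }

/-- The sheaf `𝒪(a)` on `Proj R`. -/
def twist (a : Fin q → ℤ) : (multiProj 𝒜).Modules :=
  mkModules (multiProj 𝒜) (twistPresheaf 𝒜 a)
    (inst := fun U => twistModule 𝒜 a U)
    (fun _ _ _ _ _ => rfl)
    (TopCat.Presheaf.isSheaf_of_iso (NatIso.ofComponents (fun _ => Iso.refl _) (by intros; rfl))
      (TopCat.subsheafToTypes (isLocallyFractionOfDegree 𝒜 a)).property)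

variable {𝒜} in
/-- The global section `r / 1` of `𝒪(a)` given by an element `r` of degree `a`. -/
def twistSection {a : Fin q → ℤ} (r : 𝒜 a) : Γ(twist 𝒜 a, ⊤) :=
  (⟨fun _ => Localization.mk r.1 1, fun x => ⟨⊤, x.2, 𝟙 _, 0, ⟨r.1, by rw [zero_add]; exact r.2⟩,
    ⟨1, SetLike.one_mem_graded 𝒜⟩,
    fun y => (Ideal.ne_top_iff_one _).mp (Point.isPrime y.1).ne_top, fun _ => rfl⟩⟩ :
    twistSections 𝒜 a ⊤)

/-- The locus where `𝒪(a)` is locally generated by a homogeneous unit: the union of the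
`D₊(f)`, `f` a homogeneous element of `R_#` for which `a` is the degree of a homogeneous unit of
`R[f⁻¹]`. -/
def unitLocus (a : Fin q → ℤ) : (multiProj 𝒜).Opens :=
  ⨆ f ∈ {f : R | SetLike.IsHomogeneousElem 𝒜 f ∧ f ∈ irrelevant 𝒜 ∧ a ∈ unitDegrees 𝒜 f},
    basicOpen (𝒜 := 𝒜) f

variable {𝒜} in
/-- The locus `V(I)` of the points of `Proj R` containing the homogeneous ideal `I`. -/
def zeroLocus (I : HomogeneousIdeal 𝒜) : Set (multiProj 𝒜) :=
  {p : space 𝒜 | I.toIdeal ≤ Point.asIdeal p}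

/-- Every open subset of `Proj R` is the complement of `V(J)` for a largest homogeneous ideal
`J`. -/
lemma exists_isGreatest_zeroLocus (U : (multiProj 𝒜).Opens) :
    ∃ J, IsGreatest {I : HomogeneousIdeal 𝒜 | zeroLocus I = (U : Set (multiProj 𝒜))ᶜ} J := by
  let V : Opens (space 𝒜) := U
  let J : HomogeneousIdeal 𝒜 :=
    ⟨⨅ p : {p : space 𝒜 // p ∉ V}, Point.asIdeal p.1, Ideal.IsHomogeneous.iInf fun p => p.1.isHomogeneous⟩
  refine ⟨J, ?_, ?_⟩
  · refine Set.Subset.antisymm (fun (p : space 𝒜) hp hpU => ?_) fun (p : space 𝒜) hp => ?_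
    · obtain ⟨_, ⟨f, hf, rfl⟩, hpf, hfV⟩ :=
        (isTopologicalBasis_basicOpen 𝒜).exists_subset_of_mem_open (show p ∈ (V : Set (space 𝒜)) from hpU) V.2
      refine hpf (hp ?_)
      refine (Submodule.mem_iInf _).mpr fun y => ?_
      by_contra h
      exact y.2 (hfV h)
    · exact iInf_le (fun p : {p : space 𝒜 // p ∉ V} => Point.asIdeal p.1) ⟨p, hp⟩
  · intro I (hI : _ = _)
    change I.toIdeal ≤ ⨅ p : {p : space 𝒜 // p ∉ V}, Point.asIdeal p.1
    refine le_iInf fun p : {p : space 𝒜 // p ∉ V} => ?_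
    have : p.1 ∈ zeroLocus I := by rw [hI]; exact p.2
    exact this

end Twist

section Frames

variable {X : Scheme.{u}}

/-- A frame of a sheaf of modules `M` on an open set `W`: a section of `M` on `W` that freely
generates `M` restricted to `W`. -/
structure Frame (M : X.Modules) (W : X.Opens) where
  gen : Γ(M, W)
  bijective : ∀ (V : X.Opens) (h : V ≤ W), Function.Bijective
    fun r : Γ(X, V) => r • (M.presheaf.map (homOfLE h).op gen : Γ(M, V))

/-- A sheaf of modules is invertible if it is locally free of rank one. -/
def IsInvertible (M : X.Modules) : Prop :=
  ∀ x : X, ∃ W : X.Opens, x ∈ W ∧ Nonempty (Frame M W)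

/-- Restriction of a frame to a smaller open set. -/
def Frame.res {M : X.Modules} {W W' : X.Opens} (e : Frame M W) (h : W' ≤ W) : Frame M W' where
  gen := M.presheaf.map (homOfLE h).op e.gen
  bijective V hV := by
    refine Eq.mp (congrArg (fun m : Γ(M, V) => Function.Bijective fun r : Γ(X, V) => r • m) ?_)
      (e.bijective V (hV.trans h))
    rw [← ConcreteCategory.comp_apply, ← Functor.map_comp]
    rfl

lemma Frame.ext {M : X.Modules} {W : X.Opens} {e e' : Frame M W} (h : e.gen = e'.gen) :
    e = e' := by
  cases e; cases e'; cases h; rfl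

lemma Frame.res_res {M : X.Modules} {W W' W'' : X.Opens} (e : Frame M W) (h : W' ≤ W)
    (h' : W'' ≤ W') : (e.res h).res h' = e.res (h'.trans h) := by
  refine Frame.ext ?_
  change M.presheaf.map _ (M.presheaf.map _ _) = M.presheaf.map _ _
  rw [← ConcreteCategory.comp_apply, ← Functor.map_comp]
  rfl

lemma Frame.res_self {M : X.Modules} {W : X.Opens} (e : Frame M W) : e.res le_rfl = e :=
  Frame.ext (congrArg (fun f => f e.gen)
    (congrArg ConcreteCategory.hom (M.presheaf.map_id (op W))))

/-- Multiplication of a frame by an invertible function. -/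
def Frame.smul {M : X.Modules} {W : X.Opens} (v : Γ(X, W)ˣ) (e : Frame M W) : Frame M W where
  gen := (v : Γ(X, W)) • e.gen
  bijective V hV := by
    let v' : Γ(X, V)ˣ := Units.map (X.presheaf.map (homOfLE hV).op).hom v
    have h : (fun r : Γ(X, V) =>
        r • (M.presheaf.map (homOfLE hV).op ((v : Γ(X, W)) • e.gen) : Γ(M, V))) =
        (fun r : Γ(X, V) => r • (M.presheaf.map (homOfLE hV).op e.gen : Γ(M, V))) ∘
          fun r => r * (v' : Γ(X, V)) := by
      funext r
      refine (congrArg (r • ·) (Scheme.Modules.map_smul M (homOfLE hV) _ _)).trans ?_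
      exact (mul_smul r (v' : Γ(X, V)) _).symm
    rw [h]
    exact (e.bijective V hV).comp (Units.mulRight v').bijective

lemma Frame.res_smul {M : X.Modules} {W W' : X.Opens} (v : Γ(X, W)ˣ) (e : Frame M W)
    (h : W' ≤ W) : (e.smul v).res h =
      (e.res h).smul (Units.map (X.presheaf.map (homOfLE h).op).hom v) :=
  Frame.ext (Scheme.Modules.map_smul M (homOfLE h) _ _)

lemma res_res_apply {W W' W'' : X.Opens} (h : W' ≤ W) (h' : W'' ≤ W') (g : Γ(X, W)) :
    X.presheaf.map (homOfLE h').op (X.presheaf.map (homOfLE h).op g) =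
      X.presheaf.map (homOfLE (h'.trans h)).op g := by
  rw [← ConcreteCategory.comp_apply, ← Functor.map_comp]
  rfl

lemma Frame.bijective_self {M : X.Modules} {W : X.Opens} (e : Frame M W) :
    Function.Bijective fun r : Γ(X, W) => r • e.gen := by
  have h := e.bijective W le_rfl
  have h1 : M.presheaf.map (homOfLE le_rfl).op e.gen = e.gen := congrArg Frame.gen e.res_self
  rwa [h1] at h

/-- Two frames differ by an invertible function. -/
lemma Frame.exists_eq_smul {M : X.Modules} {W : X.Opens} (e e' : Frame M W) :
    ∃ v : Γ(X, W)ˣ, e' = e.smul v := by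
  obtain ⟨r, hr⟩ := e.bijective_self.2 e'.gen
  obtain ⟨t, ht⟩ := e'.bijective_self.2 e.gen
  have hr : r • e.gen = e'.gen := hr
  have ht : t • e'.gen = e.gen := ht
  have h1 : t * r = 1 := e.bijective_self.1 (by
    change (t * r) • e.gen = (1 : Γ(X, W)) • e.gen
    rw [mul_smul, hr, ht, one_smul])
  exact ⟨⟨r, t, (mul_comm _ _).trans h1, h1⟩, Frame.ext hr.symm⟩

lemma Frame.smul_injective {M : X.Modules} {W : X.Opens} (e : Frame M W) {v w : Γ(X, W)ˣ}
    (h : e.smul v = e.smul w) : v = w :=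
  Units.ext (e.bijective_self.1 (congrArg Frame.gen h))

lemma Frame.smul_smul {M : X.Modules} {W : X.Opens} (e : Frame M W) (v w : Γ(X, W)ˣ) :
    (e.smul v).smul w = e.smul (w * v) :=
  Frame.ext (mul_smul (w : Γ(X, W)) (v : Γ(X, W)) e.gen).symm

variable {q : ℕ} (L : Fin q → X.Modules)

/-- Families of functions indexed by the open subsets `W` of `V` and the tuples of frames of
`L_1, ..., L_q` on `W`. -/
abbrev Coeffs (V : X.Opens) : Type u :=
  ∀ (W : {W : X.Opens // W ≤ V}) (_ : ∀ i, Frame (L i) W.1), Γ(X, W.1)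

/-- The sections over `V` of `L^a = L_1^{⊗ a_1} ⊗ ... ⊗ L_q^{⊗ a_q}`. A section is given by its
coefficients `c W e` with respect to the local generators `e_1^{⊗ a_1} ⊗ ... ⊗ e_q^{⊗ a_q}` of
`L^a`, where `e` runs through the tuples of frames of the `L_i` on the open subsets `W` of `V`.
The coefficients are compatible with restriction, and replacing each `e_i` by `v_i • e_i`
divides the coefficient by `v_1 ^ a_1 ⋯ v_q ^ a_q`. -/
def tensorPowSections (a : Fin q → ℤ) (V : X.Opens) : AddSubgroup (Coeffs L V) where
  carrier := {c |
    (∀ (W : {W : X.Opens // W ≤ V}) (W' : X.Opens) (h : W' ≤ W.1) (e : ∀ i, Frame (L i) W.1),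
      X.presheaf.map (homOfLE h).op (c W e) = c ⟨W', h.trans W.2⟩ fun i => (e i).res h) ∧
    ∀ (W : {W : X.Opens // W ≤ V}) (v : Fin q → Γ(X, W.1)ˣ) (e : ∀ i, Frame (L i) W.1),
      c W (fun i => (e i).smul (v i)) = ((∏ i, v i ^ (-a i) : Γ(X, W.1)ˣ) : Γ(X, W.1)) * c W e}
  zero_mem' := ⟨fun _ _ _ _ => map_zero _, fun _ _ _ => (mul_zero _).symm⟩
  add_mem' hc hd :=
    ⟨fun W W' h e => (map_add _ _ _).trans (congrArg₂ (· + ·) (hc.1 W W' h e) (hd.1 W W' h e)),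
      fun W v e => (congrArg₂ (· + ·) (hc.2 W v e) (hd.2 W v e)).trans (mul_add _ _ _).symm⟩
  neg_mem' hc :=
    ⟨fun W W' h e => (map_neg _ _).trans (congrArg (- ·) (hc.1 W W' h e)),
      fun W v e => (congrArg (- ·) (hc.2 W v e)).trans (neg_mul_eq_mul_neg _ _)⟩

/-- Frames `e_i` of the `L_i` on `V` give the generator `e_1^{⊗ a_1} ⊗ ... ⊗ e_q^{⊗ a_q}` of
`L^a` on `V`: taking coefficients identifies the sections of `L^a` over `V` with functions. -/
lemma coeff_bijective (a : Fin q → ℤ) (V : X.Opens) (e : ∀ i, Frame (L i) V) :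
    Function.Bijective fun c : tensorPowSections L a V => c.1 ⟨V, le_rfl⟩ e := by
  constructor
  · intro c d h
    refine Subtype.ext (funext fun W => funext fun e' => ?_)
    choose v hv using fun i => ((e i).res W.2).exists_eq_smul (e' i)
    obtain rfl : e' = _ := funext hv
    rw [c.2.2, d.2.2]
    refine congrArg _ ?_
    exact (c.2.1 ⟨V, le_rfl⟩ W.1 W.2 e).symm.trans ((congrArg _ h).trans (d.2.1 ⟨V, le_rfl⟩ W.1 W.2 e))
  · intro g
    choose v hv using fun (W : {W : X.Opens // W ≤ V}) (e' : ∀ i, Frame (L i) W.1) i =>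
      ((e i).res W.2).exists_eq_smul (e' i)
    have huniq : ∀ W e' w, (∀ i, e' i = ((e i).res W.2).smul (w i)) → v W e' = w :=
      fun W e' w h => funext fun i => ((e i).res W.2).smul_injective ((hv W e' i).symm.trans (h i))
    refine ⟨⟨fun W e' => ((∏ i, v W e' i ^ (-a i) : Γ(X, W.1)ˣ) : Γ(X, W.1)) *
      X.presheaf.map (homOfLE W.2).op g, ?_, ?_⟩, ?_⟩
    · intro W W' h e'
      dsimp only
      rw [huniq ⟨W', h.trans W.2⟩ _ (fun i => Units.map (X.presheaf.map (homOfLE h).op).hom (v W e' i))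
        (fun i => by
          exact (congrArg (Frame.res · h) (hv W e' i)).trans (by
            rw [Frame.res_smul, Frame.res_res])), map_mul, res_res_apply]
      refine congrArg (· * _) ?_
      simp only [← map_zpow, ← map_prod, Units.coe_map]
      rfl
    · intro W w e'
      dsimp only
      rw [huniq W _ (fun i => w i * v W e' i) (fun i => by
        exact (congrArg (Frame.smul (w i)) (hv W e' i)).trans (Frame.smul_smul _ _ _))]
      simp only [mul_zpow, Finset.prod_mul_distrib, Units.val_mul, mul_assoc]
    · have : v ⟨V, le_rfl⟩ e = 1 := huniq _ _ _ fun i => by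
        rw [Frame.res_self]; exact (Frame.ext (one_smul _ _)).symm
      change _ * _ = g
      rw [this]
      simp only [Pi.one_apply, one_zpow, Finset.prod_const_one, Units.val_one, one_mul]
      exact congrArg (fun f => f g) (congrArg ConcreteCategory.hom (X.presheaf.map_id (op V)))
/-- The multiplication `L^a ⊗ L^b → L^(a + b)`, which makes the direct sum of the modules of
sections of the `L^a` a commutative ring. -/
instance (V : X.Opens) : SetLike.GradedMonoid fun a => tensorPowSections L a V where
  one_mem := ⟨fun _ _ _ _ => map_one _, fun _ _ _ => by simp⟩
  mul_mem {a b c d} hc hd :=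
    ⟨fun W W' h e => (map_mul _ _ _).trans (congrArg₂ (· * ·) (hc.1 W W' h e) (hd.1 W W' h e)),
      fun W v e => (congrArg₂ (· * ·) (hc.2 W v e) (hd.2 W v e)).trans (by
        simp only [Pi.add_apply, neg_add, zpow_add, Finset.prod_mul_distrib, Units.val_mul]
        exact mul_mul_mul_comm _ _ _ _)⟩

/-- Functions act on the sections of `L^a`. -/
instance tensorPowModule (a : Fin q → ℤ) (V : X.Opens) : Module Γ(X, V) (tensorPowSections L a V) where
  smul r c := ⟨fun W e => X.presheaf.map (homOfLE W.2).op r * c.1 W e, fun W W' h e => by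
      refine (map_mul _ _ _).trans (congrArg₂ (· * ·) ?_ (c.2.1 W W' h e))
      rw [← ConcreteCategory.comp_apply, ← Functor.map_comp]
      rfl,
    fun W v e => (congrArg _ (c.2.2 W v e)).trans (mul_left_comm _ _ _)⟩
  one_smul c := Subtype.ext <| funext fun W => funext fun e =>
    (congrArg (· * c.1 W e) (map_one _)).trans (one_mul _)
  mul_smul _ _ c := Subtype.ext <| funext fun W => funext fun e =>
    (congrArg (· * c.1 W e) (map_mul _ _ _)).trans (mul_assoc _ _ _)
  smul_zero _ := Subtype.ext <| funext fun _ => funext fun _ => mul_zero _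
  smul_add _ _ _ := Subtype.ext <| funext fun _ => funext fun _ => mul_add _ _ _
  add_smul _ _ c := Subtype.ext <| funext fun W => funext fun e =>
    (congrArg (· * c.1 W e) (map_add _ _ _)).trans (add_mul _ _ _)
  zero_smul c := Subtype.ext <| funext fun W => funext fun e =>
    (congrArg (· * c.1 W e) (map_zero _)).trans (zero_mul _)

/-- The presheaf of abelian groups `L^a`. -/
abbrev tensorPowPresheaf (a : Fin q → ℤ) : TopCat.Presheaf AddCommGrpCat.{u} X where
  obj V := AddCommGrpCat.of (tensorPowSections L a V.unop)
  map {V V'} i := AddCommGrpCat.ofHom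
    { toFun := fun c => ⟨fun W e => c.1 ⟨W.1, W.2.trans (leOfHom i.unop)⟩ e,
        fun W => c.2.1 ⟨W.1, W.2.trans (leOfHom i.unop)⟩,
        fun W => c.2.2 ⟨W.1, W.2.trans (leOfHom i.unop)⟩⟩
      map_zero' := rfl
      map_add' := fun _ _ => rfl }

lemma isSheaf_tensorPowPresheaf (a : Fin q → ℤ) :
    TopCat.Presheaf.IsSheaf (tensorPowPresheaf L a ⋙ forget AddCommGrpCat) := by
  rw [TopCat.Presheaf.isSheaf_iff_isSheafUniqueGluing_types]
  intro ι U sf hsf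
  let T : ∀ i, tensorPowSections L a (U i) := sf
  have hT : ∀ i j (W : X.Opens) (hi : W ≤ U i) (hj : W ≤ U j) (e : ∀ k, Frame (L k) W),
      (T i).1 ⟨W, hi⟩ e = (T j).1 ⟨W, hj⟩ e := fun i j W hi hj e =>
    congrFun (congrFun (congrArg Subtype.val (hsf i j)) ⟨W, le_inf hi hj⟩) e
  have hcov : ∀ W : X.Opens, W ≤ iSup U → W ≤ ⨆ i, W ⊓ U i := fun W hW => by
    rw [← inf_iSup_eq]; exact le_inf le_rfl hW
  have hglue : ∀ (W : {W : X.Opens // W ≤ iSup U}) (e : ∀ k, Frame (L k) W.1),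
      ∃ g : Γ(X, W.1), ∀ i, X.presheaf.map (homOfLE (inf_le_left : W.1 ⊓ U i ≤ W.1)).op g =
        (T i).1 ⟨W.1 ⊓ U i, inf_le_right⟩ fun k => (e k).res inf_le_left := by
    intro W e
    refine (X.sheaf.existsUnique_gluing' (fun i => W.1 ⊓ U i) W.1
      (fun i => homOfLE inf_le_left) (hcov W.1 W.2)
      (fun i => (T i).1 ⟨W.1 ⊓ U i, inf_le_right⟩ fun k => (e k).res inf_le_left) ?_).exists
    intro i j
    refine ((T i).2.1 ⟨W.1 ⊓ U i, inf_le_right⟩ _ inf_le_left _).trans ?_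
    refine Eq.trans ?_ ((T j).2.1 ⟨W.1 ⊓ U j, inf_le_right⟩ _ inf_le_right _).symm
    simp only [Frame.res_res]
    exact hT i j _ _ _ _
  choose c hc using hglue
  have hc' : ∀ (W : {W : X.Opens // W ≤ iSup U}) (e : ∀ k, Frame (L k) W.1) (W' : X.Opens)
      (h : W' ≤ W.1) (i) (hi : W' ≤ U i), X.presheaf.map (homOfLE h).op (c W e) =
        (T i).1 ⟨W', hi⟩ fun k => (e k).res h := by
    intro W e W' h i hi
    rw [← res_res_apply inf_le_left (le_inf h hi), hc]
    refine ((T i).2.1 ⟨W.1 ⊓ U i, inf_le_right⟩ _ _ _).trans ?_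
    simp only [Frame.res_res]
  have hext : ∀ W : X.Opens, W ≤ iSup U → ∀ g g' : Γ(X, W),
      (∀ i, X.presheaf.map (homOfLE (inf_le_left : W ⊓ U i ≤ W)).op g =
        X.presheaf.map (homOfLE (inf_le_left : W ⊓ U i ≤ W)).op g') → g = g' :=
    fun W hW g g' h => X.sheaf.eq_of_locally_eq' (fun i => W ⊓ U i) W
      (fun i => homOfLE inf_le_left) (hcov W hW) g g' h
  refine ⟨(⟨c, ?_, ?_⟩ : tensorPowSections L a (iSup U)), ?_, ?_⟩
  · intro W W' h e
    refine hext W' (h.trans W.2) _ _ fun i => ?_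
    rw [res_res_apply, hc' W e _ _ i inf_le_right,
      hc' ⟨W', h.trans W.2⟩ _ _ _ i inf_le_right]
    simp only [Frame.res_res]
  · intro W v e
    refine hext W.1 W.2 _ _ fun i => ?_
    rw [hc, map_mul, hc]
    simp only [Frame.res_smul]
    refine ((T i).2.2 ⟨W.1 ⊓ U i, inf_le_right⟩ _ _).trans (congrArg (· * _) ?_)
    simp only [← map_zpow, ← map_prod, Units.coe_map]
    rfl
  · intro i
    refine Subtype.ext (funext fun W => funext fun e => ?_)
    have := hc' ⟨W.1, W.2.trans (le_iSup U i)⟩ e W.1 le_rfl i W.2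
    refine Eq.trans ?_ (this.trans ?_)
    · exact (congrArg (fun f => f (c ⟨W.1, W.2.trans (le_iSup U i)⟩ e))
        (congrArg ConcreteCategory.hom (X.presheaf.map_id (op W.1)))).symm
    · simp only [Frame.res_self]; rfl
  · intro (d : tensorPowSections L a (iSup U)) hd
    refine Subtype.ext (funext fun W => funext fun e => hext W.1 W.2 _ _ fun i => ?_)
    refine Eq.trans ?_ (hc W e i).symm
    refine (d.2.1 W _ _ e).trans ?_
    exact congrFun (congrFun (congrArg Subtype.val (hd i)) ⟨W.1 ⊓ U i, inf_le_right⟩) _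

/-- The invertible sheaf `L^a = L_1^{⊗ a_1} ⊗ ... ⊗ L_q^{⊗ a_q}`. -/
def tensorPow (a : Fin q → ℤ) : X.Modules :=
  mkModules X (tensorPowPresheaf L a) (inst := fun V => tensorPowModule L a V)
    (fun V V' i r c => Subtype.ext <| funext fun W => funext fun e => by
      refine congrArg (· * c.1 ⟨W.1, W.2.trans (leOfHom i)⟩ e) ?_
      change _ = X.presheaf.map _ (X.presheaf.map _ _)
      rw [← ConcreteCategory.comp_apply, ← Functor.map_comp]
      rfl)
    (isSheaf_tensorPowPresheaf L a)

variable {L}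

/-- The open locus where a global section of `L^a` does not vanish. -/
def nonvanishing {a : Fin q → ℤ} (c : tensorPowSections L a ⊤) : X.Opens :=
  ⨆ (W : {W : X.Opens // W ≤ ⊤}) (e : ∀ i, Frame (L i) W.1), X.basicOpen (c.1 W e)

/-- The common zero locus of a set of elements of the section ring: the set of the points
where all their homogeneous components vanish. -/
def sectionZeroLocus (S : Set (⨁ a, tensorPowSections L a (⊤ : X.Opens))) : Set X :=
  {x | ∀ t ∈ S, ∀ a, x ∉ nonvanishing (t a)}

lemma isClosed_sectionZeroLocus (S : Set (⨁ a, tensorPowSections L a (⊤ : X.Opens))) :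
    IsClosed (sectionZeroLocus S) := by
  have : sectionZeroLocus S = ⋂ t ∈ S, ⋂ a, (nonvanishing (t a) : Set X)ᶜ := by
    ext x; simp [sectionZeroLocus]
  rw [this]
  exact isClosed_biInter fun t _ => isClosed_iInter fun a => (nonvanishing (t a)).2.isClosed_compl

variable {R : Type u} {σ : Type*} [CommRing R] [SetLike σ R] [AddSubgroupClass σ R]
  {𝒜 : (Fin q → ℤ) → σ} [GradedRing 𝒜]

/-- The complement of `B = V(s(R_#)) ∪ V(s(J))`. -/
def definedLocus (s : R →+* ⨁ a, tensorPowSections L a (⊤ : X.Opens)) (J : HomogeneousIdeal 𝒜) :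
    X.Opens :=
  ⟨(sectionZeroLocus (s '' (irrelevant 𝒜 : Set R)) ∪ sectionZeroLocus (s '' (J : Set R)))ᶜ,
    ((isClosed_sectionZeroLocus _).union (isClosed_sectionZeroLocus _)).isOpen_compl⟩

end Frames

/-- The pullback of a global section of a sheaf of modules along a morphism of schemes. -/
def pullbackSection {X Y : Scheme.{u}} (f : X ⟶ Y) {M : Y.Modules} (m : Γ(M, ⊤)) :
    Γ((Scheme.Modules.pullback f).obj M, ⊤) :=
  ((Scheme.Modules.pullbackPushforwardAdjunction f).unit.app M).app ⊤ m

end MultiProj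

end

open MultiProj

/-! Near a point `y` of `X - B` choose generators of `L_1, ..., L_q`. They trivialise all `L^b` at
once, so taking germs of coefficients turns `s` into a ring homomorphism `τ` from `R` to the local
ring at `y` (`germHom`). Other generators multiply `τ` on `R_a` by a unit `v(a)`, where `v` is a
character of `ℤ^q` (`exists_germHom_eq`). Hence the invertibility of `τ t` for homogeneous `t`, and
the value `τ r / τ t` of a fraction of degree `0`, do not depend on the generators.

Existence. The homogeneous elements with noninvertible image generate a homogeneous prime `β y`. It
is a point of `Proj R` because `y` is not in `V(s(R_#))`, and it lies in `U` because `y` is not in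
`V(s(J))`. The rule `r / t ↦ s r / s t` in degree `0` then gives the morphism of sheaves
(`exists_isCompatible`). In degree `a` the value `τ r / τ t` changes by `v(a)` with the generators,
and this is the rule for the coefficients of a section of `L^{a'}`. So there is a map from `𝒪(a)` to
the direct image of `L^{a'}`, and `e_a` is its adjoint. On `P_a` the sheaf `𝒪(a)` is locally
generated by fractions with nowhere vanishing numerator and denominator. Their images generate
`L^{a'}`, and a map out of a pullback that takes a generator to a generator is bijective
(`bijective_app_of_frame`).

Uniqueness. Condition (2) and linearity give `φ^*(r / t) · s t = s r`. This determines `φ` once it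
is known that `t ∉ φ y` exactly when `s t` is invertible at `y` (`isCompatible_of_isTwistMap`). For
one direction, some power `t^N` with `N > 0` lies in a degree where `𝒪` is invertible near `φ y`,
and is compared with a generator there. For the other, a relevant `h` with `s h` invertible at `y`
allows a power of `t` to be completed to a fraction of degree `0` with denominator a power of `h`.
Both parts meet in the notion `IsCompatible`, and a compatible morphism is unique
(`IsCompatible.unique`). -/

noncomputable section

namespace MultiProj

/-! ### Values of homogeneous fractions under a ring homomorphism -/

section FractionRelation

variable {q : ℕ} {R : Type u} {σ : Type*} [CommRing R] [SetLike σ R]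
  (𝒜 : (Fin q → ℤ) → σ) {S : Type*} [CommRing S]

/-- A ring homomorphism `τ` inverts the homogeneous elements outside `p`. -/
def InvertsAt (τ : R →+* S) (p : Ideal R) : Prop :=
  ∀ i, ∀ t ∈ 𝒜 i, t ∉ p → IsUnit (τ t)

/-- The element `γ` is the value `τ r / τ t` on a homogeneous fraction `w = r / t` of degree
`a`. -/
def FracRel (τ : R →+* S) {p : Ideal R} [p.IsPrime] (a : Fin q → ℤ)
    (w : Localization.AtPrime p) (γ : S) : Prop :=
  ∃ (i : Fin q → ℤ) (r : 𝒜 (i + a)) (t : 𝒜 i) (ht : t.1 ∉ p),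
    w = Localization.mk r.1 ⟨t.1, ht⟩ ∧ γ * τ t.1 = τ r.1

variable {𝒜} {τ : R →+* S} {p : Ideal R} [hp : p.IsPrime] {a b : Fin q → ℤ}
  {w w' : Localization.AtPrime p} {γ γ' : S}

lemma FracRel.of_mk {i : Fin q → ℤ} {r t : R} (hr : r ∈ 𝒜 (i + a)) (ht : t ∈ 𝒜 i) (htp : t ∉ p)
    (h : γ * τ t = τ r) : FracRel 𝒜 τ a (Localization.mk r ⟨t, htp⟩) γ :=
  ⟨i, ⟨r, hr⟩, ⟨t, ht⟩, htp, rfl, h⟩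

/-- The behaviour of `FracRel` when the homomorphism is multiplied by a character of the group
of degrees. -/
lemma FracRel.twist {τ' : R →+* S} (v : (Fin q → ℤ) → Sˣ) (hv : ∀ i j, v (i + j) = v i * v j)
    (hτ' : ∀ i, ∀ r ∈ 𝒜 i, τ' r = v i * τ r) (h : FracRel 𝒜 τ a w γ) :
    FracRel 𝒜 τ' a w (v a * γ) := by
  obtain ⟨i, ⟨r, hr⟩, ⟨t, ht⟩, htp, rfl, h⟩ := h
  refine FracRel.of_mk hr ht htp ?_
  rw [hτ' _ _ hr, hτ' _ _ ht, hv]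
  push_cast
  dsimp only at h
  linear_combination (v a * v i : S) * h

variable [AddSubgroupClass σ R] [GradedRing 𝒜]

/-- Two representations of `w` are identified by a multiplier `c` outside `p`, which need not be
homogeneous, whereas `τ` inverts only homogeneous elements outside `p`. Homogeneity of `p` allows
`c` to be replaced by one of its components. -/
lemma FracRel.unique (hph : p.IsHomogeneous 𝒜) (hτ : InvertsAt 𝒜 τ p)
    (h : FracRel 𝒜 τ a w γ) (h' : FracRel 𝒜 τ a w γ') : γ = γ' := by
  obtain ⟨i, ⟨r, hr⟩, ⟨t, ht⟩, htp, hw, h⟩ := h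
  obtain ⟨i', ⟨r', hr'⟩, ⟨t', ht'⟩, htp', hw', h'⟩ := h'
  rw [hw, Localization.mk_eq_mk_iff, Localization.r_iff_exists] at hw'
  obtain ⟨⟨c, hcp⟩, hc⟩ := hw'
  dsimp only at hc h h'
  -- Some component `c_k` lies outside `p`. As `t' r` and `t r'` have the same degree, the relation
  -- `c t' r = c t r'` can be read off with `c_k` in place of `c`.
  obtain ⟨k, hk⟩ := not_forall.mp ((hph.mem_iff 𝒜).not.mp hcp)
  have d1 : t' * r ∈ 𝒜 (i' + (i + a)) := SetLike.mul_mem_graded ht' hr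
  have d2 : t * r' ∈ 𝒜 (i' + (i + a)) := by
    convert SetLike.mul_mem_graded ht hr' using 2; abel
  have e1 := DirectSum.coe_decompose_mul_add_of_right_mem 𝒜 (i := k) (a := c) d1
  rw [hc, DirectSum.coe_decompose_mul_add_of_right_mem 𝒜 d2] at e1
  have u1 := hτ _ _ (SetLike.coe_mem _) hk
  have u2 := hτ _ _ ht htp
  have u3 := hτ _ _ ht' htp'
  have e2 := congrArg τ e1
  simp only [map_mul] at e2
  refine ((u1.mul u2).mul u3).mul_left_injective ?_
  dsimp only
  linear_combination (τ ((DirectSum.decompose 𝒜 c k : 𝒜 k) : R) * τ t') * h -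
    (τ ((DirectSum.decompose 𝒜 c k : 𝒜 k) : R) * τ t) * h' - e2

/-- `FracRel` provides the equation for some representation of the fraction; uniqueness of the value
transfers it to any prescribed one. -/
lemma FracRel.mul_eq (hph : p.IsHomogeneous 𝒜) (hτ : InvertsAt 𝒜 τ p) {i : Fin q → ℤ} {r t : R}
    (hr : r ∈ 𝒜 (i + a)) (ht : t ∈ 𝒜 i) {htp : t ∉ p}
    (h : FracRel 𝒜 τ a (Localization.mk r ⟨t, htp⟩) γ) : γ * τ t = τ r := by
  obtain ⟨v, hv⟩ := hτ i t ht htp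
  have h' : (τ r * ↑v⁻¹) * τ t = τ r := by rw [← hv, mul_assoc, Units.inv_mul, mul_one]
  rw [h.unique hph hτ (FracRel.of_mk hr ht htp h'), h']

lemma FracRel.add (h : FracRel 𝒜 τ a w γ) (h' : FracRel 𝒜 τ a w' γ') :
    FracRel 𝒜 τ a (w + w') (γ + γ') := by
  obtain ⟨i, ⟨r, hr⟩, ⟨t, ht⟩, htp, rfl, h⟩ := h
  obtain ⟨i', ⟨r', hr'⟩, ⟨t', ht'⟩, htp', rfl, h'⟩ := h'
  rw [Localization.add_mk]
  refine FracRel.of_mk (i := i + i') (add_mem ?_ ?_) (SetLike.mul_mem_graded ht ht') _ ?_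
  · rw [add_assoc]; exact SetLike.mul_mem_graded ht hr'
  · convert SetLike.mul_mem_graded ht' hr using 2; abel
  · simp only [map_add, map_mul] at *
    linear_combination τ t' * h + τ t * h'

lemma FracRel.mul (h : FracRel 𝒜 τ a w γ) (h' : FracRel 𝒜 τ b w' γ') :
    FracRel 𝒜 τ (a + b) (w * w') (γ * γ') := by
  obtain ⟨i, ⟨r, hr⟩, ⟨t, ht⟩, htp, rfl, h⟩ := h
  obtain ⟨i', ⟨r', hr'⟩, ⟨t', ht'⟩, htp', rfl, h'⟩ := h'
  rw [Localization.mk_mul]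
  refine FracRel.of_mk (i := i + i') ?_ (SetLike.mul_mem_graded ht ht') _ ?_
  · convert SetLike.mul_mem_graded hr hr' using 2; abel
  · simp only [map_mul] at *
    linear_combination γ' * τ t' * h + τ r * h'

lemma FracRel.mul_zero_left (h : FracRel 𝒜 τ 0 w γ) (h' : FracRel 𝒜 τ b w' γ') :
    FracRel 𝒜 τ b (w * w') (γ * γ') := by
  simpa using h.mul h'

lemma fracRel_zero : FracRel 𝒜 τ a (0 : Localization.AtPrime p) 0 := by
  rw [← Localization.mk_zero ⟨1, (Ideal.ne_top_iff_one _).mp hp.ne_top⟩]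
  exact FracRel.of_mk (i := 0) (zero_mem _) (SetLike.one_mem_graded 𝒜) _ (by simp)

lemma fracRel_mk_one {r : R} (hr : r ∈ 𝒜 a) :
    FracRel 𝒜 τ a (Localization.mk r 1 : Localization.AtPrime p) (τ r) :=
  FracRel.of_mk (i := 0) (by rwa [zero_add]) (SetLike.one_mem_graded 𝒜)
    ((Ideal.ne_top_iff_one _).mp hp.ne_top) (by simp)

lemma fracRel_one : FracRel 𝒜 τ 0 (1 : Localization.AtPrime p) 1 := by
  rw [← Localization.mk_one, ← map_one τ]
  exact fracRel_mk_one (SetLike.one_mem_graded 𝒜)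

/-- The value of a fraction is a unit if the numerator is. -/
lemma FracRel.isUnit (hph : p.IsHomogeneous 𝒜) (hτ : InvertsAt 𝒜 τ p) {i : Fin q → ℤ} {r t : R}
    (hr : r ∈ 𝒜 (i + a)) (ht : t ∈ 𝒜 i) {htp : t ∉ p} (hrp : IsUnit (τ r))
    (h : FracRel 𝒜 τ a (Localization.mk r ⟨t, htp⟩) γ) : IsUnit γ :=
  isUnit_of_mul_isUnit_left (y := τ t) (by rwa [h.mul_eq hph hτ hr ht])

end FractionRelation

/-! ### Points of `Proj R` from homomorphisms to local rings -/

section CorePoint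

variable {q : ℕ} {R : Type u} {σ : Type*} [CommRing R] [SetLike σ R] [AddSubgroupClass σ R]
  (𝒜 : (Fin q → ℤ) → σ) [GradedRing 𝒜] {S : Type*} [CommRing S] [IsLocalRing S]

/-- The point of `Proj R` given by a homomorphism from `R` to a local ring for which the image of
the irrelevant ideal is not contained in the maximal ideal. -/
def corePoint (τ : R →+* S) (h : ∃ f ∈ irrelevant 𝒜, IsUnit (τ f)) : Point 𝒜 where
  asIdeal := (((IsLocalRing.maximalIdeal S).comap τ).homogeneousCore 𝒜).toIdeal
  isPrime := isPrime_homogeneousCore inferInstance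
  isHomogeneous := HomogeneousIdeal.isHomogeneous _
  not_irrelevant_le hle := by
    obtain ⟨f, hf, hu⟩ := h
    exact Ideal.toIdeal_homogeneousCore_le 𝒜 _ (hle hf) hu

variable {𝒜}

lemma mem_corePoint {τ : R →+* S} {h : ∃ f ∈ irrelevant 𝒜, IsUnit (τ f)} {i : Fin q → ℤ} {t : R}
    (ht : t ∈ 𝒜 i) : t ∉ (corePoint 𝒜 τ h).asIdeal ↔ IsUnit (τ t) := by
  rw [← not_iff_not, not_not]
  exact ⟨fun h' => Ideal.toIdeal_homogeneousCore_le 𝒜 _ h',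
    fun h' => Ideal.mem_homogeneousCore_of_homogeneous_of_mem ⟨_, ht⟩ h'⟩

/-- If all relevant elements went into the maximal ideal, so would the ideal they generate.
Relevance is what later provides complementary factors of suitable degree
(`IsRelevant.exists_unit`). -/
lemma exists_isRelevant_isUnit {τ : R →+* S} (h : ∃ f ∈ irrelevant 𝒜, IsUnit (τ f)) :
    ∃ f, IsRelevant 𝒜 f ∧ IsUnit (τ f) := by
  obtain ⟨f, hf, hu⟩ := h
  by_contra! hn
  have : (irrelevant 𝒜).toIdeal ≤ (IsLocalRing.maximalIdeal S).comap τ :=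
    Ideal.span_le.mpr fun g hg => hn g hg
  exact this hf hu

end CorePoint

/-! ### Gluing functions that are characterised by their germs -/

section GermGluing

variable {X : Scheme.{u}}

lemma section_ext_germ {O : X.Opens} {g g' : Γ(X, O)}
    (h : ∀ y (hy : y ∈ O), X.presheaf.germ O y hy g = X.presheaf.germ O y hy g') : g = g' :=
  TopCat.Presheaf.section_ext X.sheaf O g g' h

/-- A condition on germs which determines them and is locally satisfied by a function is
satisfied by a unique function. -/
lemma existsUnique_of_germ (O : X.Opens) (P : ∀ x : X, x ∈ O → X.presheaf.stalk x → Prop)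
    (huniq : ∀ x hx a b, P x hx a → P x hx b → a = b)
    (hloc : ∀ x, x ∈ O → ∃ (W : X.Opens) (_ : x ∈ W) (h : W ≤ O) (g : Γ(X, W)),
      ∀ y (hy : y ∈ W), P y (h hy) (X.presheaf.germ W y hy g)) :
    ∃! g : Γ(X, O), ∀ y (hy : y ∈ O), P y hy (X.presheaf.germ O y hy g) := by
  -- The local solutions agree on overlaps because the condition determines each germ, so they glue.
  choose W hxW hWO g hg using fun x : O => hloc x.1 x.2
  obtain ⟨s, hs, -⟩ := X.sheaf.existsUnique_gluing' W O (fun x => homOfLE (hWO x))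
    (fun x hx => Opens.mem_iSup.mpr ⟨⟨x, hx⟩, hxW ⟨x, hx⟩⟩) g (fun x y => by
      refine section_ext_germ fun z hz => ?_
      refine huniq z (hWO x hz.1) _ _ ?_ ?_
      · exact Eq.mp (congrArg _ (TopCat.Presheaf.germ_res_apply X.presheaf _ z hz _).symm)
          (hg x z hz.1)
      · exact Eq.mp (congrArg _ (TopCat.Presheaf.germ_res_apply X.presheaf _ z hz _).symm)
          (hg y z hz.2))
  refine ⟨s, fun y hy => ?_,
    fun s' hs' => section_ext_germ fun y hy => huniq y hy _ _ (hs' y hy) ?_⟩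
  all_goals
    have h1 := hg ⟨y, hy⟩ y (hxW ⟨y, hy⟩)
    rw [← hs ⟨y, hy⟩] at h1
    exact Eq.mp (congrArg _ (TopCat.Presheaf.germ_res_apply X.presheaf _ y (hxW ⟨y, hy⟩) _)) h1

end GermGluing

/-! ### The homomorphism `s` in terms of local generators -/

section FrameHom

variable {X : Scheme.{u}} {q : ℕ} {L : Fin q → X.Modules} {R : Type u} [CommRing R]
  (s : R →+* ⨁ a, tensorPowSections L a (⊤ : X.Opens))

/-- The coefficients with respect to frames of the `L_i` on `W` define a ring homomorphism to the
functions on `W`. -/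
def frameHom {W : X.Opens} (e : ∀ i, Frame (L i) W) : R →+* Γ(X, W) :=
  ((Pi.evalRingHom (fun _ : ∀ i, Frame (L i) W => Γ(X, W)) e).comp
    (Pi.evalRingHom (fun W : {W : X.Opens // W ≤ ⊤} => (∀ i, Frame (L i) W.1) → Γ(X, W.1))
      ⟨W, le_top⟩)).comp ((DirectSum.coeRingHom fun a => tensorPowSections L a ⊤).comp s)

/-- The germs at `x` of the coefficients with respect to frames on a neighbourhood of `x`. -/
def germHom {W : X.Opens} (e : ∀ i, Frame (L i) W) (x : X) (hx : x ∈ W) :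
    R →+* X.presheaf.stalk x :=
  (X.presheaf.germ W x hx).hom.comp (frameHom s e)

lemma germHom_apply {W : X.Opens} (e : ∀ i, Frame (L i) W) (x : X) (hx : x ∈ W) (r : R) :
    germHom s e x hx r = X.presheaf.germ W x hx (frameHom s e r) := rfl

variable {σ : Type*} [SetLike σ R] {𝒜 : (Fin q → ℤ) → σ} {α : (Fin q → ℤ) →+ (Fin q → ℤ)}
  {s}
  (hs : ∀ a, ∀ r ∈ 𝒜 a, s r ∈ (DirectSum.of (fun a => tensorPowSections L a ⊤) (α a)).range)

include hs

/-- `frameHom` adds the coefficients of all degrees, which makes it multiplicative. For `r` of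
degree `a` only the component of `s r` in degree `α a` contributes. -/
lemma frameHom_eq_coeff {W : X.Opens} (e : ∀ i, Frame (L i) W) {a : Fin q → ℤ} {r : R}
    (hr : r ∈ 𝒜 a) : frameHom s e r = (s r (α a)).1 ⟨W, le_top⟩ e := by
  obtain ⟨c, hc⟩ := hs a r hr
  have h1 : frameHom s e r = (DirectSum.coeRingHom (fun a => tensorPowSections L a ⊤) (s r))
    ⟨W, le_top⟩ e := rfl
  rw [h1, ← hc, DirectSum.coeRingHom_of, DirectSum.of_eq_same]

lemma frameHom_res {W W' : X.Opens} (h : W' ≤ W) (e : ∀ i, Frame (L i) W) {a : Fin q → ℤ} {r : R}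
    (hr : r ∈ 𝒜 a) : frameHom s (fun i => (e i).res h) r =
      X.presheaf.map (homOfLE h).op (frameHom s e r) := by
  rw [frameHom_eq_coeff hs _ hr, frameHom_eq_coeff hs _ hr]
  exact ((s r (α a)).2.1 ⟨W, le_top⟩ W' h e).symm

lemma frameHom_smul {W : X.Opens} (v : Fin q → Γ(X, W)ˣ) (e : ∀ i, Frame (L i) W)
    {a : Fin q → ℤ} {r : R} (hr : r ∈ 𝒜 a) : frameHom s (fun i => (e i).smul (v i)) r =
      ((∏ i, v i ^ (-(α a i)) : Γ(X, W)ˣ) : Γ(X, W)) * frameHom s e r := by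
  rw [frameHom_eq_coeff hs _ hr, frameHom_eq_coeff hs _ hr]
  exact (s r (α a)).2.2 ⟨W, le_top⟩ v e

/-- A change of frames multiplies the coefficients by a character of the group of degrees. -/
lemma exists_germHom_eq {W W' : X.Opens} (e : ∀ i, Frame (L i) W) (e' : ∀ i, Frame (L i) W')
    (x : X) (hx : x ∈ W) (hx' : x ∈ W') :
    ∃ v : (Fin q → ℤ) → (X.presheaf.stalk x)ˣ, (∀ i j, v (i + j) = v i * v j) ∧
      ∀ a, ∀ r ∈ 𝒜 a, germHom s e' x hx' r = v a * germHom s e x hx r := by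
  choose v hv using fun i =>
    ((e i).res (inf_le_left : W ⊓ W' ≤ W)).exists_eq_smul ((e' i).res inf_le_right)
  have hxx : x ∈ W ⊓ W' := ⟨hx, hx'⟩
  -- The character is `a ↦ ∏ v_i ^ (-(α a)_i)`, additive in `a` because `α` is.
  refine ⟨fun a => Units.map ((X.presheaf.germ (W ⊓ W') x hxx).hom : _ →* _)
    (∏ i, v i ^ (-(α a i))), fun a b => ?_, fun a r hr => ?_⟩
  · rw [← map_mul, ← Finset.prod_mul_distrib]
    refine congrArg _ (Finset.prod_congr rfl fun i _ => ?_)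
    rw [← zpow_add, map_add, Pi.add_apply, neg_add]
  · have h1 := frameHom_res hs (inf_le_left : W ⊓ W' ≤ W) e hr
    have h2 := frameHom_res hs (inf_le_right : W ⊓ W' ≤ W') e' hr
    simp only [hv] at h2
    rw [frameHom_smul hs _ _ hr, h1] at h2
    have h3 := congrArg (X.presheaf.germ (W ⊓ W') x hxx) h2
    rw [map_mul, TopCat.Presheaf.germ_res_apply, TopCat.Presheaf.germ_res_apply] at h3
    exact h3.symm

lemma isUnit_germHom_iff {W W' : X.Opens} (e : ∀ i, Frame (L i) W) (e' : ∀ i, Frame (L i) W')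
    (x : X) (hx : x ∈ W) (hx' : x ∈ W') {a : Fin q → ℤ} {r : R} (hr : r ∈ 𝒜 a) :
    IsUnit (germHom s e x hx r) ↔ IsUnit (germHom s e' x hx' r) := by
  obtain ⟨v, -, hv⟩ := exists_germHom_eq hs e e' x hx hx'
  rw [hv a r hr, Units.isUnit_units_mul]

/-- The values of fractions of degree `0` do not depend on the frames. -/
lemma fracRel_germHom_of_fracRel {p : Ideal R} [p.IsPrime] {W W' : X.Opens}
    (e : ∀ i, Frame (L i) W) (e' : ∀ i, Frame (L i) W') (x : X) (hx : x ∈ W) (hx' : x ∈ W')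
    {w : Localization.AtPrime p} {γ : X.presheaf.stalk x}
    (h : FracRel 𝒜 (germHom s e x hx) 0 w γ) : FracRel 𝒜 (germHom s e' x hx') 0 w γ := by
  obtain ⟨v, hv, hv'⟩ := exists_germHom_eq hs e e' x hx hx'
  have h1 := h.twist v hv hv'
  have h2 : v 0 = 1 := by simpa using hv 0 0
  rwa [h2, Units.val_one, one_mul] at h1

variable [AddSubgroupClass σ R] [GradedRing 𝒜]

/-- Outside the zero locus of a homogeneous ideal `I`, some homogeneous element of `I` does not
vanish. -/
lemma exists_isUnit_germHom {I : HomogeneousIdeal 𝒜} {x : X}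
    (hx : x ∉ sectionZeroLocus (s '' (I : Set R))) {W : X.Opens} (e : ∀ i, Frame (L i) W)
    (hxW : x ∈ W) : ∃ b, ∃ f ∈ 𝒜 b, f ∈ I ∧ IsUnit (germHom s e x hxW f) := by
  classical
  simp only [sectionZeroLocus, Set.mem_ofPred_eq, not_forall, not_not] at hx
  obtain ⟨_, ⟨t, ht, rfl⟩, a, hxa⟩ := hx
  obtain ⟨W', hxa⟩ := Opens.mem_iSup.mp hxa
  obtain ⟨e', hxa⟩ := Opens.mem_iSup.mp hxa
  have hxW' : x ∈ W'.1 := X.basicOpen_le _ hxa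
  rw [Scheme.mem_basicOpen _ _ _ hxW'] at hxa
  let G : (⨁ a, tensorPowSections L a (⊤ : X.Opens)) →+ X.presheaf.stalk x :=
    { toFun := fun c => X.presheaf.germ W'.1 x hxW' ((c a).1 W' e')
      map_zero' := map_zero _
      map_add' := fun c d => map_add (X.presheaf.germ W'.1 x hxW').hom _ _ }
  -- `G` takes the germ of the coefficient in the one degree `a` in which `s t` does not vanish at
  -- `x`. Several components of `t` may contribute to it, since `α` need not be injective, but in a
  -- local ring a sum that is a unit has a summand that is a unit.
  have h1 : IsUnit (∑ b ∈ (DirectSum.decompose 𝒜 t).support,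
      G (s (DirectSum.decompose 𝒜 t b : 𝒜 b))) := by
    rw [← map_sum, ← map_sum, DirectSum.sum_support_decompose 𝒜 t]
    exact hxa
  obtain ⟨b, hb⟩ : ∃ b, IsUnit (G (s (DirectSum.decompose 𝒜 t b : 𝒜 b))) := by
    by_contra! hn
    exact (IsLocalRing.maximalIdeal _).sum_mem (fun b _ => hn b) h1
  have hmem : ((DirectSum.decompose 𝒜 t b : 𝒜 b) : R) ∈ 𝒜 b := SetLike.coe_mem _
  refine ⟨b, _, hmem, I.isHomogeneous b ht, ?_⟩
  rw [isUnit_germHom_iff hs e e' x hxW hxW' hmem, germHom_apply, frameHom_eq_coeff hs _ hmem]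
  -- A component `t_b` with `α b ≠ a` contributes `0`, which is not a unit in a stalk.
  obtain rfl : α b = a := by
    by_contra hne
    obtain ⟨c, hc⟩ := hs b _ hmem
    have : G (s (DirectSum.decompose 𝒜 t b : 𝒜 b)) = 0 := by
      change X.presheaf.germ W'.1 x hxW' ((s (DirectSum.decompose 𝒜 t b : 𝒜 b) a).1 W' e') = 0
      rw [← hc, DirectSum.of_eq_of_ne _ _ _ (Ne.symm hne)]
      exact map_zero _
    rw [this] at hb
    exact not_isUnit_zero hb
  exact hb

end FrameHom

lemma exists_frames {X : Scheme.{u}} {q : ℕ} {L : Fin q → X.Modules}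
    (hL : ∀ i, IsInvertible (L i)) (x : X) :
    ∃ W : X.Opens, x ∈ W ∧ Nonempty (∀ i, Frame (L i) W) := by
  choose W hx e using fun i => hL i x
  refine ⟨⨅ i, W i, ?_, ⟨fun i => (e i).some.res (iInf_le W i)⟩⟩
  rw [← SetLike.mem_coe, Opens.coe_iInf]
  exact Set.mem_iInter.mpr hx

/-! ### The map on points and the values of fractions as functions -/

section Lifting

variable {X : Scheme.{u}} {q : ℕ} {L : Fin q → X.Modules} {R : Type u} [CommRing R]
  {σ : Type*} [SetLike σ R] [AddSubgroupClass σ R] {𝒜 : (Fin q → ℤ) → σ} [GradedRing 𝒜]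
  {s : R →+* ⨁ a, tensorPowSections L a (⊤ : X.Opens)}
  {Y : X.Opens}

variable (s) in
/-- The points `β y` consist, in each degree, of the elements of `R` whose image under `s`
vanishes at `y`. -/
def IsVanishingMap (β : Y → Point 𝒜) : Prop :=
  ∀ (y : Y) (W : X.Opens) (e : ∀ i, Frame (L i) W) (hy : y.1 ∈ W) (i : Fin q → ℤ), ∀ t ∈ 𝒜 i,
    t ∉ (β y).asIdeal ↔ IsUnit (germHom s e y.1 hy t)

lemma IsVanishingMap.invertsAt {β : Y → Point 𝒜} (hβ : IsVanishingMap s β) (y : Y) {W : X.Opens}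
    (e : ∀ i, Frame (L i) W) (hy : y.1 ∈ W) :
    InvertsAt 𝒜 (germHom s e y.1 hy) (β y).asIdeal :=
  fun i t ht h => (hβ y W e hy i t ht).mp h

/-- Over an open set with frames, the preimage of the locus `t ≠ 0` is the locus where the
coefficient of `s t` is invertible, and this is open. -/
lemma IsVanishingMap.continuous (hL : ∀ i, IsInvertible (L i)) {β : Y → Point 𝒜}
    (hβ : IsVanishingMap s β) : Continuous β := by
  refine (isTopologicalBasis_basicOpen 𝒜).continuous_iff.mpr ?_
  rintro _ ⟨t, ⟨i, ht⟩, rfl⟩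
  refine isOpen_iff_mem_nhds.mpr fun y hy => ?_
  obtain ⟨W, hyW, ⟨e⟩⟩ := exists_frames hL y.1
  have h1 : ∀ y' : Y, ∀ h : y'.1 ∈ W, t ∉ (β y').asIdeal ↔
      y'.1 ∈ X.basicOpen (frameHom s e t) := fun y' h => by
    rw [hβ y' W e h i t ht, Scheme.mem_basicOpen _ _ _ h]; rfl
  have h2 : Subtype.val ⁻¹' (X.basicOpen (frameHom s e t) : Set X) ∈ nhds y :=
    (((X.basicOpen (frameHom s e t)).2.preimage continuous_subtype_val).mem_nhds
      ((h1 y hyW).mp hy))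
  refine Filter.mem_of_superset h2 fun y' hy' => ?_
  exact (h1 y' (X.basicOpen_le _ hy')).mpr hy'

/-- Functions which are locally homogeneous fractions of degree `0` are sections of `𝒪(0)`. -/
lemma val_mem_twistSections {V : Opens (space 𝒜)} (z : sections 𝒜 V) :
    (fun x : V => (z.1 x).val) ∈ twistSections 𝒜 0 V := by
  intro x
  obtain ⟨V', hx, i', i, r, t, h, w⟩ := z.2 x
  exact ⟨V', hx, i', i, ⟨r.1, by rw [add_zero]; exact r.2⟩, t, h,
    fun y => congrArg HomogeneousLocalization.val (w y)⟩

/-- Locally there is a function whose germs are the values of a given section of `𝒪(a)`. -/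
lemma exists_local_fracRel (hL : ∀ i, IsInvertible (L i)) {β : Y → Point 𝒜}
    (hβ : IsVanishingMap s β)
    {a : Fin q → ℤ} {V : Opens (space 𝒜)} (z : twistSections 𝒜 a V) {W : X.Opens}
    (e : ∀ i, Frame (L i) W) (y : Y) (hyV : β y ∈ V) (hyW : y.1 ∈ W) :
    ∃ (N : X.Opens) (_ : y.1 ∈ N) (hNW : N ≤ W) (hNV : ∀ x ∈ N, ∃ h : x ∈ Y, β ⟨x, h⟩ ∈ V)
      (g : Γ(X, N)), ∀ x (hx : x ∈ N),
        FracRel 𝒜 (germHom s e x (hNW hx)) a (z.1 ⟨β ⟨x, (hNV x hx).1⟩, (hNV x hx).2⟩)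
          (X.presheaf.germ N x hx g) := by
  obtain ⟨V', hyV', i', i, r, t, h, w⟩ := z.2 ⟨β y, hyV⟩
  have hO : IsOpen (β ⁻¹' (V' : Set (Point 𝒜))) := V'.2.preimage (hβ.continuous hL)
  let D : X.Opens := X.basicOpen (frameHom s e t.1)
  -- On `N` the section `z` is the single fraction `r / t`, and the coefficient of `s t` is
  -- invertible; the required function is the quotient of the two coefficients.
  let N : X.Opens := Y.ι ''ᵁ (⟨_, hO⟩ : Opens Y) ⊓ D
  have hND : N ≤ D := inf_le_right
  have hDW : D ≤ W := X.basicOpen_le _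
  have hN : ∀ x ∈ N, ∃ h : x ∈ Y, β ⟨x, h⟩ ∈ V' := by
    rintro x ⟨⟨y', hy', rfl⟩, -⟩
    exact ⟨y'.2, hy'⟩
  have hNV : ∀ x ∈ N, ∃ h : x ∈ Y, β ⟨x, h⟩ ∈ V := fun x hx =>
    ⟨(hN x hx).1, leOfHom i' (hN x hx).2⟩
  have hu : IsUnit (X.presheaf.map (homOfLE (hND.trans hDW)).op (frameHom s e t.1)) := by
    have h1 : IsUnit (X.presheaf.map (homOfLE hDW).op (frameHom s e t.1)) :=
      RingedSpace.isUnit_res_basicOpen _ _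
    have h2 := h1.map (X.presheaf.map (homOfLE hND).op).hom
    rwa [res_res_apply] at h2
  obtain ⟨v, hv⟩ := hu
  refine ⟨N, ⟨⟨y, hyV', rfl⟩, ?_⟩, hND.trans hDW, hNV,
    X.presheaf.map (homOfLE (hND.trans hDW)).op (frameHom s e r.1) * (v⁻¹ : Γ(X, N)ˣ), ?_⟩
  · change y.1 ∈ D
    rw [Scheme.mem_basicOpen _ _ _ hyW]
    exact (hβ y W e hyW i t.1 t.2).mp (h ⟨β y, hyV'⟩)
  · intro x hx
    have h3 := w ⟨β ⟨x, (hN x hx).1⟩, (hN x hx).2⟩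
    refine Eq.mpr (congrArg (fun w => FracRel 𝒜 _ a w _) h3) (FracRel.of_mk r.2 t.2 _ ?_)
    have h4 : X.presheaf.map (homOfLE (hND.trans hDW)).op (frameHom s e r.1) * (v⁻¹ : Γ(X, N)ˣ) *
        X.presheaf.map (homOfLE (hND.trans hDW)).op (frameHom s e t.1) =
        X.presheaf.map (homOfLE (hND.trans hDW)).op (frameHom s e r.1) := by
      rw [← hv, mul_assoc, Units.inv_mul, mul_one]
    have h5 := congrArg (X.presheaf.germ N x hx) h4
    rw [map_mul, TopCat.Presheaf.germ_res_apply, TopCat.Presheaf.germ_res_apply] at h5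
    exact h5

variable {α : (Fin q → ℤ) →+ (Fin q → ℤ)}
  (hs : ∀ a, ∀ r ∈ 𝒜 a, s r ∈ (DirectSum.of (fun a => tensorPowSections L a ⊤) (α a)).range)

-- The condition ranges over all frames, which is consistent only because the values of fractions of
-- degree `0` are unaffected by a change of frames. This makes the pulled back function a canonical
-- object, so that identities between such functions can be checked on germs.
include hs in
lemma existsUnique_pullback (hL : ∀ i, IsInvertible (L i)) {β : Y → Point 𝒜}
    (hβ : IsVanishingMap s β) {V : Opens (space 𝒜)} (z : sections 𝒜 V) (O : X.Opens)
    (hO : ∀ x, x ∈ O ↔ ∃ h : x ∈ Y, β ⟨x, h⟩ ∈ V) :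
    ∃! g : Γ(X, O), ∀ y (hy : y ∈ O), ∀ (h : y ∈ Y) (hV : β ⟨y, h⟩ ∈ V) (W : X.Opens)
      (e : ∀ i, Frame (L i) W) (hyW : y ∈ W),
      FracRel 𝒜 (germHom s e y hyW) 0 (z.1 ⟨β ⟨y, h⟩, hV⟩).val (X.presheaf.germ O y hy g) := by
  refine existsUnique_of_germ O (fun y hy γ => ∀ (h : y ∈ Y) (hV : β ⟨y, h⟩ ∈ V) (W : X.Opens)
      (e : ∀ i, Frame (L i) W) (hyW : y ∈ W),
      FracRel 𝒜 (germHom s e y hyW) 0 (z.1 ⟨β ⟨y, h⟩, hV⟩).val γ) ?_ ?_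
  · intro x hx a b ha hb
    obtain ⟨h, hV⟩ := (hO x).mp hx
    obtain ⟨W, hxW, ⟨e⟩⟩ := exists_frames hL x
    exact (ha h hV W e hxW).unique (β ⟨x, h⟩).isHomogeneous (hβ.invertsAt _ _ _) (hb h hV W e hxW)
  · intro x hx
    obtain ⟨h, hV⟩ := (hO x).mp hx
    obtain ⟨W, hxW, ⟨e⟩⟩ := exists_frames hL x
    obtain ⟨N, hxN, hNW, hNV, g, hg⟩ :=
      exists_local_fracRel hL hβ ⟨_, val_mem_twistSections z⟩ e ⟨x, h⟩ hV hxW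
    exact ⟨N, hxN, fun y hy => (hO y).mpr (hNV y hy), g, fun y hy h hV W' e' hy' =>
      fracRel_germHom_of_fracRel hs e e' y (hNW hy) hy' (hg y hy)⟩

/-- The point of `Proj R` underlying a point of the scheme. -/
abbrev toPoint (p : multiProj 𝒜) : Point 𝒜 := p

/-- A morphism `Y ⟶ Proj R` is compatible with `s` if the pullback of a homogeneous fraction
`r / t` of degree `0` is `s r / s t`. -/
structure IsCompatible (s : R →+* ⨁ a, tensorPowSections L a (⊤ : X.Opens))
    (f : Y.toScheme ⟶ multiProj 𝒜) : Prop where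
  isVanishingMap : IsVanishingMap s (fun y : Y => toPoint (f y))
  fracRel : ∀ (V : Opens (space 𝒜)) (z : sections 𝒜 V) (y : Y) (hyV : toPoint (f y) ∈ V)
    (W : X.Opens) (e : ∀ i, Frame (L i) W) (hy : y.1 ∈ W),
    FracRel 𝒜 (germHom s e y.1 hy) 0 (z.1 ⟨toPoint (f y), hyV⟩).val
      (X.presheaf.germ (Y.ι ''ᵁ f ⁻¹ᵁ V) y.1 ⟨y, hyV, rfl⟩ (f.app V z))

/-- Frames are chosen separately at each point, and `β y` is the homogeneous core of the preimage of
the maximal ideal under the resulting `germHom`. Changing frames multiplies images of homogeneous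
elements by units, so the description of `β y` holds for all frames. -/
lemma exists_isVanishingMap (hL : ∀ i, IsInvertible (L i))
    (hs : ∀ a, ∀ r ∈ 𝒜 a, s r ∈ (DirectSum.of (fun a => tensorPowSections L a ⊤) (α a)).range)
    (hY : ∀ y ∈ Y, y ∉ sectionZeroLocus (s '' (irrelevant 𝒜 : Set R))) :
    ∃ β : Y → Point 𝒜, IsVanishingMap s β := by
  choose W hW e using fun y : Y => exists_frames hL y.1
  have h : ∀ y : Y, ∃ f ∈ irrelevant 𝒜, IsUnit (germHom s (e y).some y.1 (hW y) f) := fun y => by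
    obtain ⟨-, f, -, hf, hu⟩ := exists_isUnit_germHom hs (hY y.1 y.2) (e y).some (hW y)
    exact ⟨f, hf, hu⟩
  refine ⟨fun y => corePoint 𝒜 _ (h y), fun y W' e' hy i t ht => ?_⟩
  rw [mem_corePoint ht]
  exact isUnit_germHom_iff hs _ _ _ _ _ ht

end Lifting

/-! ### Existence and uniqueness of the compatible morphism -/

section Existence

variable {X : Scheme.{u}} {q : ℕ} {L : Fin q → X.Modules} {R : Type u} [CommRing R]
  {σ : Type*} [SetLike σ R] [AddSubgroupClass σ R] {𝒜 : (Fin q → ℤ) → σ} [GradedRing 𝒜]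
  {s : R →+* ⨁ a, tensorPowSections L a (⊤ : X.Opens)}
  {Y : X.Opens} {α : (Fin q → ℤ) →+ (Fin q → ℤ)}

lemma isUnit_sections {V : Opens (space 𝒜)} (z : sections 𝒜 V) (x : space 𝒜) (hx : x ∈ V)
    (h : IsUnit (z.1 ⟨x, hx⟩)) : IsUnit ((structurePresheaf 𝒜).germ V x hx z) := by
  have h1 : IsUnit ((stalkToLocal 𝒜 x).hom ((structurePresheaf 𝒜).germ V x hx z)) := by
    rw [stalkToLocal_germ]; exact h
  exact (MulEquiv.isUnit_map (stalkEquiv (𝒜 := 𝒜) x)).mp h1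

/-- Homogeneous fractions of degree `0` whose value at `y` is a unit are units. -/
lemma IsVanishingMap.isUnit_of_fracRel (hL : ∀ i, IsInvertible (L i)) {β : Y → Point 𝒜}
    (hβ : IsVanishingMap s β) (y : Y) (w : localRing 𝒜 (β y))
    {γ : X.presheaf.stalk y.1}
    (hγ : ∀ (W : X.Opens) (e : ∀ i, Frame (L i) W) (hy : y.1 ∈ W),
      FracRel 𝒜 (germHom s e y.1 hy) 0 w.val γ) : IsUnit γ ↔ IsUnit w := by
  obtain ⟨W, hyW, ⟨e⟩⟩ := exists_frames hL y.1
  obtain ⟨⟨i, ⟨r, hr⟩, ⟨t, ht⟩, htp⟩, rfl⟩ := HomogeneousLocalization.mk_surjective w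
  have h1 := hγ W e hyW
  rw [HomogeneousLocalization.val_mk] at h1
  have h2 := h1.mul_eq (β y).isHomogeneous (hβ.invertsAt y e hyW) (by rwa [add_zero]) ht
  have h3 : IsUnit (germHom s e y.1 hyW t) := (hβ y W e hyW i t ht).mp htp
  rw [isUnit_mk_iff, hβ y W e hyW i r hr, ← h2, IsUnit.mul_iff, and_iff_left h3]

/-- The pullback of each function is singled out by its germs. The ring homomorphism laws and the
compatibility with restriction therefore follow by checking that the two sides have the same
germwise values. -/
lemma exists_isCompatible (hL : ∀ i, IsInvertible (L i))
    (hs : ∀ a, ∀ r ∈ 𝒜 a, s r ∈ (DirectSum.of (fun a => tensorPowSections L a ⊤) (α a)).range)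
    (hY : ∀ y ∈ Y, y ∉ sectionZeroLocus (s '' (irrelevant 𝒜 : Set R))) :
    ∃ f : Y.toScheme ⟶ multiProj 𝒜, IsCompatible s f := by
  obtain ⟨β, hβ⟩ := exists_isVanishingMap hL hs hY
  let βc : Y.toScheme.carrier ⟶ space 𝒜 := TopCat.ofHom ⟨β, hβ.continuous hL⟩
  let O : Opens (space 𝒜) → X.Opens := fun V => Y.ι ''ᵁ ((Opens.map βc).obj V)
  have hO : ∀ V x, x ∈ O V ↔ ∃ h : x ∈ Y, β ⟨x, h⟩ ∈ V := fun V x =>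
    ⟨by rintro ⟨y, hy, rfl⟩; exact ⟨y.2, hy⟩, fun ⟨h, h'⟩ => ⟨⟨x, h⟩, h', rfl⟩⟩
  choose F hF hF' using fun (V : Opens (space 𝒜)) (z : sections 𝒜 V) =>
    existsUnique_pullback hs hL hβ z (O V) (hO V)
  let Fh : ∀ V : Opens (space 𝒜), sections 𝒜 V →+* Γ(X, O V) := fun V =>
    { toFun := F V
      map_one' := (hF' V 1 1 fun y hy h hV W e hyW => by
        rw [map_one]
        exact Eq.mpr (congrArg (fun w => FracRel 𝒜 _ 0 w _) HomogeneousLocalization.val_one)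
          fracRel_one).symm
      map_mul' := fun z z' => (hF' V _ _ fun y hy h hV W e hyW => by
        rw [map_mul]
        refine Eq.mpr (congrArg (fun w => FracRel 𝒜 _ 0 w _) ?_)
          ((hF V z y hy h hV W e hyW).mul_zero_left (hF V z' y hy h hV W e hyW))
        exact HomogeneousLocalization.val_mul _ _).symm
      map_zero' := (hF' V 0 0 fun y hy h hV W e hyW => by
        rw [map_zero]
        exact Eq.mpr (congrArg (fun w => FracRel 𝒜 _ 0 w _) HomogeneousLocalization.val_zero)
          fracRel_zero).symm
      map_add' := fun z z' => (hF' V _ _ fun y hy h hV W e hyW => by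
        rw [map_add]
        refine Eq.mpr (congrArg (fun w => FracRel 𝒜 _ 0 w _) ?_)
          ((hF V z y hy h hV W e hyW).add (hF V z' y hy h hV W e hyW))
        exact HomogeneousLocalization.val_add _ _).symm }
  let f₀ : PresheafedSpace.Hom Y.toScheme.toPresheafedSpace
      (toLocallyRingedSpace 𝒜).toPresheafedSpace :=
    { base := βc
      c :=
        { app := fun V => CommRingCat.ofHom (Fh V.unop)
          naturality := fun V V' i => by
            refine CommRingCat.hom_ext (RingHom.ext fun z => ?_)
            refine hF' V'.unop _ _ (fun y hy h hV W e hyW => ?_) |>.symm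
            have h1 := hF V.unop z y ((hO _ _).mpr ⟨h, leOfHom i.unop hV⟩) h
              (leOfHom i.unop hV) W e hyW
            refine Eq.mpr (congrArg (FracRel 𝒜 _ 0 _) ?_) h1
            exact TopCat.Presheaf.germ_res_apply X.presheaf
              (homOfLE (fun x hx => (hO _ _).mpr ⟨((hO _ _).mp hx).1,
                leOfHom i.unop ((hO _ _).mp hx).2⟩) : O V'.unop ⟶ O V.unop) y hy _ } }
  -- A fraction `r / t` is a unit at `β y` exactly when `r ∉ β y`, that is, when `s r` is a unit at
  -- `y`. The passage from the stalk of `Y` to that of `X` goes through basic open sets.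
  have hloc : ∀ y, IsLocalHom (f₀.stalkMap y).hom := fun y => by
    refine ⟨fun w hw => ?_⟩
    obtain ⟨V, hyV, z, rfl⟩ := (structurePresheaf 𝒜).exists_germ_eq w
    refine isUnit_sections z _ hyV ?_
    have h1 : IsUnit (Y.toScheme.presheaf.germ ((Opens.map βc).obj V) y hyV
        (Fh V z : Γ(X, O V))) := by
      have h2 := PresheafedSpace.stalkMap_germ_apply f₀ V y hyV z
      exact Eq.mp (congrArg IsUnit h2) hw
    have h2 : y ∈ Y.toScheme.basicOpen (U := (Opens.map βc).obj V) (Fh V z : Γ(X, O V)) :=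
      (Scheme.mem_basicOpen _ _ _ hyV).mpr h1
    have h3 : y.1 ∈ X.basicOpen (Fh V z : Γ(X, O V)) := by
      have h4 := Scheme.image_basicOpen Y.ι (U := (Opens.map βc).obj V)
        (Fh V z : Γ(X, O V))
      rw [Scheme.Opens.ι_appIso] at h4
      exact Eq.mp (congrArg (y.1 ∈ ·) h4) ⟨y, h2, rfl⟩
    rw [Scheme.mem_basicOpen _ _ _ ((hO V y.1).mpr ⟨y.2, hyV⟩)] at h3
    exact (hβ.isUnit_of_fracRel hL y _ fun W e hy => hF V z y.1 _ y.2 hyV W e hy).mp h3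
  let f₁ : Y.toScheme.toLocallyRingedSpace ⟶ toLocallyRingedSpace 𝒜 := ⟨f₀, hloc⟩
  exact ⟨(⟨f₁⟩ : Scheme.Hom Y.toScheme (multiProj 𝒜)), hβ, fun V z y hyV W e hy =>
    hF V z y.1 ((hO V y.1).mpr ⟨y.2, hyV⟩) y.2 hyV W e hy⟩

/-- A compatible morphism is unique. -/
lemma IsCompatible.unique (hL : ∀ i, IsInvertible (L i)) {f g : Y.toScheme ⟶ multiProj 𝒜}
    (hf : IsCompatible s f) (hg : IsCompatible s g) : f = g := by
  have hb : ∀ y : Y, toPoint (f y) = toPoint (g y) := fun y => by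
    obtain ⟨W, hyW, ⟨e⟩⟩ := exists_frames hL y.1
    refine Point.ext (Ideal.ext fun r => ?_)
    rw [(toPoint (f y)).isHomogeneous.mem_iff 𝒜, (toPoint (g y)).isHomogeneous.mem_iff 𝒜]
    refine forall_congr' fun i => not_iff_not.mp ?_
    exact (hf.isVanishingMap y W e hyW i _ (SetLike.coe_mem _)).trans
      (hg.isVanishingMap y W e hyW i _ (SetLike.coe_mem _)).symm
  have hbase : f.base = g.base := TopCat.hom_ext (ContinuousMap.ext hb)
  refine Scheme.Hom.ext hbase fun V => CommRingCat.hom_ext (RingHom.ext fun z => ?_)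
  refine section_ext_germ (X := X) (O := Y.ι ''ᵁ g ⁻¹ᵁ V) ?_
  rintro _ ⟨y, hy, rfl⟩
  obtain ⟨W, hyW, ⟨e⟩⟩ := exists_frames hL y.1
  have hy' : toPoint (f y) ∈ (V : Opens (space 𝒜)) :=
    (congrArg (fun p : space 𝒜 => p ∈ (V : Opens (space 𝒜))) (hb y)).mpr hy
  have h1 := hf.fracRel V z y hy' W e hyW
  have h2 := hg.fracRel V z y hy W e hyW
  -- The values of `z` at `f y` and `g y` lie in different types although the points are equal; `h3`
  -- transports the relation along this equality.
  have h3 : ∀ (p p' : space 𝒜) (hp : p ∈ (V : Opens (space 𝒜)))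
      (hp' : p' ∈ (V : Opens (space 𝒜))) (γ),
      p = p' → FracRel 𝒜 (germHom s e y.1 hyW) 0 ((show sections 𝒜 V from z).1 ⟨p, hp⟩).val γ →
      FracRel 𝒜 (germHom s e y.1 hyW) 0 ((show sections 𝒜 V from z).1 ⟨p', hp'⟩).val γ := by
    rintro p p' hp hp' γ rfl h
    exact h
  refine Eq.trans ?_ ((h3 _ _ hy' hy _ (hb y) h1).unique (toPoint (g y)).isHomogeneous
    (hg.isVanishingMap.invertsAt y e hyW) h2)
  exact TopCat.Presheaf.germ_res_apply X.presheaf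
    (eqToHom (congrArg (Y.ι ''ᵁ ·) congr((Opens.map $hbase.symm).obj V)) :
      Y.ι ''ᵁ g ⁻¹ᵁ V ⟶ Y.ι ''ᵁ f ⁻¹ᵁ V) y.1 ⟨y, hy, rfl⟩ (f.app V z)

end Existence

/-! ### Homomorphisms of sheaves of modules and local generators -/

section Modules

open Scheme.Modules

variable {X : Scheme.{u}} {M N : X.Modules}

/-- A morphism of sheaves of modules from compatible linear maps on sections. -/
def modulesHomMk (φ : ∀ U : X.Opens, Γ(M, U) →+ Γ(N, U))
    (hres : ∀ (U V : X.Opens) (h : V ≤ U) (x : Γ(M, U)),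
      φ V (M.presheaf.map (homOfLE h).op x) = N.presheaf.map (homOfLE h).op (φ U x))
    (hsmul : ∀ (U : X.Opens) (r : Γ(X, U)) (x : Γ(M, U)), φ U (r • x) = r • φ U x) : M ⟶ N :=
  (⟨PresheafOfModules.homMk (M₁ := M.val) (M₂ := N.val)
    { app := fun U => AddCommGrpCat.ofHom (φ U.unop)
      naturality := fun U V i => AddCommGrpCat.hom_ext (AddMonoidHom.ext fun x =>
        hres U.unop V.unop (leOfHom i.unop) x) }
    (fun U r x => hsmul U.unop r x)⟩ : SheafOfModules.Hom M N)

lemma hom_app_res (φ : M ⟶ N) {U V : X.Opens} (h : V ≤ U) (x : Γ(M, U)) :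
    φ.app V (M.presheaf.map (homOfLE h).op x) = N.presheaf.map (homOfLE h).op (φ.app U x) :=
  congr($(φ.mapPresheaf.naturality (homOfLE h).op) x)

lemma modules_res_res (M : X.Modules) {U V W : X.Opens} (h : V ≤ U) (h' : W ≤ V) (x : Γ(M, U)) :
    M.presheaf.map (homOfLE h').op (M.presheaf.map (homOfLE h).op x) =
      M.presheaf.map (homOfLE (h'.trans h)).op x := by
  rw [← ConcreteCategory.comp_apply, ← Functor.map_comp]
  rfl

lemma modules_res_self (M : X.Modules) {U : X.Opens} (x : Γ(M, U)) :
    M.presheaf.map (homOfLE le_rfl).op x = x :=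
  congrArg (fun f => f x) (congrArg ConcreteCategory.hom (M.presheaf.map_id (op U)))

/-- The homomorphism on `W` which maps the generator of a frame to a given section. -/
def homOfFrame {W : X.Opens} (e : Frame M W) (m : Γ(N, W)) :
    M.restrict W.ι ⟶ N.restrict W.ι :=
  have hW : ∀ U : W.toScheme.Opens, W.ι ''ᵁ U ≤ W := fun U => by
    rintro _ ⟨x, -, rfl⟩; exact x.2
  let E : ∀ U : W.toScheme.Opens, Γ(X, W.ι ''ᵁ U) ≃ Γ(M, W.ι ''ᵁ U) := fun U =>
    Equiv.ofBijective _ (e.bijective _ (hW U))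
  let m' : ∀ U : W.toScheme.Opens, Γ(N, W.ι ''ᵁ U) := fun U =>
    N.presheaf.map (homOfLE (hW U)).op m
  have hE : ∀ U r, E U r = (r • (M.presheaf.map (homOfLE (hW U)).op e.gen) : Γ(M, W.ι ''ᵁ U)) :=
    fun _ _ => rfl
  have hadd : ∀ U x y, (E U).symm (x + y) = (E U).symm x + (E U).symm y := fun U x y => by
    rw [Equiv.symm_apply_eq, hE, add_smul, ← hE, ← hE, Equiv.apply_symm_apply,
      Equiv.apply_symm_apply]
  have hsmul : ∀ (U : W.toScheme.Opens) (r : Γ(X, W.ι ''ᵁ U)) (x : Γ(M, W.ι ''ᵁ U)),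
      (E U).symm (r • x) • m' U = r • ((E U).symm x • m' U) := fun U r x => by
    rw [← mul_smul]
    refine congrArg (· • m' U) ?_
    rw [Equiv.symm_apply_eq, hE, mul_smul, ← hE, Equiv.apply_symm_apply]
  modulesHomMk (M := M.restrict W.ι) (N := N.restrict W.ι)
    (fun U => AddMonoidHom.mk' (fun x : Γ(M, W.ι ''ᵁ U) => ((E U).symm x • m' U : Γ(N, W.ι ''ᵁ U)))
      fun x y => (congrArg (· • m' U) (hadd U x y)).trans (add_smul _ _ _))
    (fun U V h x => by
      obtain ⟨r, rfl⟩ := (E U).surjective x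
      have h1 : W.ι ''ᵁ V ≤ W.ι ''ᵁ U := Scheme.Hom.image_mono _ h
      have h2 : (E V).symm (M.presheaf.map (homOfLE h1).op (E U r)) =
          X.presheaf.map (homOfLE h1).op r := by
        rw [Equiv.symm_apply_eq, hE, hE]
        refine (Scheme.Modules.map_smul M (homOfLE h1) _ _).trans ?_
        rw [modules_res_res]
      change (E V).symm (M.presheaf.map (homOfLE h1).op (E U r)) • m' V =
        N.presheaf.map (homOfLE h1).op ((E U).symm (E U r) • m' U)
      rw [h2, Equiv.symm_apply_apply]
      refine Eq.trans ?_ (Scheme.Modules.map_smul N (homOfLE h1) _ _).symm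
      exact congrArg (_ • ·) (modules_res_res N _ _ _).symm)
    (fun U r x => hsmul U ((W.ι.appIso U).inv r) x)

lemma homOfFrame_app {W : X.Opens} (e : Frame M W) (m : Γ(N, W)) (U : W.toScheme.Opens)
    (h : W.ι ''ᵁ U ≤ W) (r : Γ(X, W.ι ''ᵁ U)) :
    (homOfFrame e m).app U
        (r • M.presheaf.map (homOfLE h).op e.gen : Γ(M, W.ι ''ᵁ U)) =
      (r • N.presheaf.map (homOfLE h).op m : Γ(N, W.ι ''ᵁ U)) :=
  congrArg (· • (N.presheaf.map (homOfLE h).op m : Γ(N, W.ι ''ᵁ U)))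
    ((Equiv.ofBijective _ (e.bijective _ h)).symm_apply_apply r)

/-- Homomorphisms which agree on the generator of a frame on `V` are equal if the sections of
the target are determined by their restrictions to `V`. -/
lemma hom_ext_of_frame {V : X.Opens} (g : Frame M V)
    (hN : ∀ O : X.Opens, Function.Injective
      (N.presheaf.map (homOfLE (inf_le_left : O ⊓ V ≤ O)).op)) {a b : M ⟶ N}
    (h : a.app V g.gen = b.app V g.gen) : a = b := by
  refine Scheme.Modules.hom_ext _ _ fun O => AddCommGrpCat.hom_ext (AddMonoidHom.ext fun x => ?_)
  refine hN O ?_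
  refine (hom_app_res a _ x).symm.trans (Eq.trans ?_ (hom_app_res b _ x))
  obtain ⟨r, hr⟩ := (g.bijective (O ⊓ V) inf_le_right).2
    (M.presheaf.map (homOfLE (inf_le_left : O ⊓ V ≤ O)).op x)
  rw [← hr]
  refine (Scheme.Modules.Hom.app_smul a r _).trans
    (Eq.trans ?_ (Scheme.Modules.Hom.app_smul b r _).symm)
  rw [hom_app_res, hom_app_res, h]

/-- A homomorphism which is bijective on the sections on small open subsets of `P` is an
isomorphism on `P`. -/
lemma isIso_restrict_of_bijective (φ : M ⟶ N) (P : X.Opens)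
    (h : ∀ x ∈ P, ∃ W : X.Opens, x ∈ W ∧ ∀ W' ≤ W, Function.Bijective (φ.app W')) :
    IsIso ((restrictFunctor P.ι).map φ) := by
  refine Scheme.Modules.Hom.isIso_iff_isIso_app.mpr fun U => ?_
  rw [ConcreteCategory.isIso_iff_bijective]
  suffices h' : ∀ O ≤ P, Function.Bijective (φ.app O) from
    h' (P.ι ''ᵁ U) (by rintro _ ⟨x, -, rfl⟩; exact x.2)
  intro O hO
  choose W hxW hW using fun x : O => h x.1 (hO x.2)
  have hcov : O ≤ ⨆ x : O, O ⊓ W x := fun x hx =>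
    Opens.mem_iSup.mpr ⟨⟨x, hx⟩, hx, hxW ⟨x, hx⟩⟩
  -- Injectivity is needed on every smaller open set: it forces the local preimages to agree on
  -- overlaps in the proof of surjectivity.
  have hinj : ∀ O' ≤ O, Function.Injective (φ.app O') := by
    intro O' hO' m m' hm
    refine TopCat.Sheaf.eq_of_locally_eq' ⟨M.presheaf, M.isSheaf⟩ (fun x : O => O' ⊓ W x) O'
      (fun x => homOfLE inf_le_left)
      (fun x hx => Opens.mem_iSup.mpr ⟨⟨x, hO' hx⟩, hx, hxW _⟩) m m' fun x => ?_
    refine (hW x (O' ⊓ W x) inf_le_right).1 ?_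
    refine (hom_app_res φ _ _).trans (Eq.trans ?_ (hom_app_res φ _ _).symm)
    rw [hm]
  refine ⟨hinj O le_rfl, fun n => ?_⟩
  choose m hm using fun x : O => (hW x (O ⊓ W x) inf_le_right).2
    (N.presheaf.map (homOfLE inf_le_left).op n)
  obtain ⟨t, ht, -⟩ := TopCat.Sheaf.existsUnique_gluing' ⟨M.presheaf, M.isSheaf⟩
    (fun x : O => O ⊓ W x) O (fun x => homOfLE inf_le_left) hcov m (fun x y => by
      refine hinj _ (inf_le_left.trans inf_le_left) ?_
      refine (hom_app_res φ inf_le_left (m x)).trans (Eq.trans ?_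
        (hom_app_res φ inf_le_right (m y)).symm)
      rw [hm, hm, modules_res_res, modules_res_res])
  refine ⟨t, ?_⟩
  refine TopCat.Sheaf.eq_of_locally_eq' ⟨N.presheaf, N.isSheaf⟩ (fun x : O => O ⊓ W x) O
    (fun x => homOfLE inf_le_left) hcov _ _ fun x => ?_
  refine (hom_app_res φ _ _).symm.trans (Eq.trans ?_ (hm x))
  exact congrArg _ (ht x)

end Modules

/-! ### Homomorphisms out of a pullback -/

section Pullback

open Scheme.Modules

variable {Y Z : Scheme.{u}} (f : Y ⟶ Z) {M : Z.Modules} {N : Y.Modules}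

/-- The pullback of a section of a sheaf of modules on an open set. -/
def pullbackSectionOn {V : Z.Opens} (m : Γ(M, V)) : Γ((pullback f).obj M, f ⁻¹ᵁ V) :=
  ((pullbackPushforwardAdjunction f).unit.app M).app V m

variable {f}

lemma homEquiv_app (e : (pullback f).obj M ⟶ N) {V : Z.Opens} (m : Γ(M, V)) :
    ((pullbackPushforwardAdjunction f).homEquiv M N e).app V m =
      e.app (f ⁻¹ᵁ V) (pullbackSectionOn f m) := by
  rw [Adjunction.homEquiv_unit]
  rfl

lemma restrict_homEquiv_app (j : Y ⟶ Z) [IsOpenImmersion j] (c : M.restrict j ⟶ N) (O : Z.Opens)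
    (x : Γ(M, O)) : ((restrictAdjunction j).homEquiv M N c).app O x =
      c.app (j ⁻¹ᵁ O) (M.presheaf.map (homOfLE (j.image_preimage_le O)).op x) := by
  rw [Adjunction.homEquiv_unit]
  rfl

/-- By two adjunctions such homomorphisms correspond to homomorphisms from `M` to an iterated direct
image of `K`. The sections of the latter over `O` and over `O ⊓ V` are the same, so
`hom_ext_of_frame` applies. No description of the sections of the pullback is needed. -/
lemma restrict_pullback_hom_ext {V : Z.Opens} (g : Frame M V)
    {K : (f ⁻¹ᵁ V).toScheme.Modules}
    {a b : (restrictFunctor (f ⁻¹ᵁ V).ι).obj ((pullback f).obj M) ⟶ K}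
    (h : ∀ U (hU : (f ⁻¹ᵁ V).ι ''ᵁ U ≤ f ⁻¹ᵁ V),
      a.app U (((pullback f).obj M).presheaf.map (homOfLE hU).op (pullbackSectionOn f g.gen)) =
      b.app U (((pullback f).obj M).presheaf.map (homOfLE hU).op (pullbackSectionOn f g.gen))) :
    a = b := by
  refine ((restrictAdjunction (f ⁻¹ᵁ V).ι).homEquiv _ _).injective ?_
  refine ((pullbackPushforwardAdjunction f).homEquiv _ _).injective ?_
  refine hom_ext_of_frame g (fun O => ?_) ?_
  · have h1 : (f ⁻¹ᵁ V).ι ⁻¹ᵁ (f ⁻¹ᵁ (O ⊓ V)) = (f ⁻¹ᵁ V).ι ⁻¹ᵁ (f ⁻¹ᵁ O) :=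
      Opens.ext (Set.ext fun x => ⟨fun hx => hx.1, fun hx => ⟨hx, x.2⟩⟩)
    have h2 : ∀ U (hU : U = (f ⁻¹ᵁ V).ι ⁻¹ᵁ (f ⁻¹ᵁ O)), Function.Injective
        (K.presheaf.map (homOfLE hU.le).op) := by
      rintro _ rfl x y hxy
      rwa [modules_res_self, modules_res_self] at hxy
    exact h2 _ h1
  · rw [homEquiv_app, homEquiv_app, restrict_homEquiv_app, restrict_homEquiv_app]
    exact h _ _

/-- If a homomorphism from a pullback maps the pullback of a generator to a generator, then it is
bijective. -/
lemma bijective_app_of_frame (e : (pullback f).obj M ⟶ N) {V : Z.Opens} (g : Frame M V)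
    (n : Frame N (f ⁻¹ᵁ V)) (hn : e.app (f ⁻¹ᵁ V) (pullbackSectionOn f g.gen) = n.gen)
    {W : Y.Opens} (hW : W ≤ f ⁻¹ᵁ V) : Function.Bijective (e.app W) := by
  -- The inverse of `e` over the preimage of `V` sends the generator of `N` back to the pulled back
  -- generator. One composite is the identity by `restrict_pullback_hom_ext`, the other because the
  -- generator of `n` generates `N`.
  let i := homOfFrame n (pullbackSectionOn f g.gen)
  let e' := (restrictFunctor (f ⁻¹ᵁ V).ι).map e
  have he' : ∀ U (hU : (f ⁻¹ᵁ V).ι ''ᵁ U ≤ f ⁻¹ᵁ V),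
      e'.app U (((pullback f).obj M).presheaf.map (homOfLE hU).op (pullbackSectionOn f g.gen)) =
        N.presheaf.map (homOfLE hU).op n.gen := fun U hU =>
    (hom_app_res e hU (pullbackSectionOn f g.gen)).trans
      (congrArg (N.presheaf.map (homOfLE hU).op) hn)
  have hi : ∀ U (hU : (f ⁻¹ᵁ V).ι ''ᵁ U ≤ f ⁻¹ᵁ V),
      i.app U (N.presheaf.map (homOfLE hU).op n.gen) =
        ((pullback f).obj M).presheaf.map (homOfLE hU).op (pullbackSectionOn f g.gen) :=
    fun U hU => by
      have := homOfFrame_app n (pullbackSectionOn f g.gen) U hU 1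
      rwa [one_smul, one_smul] at this
  have h1 : e' ≫ i = 𝟙 _ := restrict_pullback_hom_ext g fun U hU =>
    (congrArg _ (he' U hU)).trans (hi U hU)
  have h2 : i ≫ e' = 𝟙 _ := by
    refine Scheme.Modules.hom_ext _ _ fun U =>
      AddCommGrpCat.hom_ext (AddMonoidHom.ext fun x => ?_)
    have hU : (f ⁻¹ᵁ V).ι ''ᵁ U ≤ f ⁻¹ᵁ V := by rintro _ ⟨x, -, rfl⟩; exact x.2
    obtain ⟨r, rfl⟩ := (n.bijective _ hU).2 x
    refine (congrArg (e'.app U) (homOfFrame_app n (pullbackSectionOn f g.gen) U hU r)).trans ?_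
    exact (Scheme.Modules.Hom.app_smul e r _).trans (congrArg (r • ·) (he' U hU))
  have h3 : IsIso e' := ⟨i, h1, h2⟩
  have h4 := Scheme.Modules.Hom.isIso_iff_isIso_app.mp h3 ((f ⁻¹ᵁ V).ι ⁻¹ᵁ W)
  rw [ConcreteCategory.isIso_iff_bijective] at h4
  have h5 : (f ⁻¹ᵁ V).ι ''ᵁ (f ⁻¹ᵁ V).ι ⁻¹ᵁ W = W := by
    rw [Scheme.Hom.image_preimage_eq_opensRange_inf, Scheme.Opens.opensRange_ι]
    exact inf_eq_right.mpr hW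
  have h6 : Function.Bijective (e.app ((f ⁻¹ᵁ V).ι ''ᵁ (f ⁻¹ᵁ V).ι ⁻¹ᵁ W)) := h4
  rwa [h5] at h6

end Pullback

/-! ### Generators of `L^a` -/

section TensorPow

open Scheme.Modules

variable {X : Scheme.{u}} {q : ℕ} {L : Fin q → X.Modules}

lemma tensorPow_smul_coeff {a : Fin q → ℤ} {O : X.Opens} (r : Γ(X, O)) (c : Γ(tensorPow L a, O))
    (W : {W : X.Opens // W ≤ O}) (e : ∀ i, Frame (L i) W.1) :
    (show tensorPowSections L a O from r • c).1 W e =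
      X.presheaf.map (homOfLE W.2).op r * (show tensorPowSections L a O from c).1 W e := rfl

/-- The scalar multiplication on the direct image of the restriction of a sheaf of modules. -/
lemma pushforward_restrict_smul {Z : Scheme.{u}} {Y : X.Opens} (f : Y.toScheme ⟶ Z)
    (N : X.Modules) {V : Z.Opens} (r : Γ(Z, V)) (c : Γ(N, Y.ι ''ᵁ f ⁻¹ᵁ V)) :
    (show Γ(N, Y.ι ''ᵁ f ⁻¹ᵁ V) from
      (r • (show Γ((pushforward f).obj (N.restrict Y.ι), V) from c))) =
      (show Γ(X, Y.ι ''ᵁ f ⁻¹ᵁ V) from f.app V r) • c := by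
  have h : (Y.ι.appIso (f ⁻¹ᵁ V)).inv (f.app V r) =
      (show Γ(X, Y.ι ''ᵁ f ⁻¹ᵁ V) from f.app V r) := by
    rw [Scheme.Opens.ι_appIso]; rfl
  exact congrArg (fun r : Γ(X, Y.ι ''ᵁ f ⁻¹ᵁ V) => r • c) h

lemma restrict_smul {Y : X.Opens} (N : X.Modules) {U : Y.toScheme.Opens} (r : Γ(Y.toScheme, U))
    (c : Γ(N, Y.ι ''ᵁ U)) :
    (show Γ(N, Y.ι ''ᵁ U) from (r • (show Γ(N.restrict Y.ι, U) from c))) =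
      (show Γ(X, Y.ι ''ᵁ U) from r) • c := by
  have h : (Y.ι.appIso U).inv r = (show Γ(X, Y.ι ''ᵁ U) from r) := by
    rw [Scheme.Opens.ι_appIso]; rfl
  exact congrArg (fun r : Γ(X, Y.ι ''ᵁ U) => r • c) h

lemma coeff_ext_germ {a : Fin q → ℤ} {O : X.Opens} {c d : tensorPowSections L a O}
    (h : ∀ (W : {W : X.Opens // W ≤ O}) (e : ∀ i, Frame (L i) W.1) (y : X) (hy : y ∈ W.1),
      X.presheaf.germ W.1 y hy (c.1 W e) = X.presheaf.germ W.1 y hy (d.1 W e)) : c = d :=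
  Subtype.ext (funext fun W => funext fun e => section_ext_germ (h W e))

/-- The germs of the coefficients of two sections transform in the same way. -/
lemma exists_germ_coeff_eq {a : Fin q → ℤ} {O : X.Opens} (W W' : {W : X.Opens // W ≤ O})
    (e : ∀ i, Frame (L i) W.1) (e' : ∀ i, Frame (L i) W'.1) (y : X) (hy : y ∈ W.1)
    (hy' : y ∈ W'.1) : ∃ v : (X.presheaf.stalk y)ˣ, ∀ c : tensorPowSections L a O,
      X.presheaf.germ W'.1 y hy' (c.1 W' e') = v * X.presheaf.germ W.1 y hy (c.1 W e) := by
  choose v hv using fun i =>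
    ((e i).res (inf_le_left : W.1 ⊓ W'.1 ≤ W.1)).exists_eq_smul ((e' i).res inf_le_right)
  have hyy : y ∈ W.1 ⊓ W'.1 := ⟨hy, hy'⟩
  refine ⟨Units.map ((X.presheaf.germ (W.1 ⊓ W'.1) y hyy).hom : _ →* _)
    (∏ i, v i ^ (-(a i))), fun c => ?_⟩
  have h1 := c.2.1 W (W.1 ⊓ W'.1) inf_le_left e
  have h2 := c.2.1 W' (W.1 ⊓ W'.1) inf_le_right e'
  simp only [hv] at h2
  have h2' := h2.trans (c.2.2 ⟨W.1 ⊓ W'.1, inf_le_left.trans W.2⟩ v _)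
  rw [← h1] at h2'
  have h3 := congrArg (X.presheaf.germ (W.1 ⊓ W'.1) y hyy) h2'
  rw [map_mul, TopCat.Presheaf.germ_res_apply, TopCat.Presheaf.germ_res_apply] at h3
  exact h3

/-- A section of `L^a` with invertible coefficients is a generator. -/
lemma bijective_smul_of_isUnit_germ (hL : ∀ i, IsInvertible (L i)) {a : Fin q → ℤ} {O : X.Opens}
    (c : tensorPowSections L a O)
    (hc : ∀ (W : {W : X.Opens // W ≤ O}) (e : ∀ i, Frame (L i) W.1) (y : X) (hy : y ∈ W.1),
      IsUnit (X.presheaf.germ W.1 y hy (c.1 W e))) :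
    Function.Bijective fun r : Γ(X, O) => r • (show Γ(tensorPow L a, O) from c) := by
  have hfr : ∀ y ∈ O, ∃ W : {W : X.Opens // W ≤ O}, y ∈ W.1 ∧ Nonempty (∀ i, Frame (L i) W.1) :=
    fun y hy => by
      obtain ⟨W, hyW, ⟨e⟩⟩ := exists_frames hL y
      exact ⟨⟨W ⊓ O, inf_le_right⟩, ⟨hyW, hy⟩, ⟨fun i => (e i).res inf_le_left⟩⟩
  have hsm : ∀ (r : Γ(X, O)) (W : {W : X.Opens // W ≤ O}) (e : ∀ i, Frame (L i) W.1) (y : X)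
      (hy : y ∈ W.1), X.presheaf.germ W.1 y hy ((show tensorPowSections L a O from
        r • (show Γ(tensorPow L a, O) from c)).1 W e) =
      X.presheaf.germ O y (W.2 hy) r * X.presheaf.germ W.1 y hy (c.1 W e) := fun r W e y hy => by
    rw [tensorPow_smul_coeff, map_mul, TopCat.Presheaf.germ_res_apply]
  constructor
  · intro r r' h
    refine section_ext_germ fun y hy => ?_
    obtain ⟨W, hyW, ⟨e⟩⟩ := hfr y hy
    have h1 := congrArg (fun d : tensorPowSections L a O => X.presheaf.germ W.1 y hyW (d.1 W e)) h
    refine (hc W e y hyW).mul_left_injective ?_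
    exact (hsm r W e y hyW).symm.trans (h1.trans (hsm r' W e y hyW))
  · intro d
    -- The factor sought is the quotient of the coefficients of `d` and `c`. A change of frames
    -- multiplies both coefficients by the same unit, so the quotient is independent of the frames
    -- and glues.
    have key := existsUnique_of_germ O (fun y _ γ => ∀ (W : {W : X.Opens // W ≤ O})
        (e : ∀ i, Frame (L i) W.1) (hyW : y ∈ W.1), γ * X.presheaf.germ W.1 y hyW (c.1 W e) =
        X.presheaf.germ W.1 y hyW ((show tensorPowSections L a O from d).1 W e))
    suffices hex : _ ∧ _ by
      obtain ⟨g, hg, -⟩ := key hex.1 hex.2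
      refine ⟨g, coeff_ext_germ fun W e y hyW => (hsm g W e y hyW).trans ?_⟩
      exact hg y (W.2 hyW) W e hyW
    constructor
    · intro y hy γ γ' h h'
      obtain ⟨W, hyW, ⟨e⟩⟩ := hfr y hy
      exact (hc W e y hyW).mul_left_injective ((h W e hyW).trans (h' W e hyW).symm)
    · intro y hy
      obtain ⟨W, hyW, ⟨e⟩⟩ := hfr y hy
      have hu : IsUnit (c.1 W e) := RingedSpace.isUnit_of_isUnit_germ X.toRingedSpace W.1 _ (hc W e)
      obtain ⟨v, hv⟩ := hu
      refine ⟨W.1, hyW, W.2, (show tensorPowSections L a O from d).1 W e * (v⁻¹ : Γ(X, W.1)ˣ),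
        fun z hz W' e' hz' => ?_⟩
      obtain ⟨w, hw⟩ := exists_germ_coeff_eq (a := a) W W' e e' z hz hz'
      rw [hw c, hw d]
      have h1 : (show tensorPowSections L a O from d).1 W e * (v⁻¹ : Γ(X, W.1)ˣ) * c.1 W e =
          (show tensorPowSections L a O from d).1 W e := by
        rw [← hv, mul_assoc, Units.inv_mul, mul_one]
      have h2 := congrArg (X.presheaf.germ W.1 z hz) h1
      rw [map_mul] at h2
      rw [mul_left_comm, h2]

end TensorPow

/-! ### Local generators of `𝒪(a)` -/

section TwistFrame

variable {q : ℕ} {R : Type u} {σ : Type*} [CommRing R] [SetLike σ R] [AddSubgroupClass σ R]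
  {𝒜 : (Fin q → ℤ) → σ} [GradedRing 𝒜]

/-- The section `r / t` of `𝒪(a)`. -/
def twistFraction {a i : Fin q → ℤ} {r t : R} (hr : r ∈ 𝒜 (i + a)) (ht : t ∈ 𝒜 i)
    (V : Opens (space 𝒜)) (hV : ∀ p ∈ V, t ∉ Point.asIdeal p) : twistSections 𝒜 a V :=
  ⟨fun p => Localization.mk r ⟨t, hV p.1 p.2⟩, fun x => ⟨V, x.2, 𝟙 _, i, ⟨r, hr⟩, ⟨t, ht⟩,
    fun y => hV y.1 y.2, fun _ => rfl⟩⟩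

/-- The inverse is multiplication by `t / r`, which is defined on `V` and has degree `-a`, so it
carries fractions of degree `a` to fractions of degree `0`. -/
lemma twistFraction_bijective {a i : Fin q → ℤ} {r t : R} (hr : r ∈ 𝒜 (i + a)) (ht : t ∈ 𝒜 i)
    (V : Opens (space 𝒜)) (hV : ∀ p ∈ V, t ∉ Point.asIdeal p)
    (hV' : ∀ p ∈ V, r ∉ Point.asIdeal p) :
    Function.Bijective fun ρ : sections 𝒜 V => ρ • twistFraction hr ht V hV := by
  have hinv : ∀ p : V, (Localization.mk t ⟨r, hV' p.1 p.2⟩ :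
      Localization.AtPrime (Point.asIdeal p.1)) * Localization.mk r ⟨t, hV p.1 p.2⟩ = 1 :=
    fun p => by
      rw [Localization.mk_mul, ← Localization.mk_one, Localization.mk_eq_mk_iff,
        Localization.r_iff_exists]
      refine ⟨1, ?_⟩
      simp only [Submonoid.coe_mul, OneMemClass.coe_one]
      ring
  constructor
  · intro ρ ρ' h
    refine sections_ext fun p => HomogeneousLocalization.val_injective _ ?_
    have h1 : (ρ.1 p).val * Localization.mk r ⟨t, hV p.1 p.2⟩ =
      (ρ'.1 p).val * Localization.mk r ⟨t, hV p.1 p.2⟩ :=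
      congrFun (congrArg Subtype.val h) p
    have h2 := congrArg (Localization.mk t ⟨r, hV' p.1 p.2⟩ * ·) h1
    simp only [mul_left_comm _ (HomogeneousLocalization.val _), hinv, mul_one] at h2
    exact h2
  · intro z
    have hw : ∀ p : V, ∃ w : localRing 𝒜 p.1,
        w.val = Localization.mk t ⟨r, hV' p.1 p.2⟩ * z.1 p := fun p => by
      obtain ⟨V', hpV', i', j, r', t', ht', h⟩ := z.2 p
      have hz : z.1 p = _ := h ⟨p.1, hpV'⟩
      -- With `z = r' / t'` the product is `t r' / (r t')`; numerator and denominator both have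
      -- degree `i + j + a`.
      refine ⟨.mk ⟨i + (j + a), ⟨t * r', SetLike.mul_mem_graded ht r'.2⟩, ⟨r * t', ?_⟩,
        (Point.asIdeal p.1).primeCompl.mul_mem (hV' p.1 p.2) (ht' ⟨p.1, hpV'⟩)⟩, ?_⟩
      · convert SetLike.mul_mem_graded hr t'.2 using 2; abel
      · rw [hz, Localization.mk_mul]; rfl
    choose w hw using hw
    refine ⟨⟨w, fun p => ?_⟩, Subtype.ext (funext fun p => ?_)⟩
    · obtain ⟨V', hpV', i', j, r', t', ht', h⟩ := z.2 p
      refine ⟨V', hpV', i', i + (j + a), ⟨t * r', SetLike.mul_mem_graded ht r'.2⟩, ⟨r * t', ?_⟩,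
        fun y => (Point.asIdeal y.1).primeCompl.mul_mem (hV' y.1 (leOfHom i' y.2)) (ht' y),
        fun y => HomogeneousLocalization.val_injective _ ?_⟩
      · convert SetLike.mul_mem_graded hr t'.2 using 2; abel
      · refine (hw ⟨y.1, leOfHom i' y.2⟩).trans ?_
        have hz : z.1 ⟨y.1, leOfHom i' y.2⟩ = _ := h y
        rw [hz, Localization.mk_mul]; rfl
    · change (w p).val * Localization.mk r ⟨t, hV p.1 p.2⟩ = z.1 p
      rw [hw, mul_right_comm, hinv, one_mul]

/-- If `r` and `t` do not vanish on `V`, then `r / t` is a generator of `𝒪(a)` on `V`. -/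
def twistFrame {a i : Fin q → ℤ} {r t : R} (hr : r ∈ 𝒜 (i + a)) (ht : t ∈ 𝒜 i)
    (V : Opens (space 𝒜)) (hV : ∀ p ∈ V, t ∉ Point.asIdeal p)
    (hV' : ∀ p ∈ V, r ∉ Point.asIdeal p) :
    Frame (twist 𝒜 a) (show (multiProj 𝒜).Opens from V) where
  gen := (twistFraction hr ht V hV : twistSections 𝒜 a V)
  bijective V₁ h := twistFraction_bijective hr ht V₁ (fun p hp => hV p (h hp))
    fun p hp => hV' p (h hp)

/-- The numerator of a fraction `r / f ^ n` which is a unit does not vanish where `f` does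
not. -/
lemma not_mem_of_isUnit_mk {f r : R} {n : ℕ}
    (hu : IsUnit (Localization.mk r ⟨f ^ n, n, rfl⟩ : Localization.Away f))
    {p : Ideal R} [p.IsPrime] (hf : f ∉ p) : r ∉ p := by
  refine not_mem_of_isUnit_away (f := f) ?_ hf
  rw [Localization.mk_eq_mk', IsLocalization.mk'_eq_mul_mk'_one] at hu
  exact isUnit_of_mul_isUnit_left hu

/-- A degree of a homogeneous unit of `R[f⁻¹]` gives a fraction that does not vanish on
`D₊(f)`. -/
lemma exists_fraction_of_mem_unitDegrees {f : R} {a : Fin q → ℤ} (ha : a ∈ unitDegrees 𝒜 f) :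
    ∃ (i : Fin q → ℤ) (r t : R), r ∈ 𝒜 (i + a) ∧ t ∈ 𝒜 i ∧
      ∀ p : Point 𝒜, f ∉ p.asIdeal → r ∉ p.asIdeal ∧ t ∉ p.asIdeal := by
  obtain ⟨e, n, r, hf, hr, hu⟩ := ha
  refine ⟨n • e, r, f ^ n, by rwa [add_comm], SetLike.pow_mem_graded n hf, fun p hp => ⟨?_, ?_⟩⟩
  · exact not_mem_of_isUnit_mk hu hp
  · exact fun h => hp (p.isPrime.mem_of_pow_mem _ h)

lemma isUnit_germ_sections_iff {V : Opens (space 𝒜)} (z : sections 𝒜 V) (x : space 𝒜)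
    (hx : x ∈ V) : IsUnit ((structurePresheaf 𝒜).germ V x hx z) ↔ IsUnit (z.1 ⟨x, hx⟩) := by
  refine ⟨fun h => ?_, isUnit_sections z x hx⟩
  have h1 := h.map (stalkToLocal 𝒜 x).hom
  rwa [stalkToLocal_germ] at h1

/-- The pullback of a function is invertible at `y` if and only if the function is invertible at
the image of `y`. -/
lemma isUnit_germ_app_iff {X : Scheme.{u}} {Y : X.Opens} (f : Y.toScheme ⟶ multiProj 𝒜)
    (V : Opens (space 𝒜)) (z : sections 𝒜 V) (y : Y) (hyV : toPoint (f y) ∈ V) :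
    IsUnit (X.presheaf.germ (Y.ι ''ᵁ f ⁻¹ᵁ V) y.1 ⟨y, hyV, rfl⟩ (f.app V z)) ↔
      IsUnit (z.1 ⟨toPoint (f y), hyV⟩) := by
  rw [← isUnit_germ_sections_iff]
  -- Invertibility at a point is membership in a basic open set, and basic open sets are compatible
  -- with preimages under `f` and with images under the inclusion of `Y`.
  refine (Scheme.mem_basicOpen X (U := Y.ι ''ᵁ f ⁻¹ᵁ V) (f.app V z) y.1 ⟨y, hyV, rfl⟩).symm.trans
    (Iff.trans ?_ (Scheme.mem_basicOpen (multiProj 𝒜) (U := V) z (f y) hyV))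
  have h1 := Scheme.image_basicOpen Y.ι (f.app V z)
  have h2 := Scheme.preimage_basicOpen f (U := V) z
  rw [Scheme.Opens.ι_appIso, ← h2] at h1
  constructor
  · intro h
    obtain ⟨y', hy', h'⟩ : y.1 ∈ Y.ι ''ᵁ f ⁻¹ᵁ ((multiProj 𝒜).basicOpen (U := V) z) :=
      (congrArg (y.1 ∈ ·) h1).mpr h
    obtain rfl : y' = y := Subtype.ext h'
    exact hy'
  · intro h
    exact (congrArg (y.1 ∈ ·) h1).mp ⟨y, h, rfl⟩

end TwistFrame

/-! ### The homomorphisms `𝒪(a) → f_* L^{a'}` and their adjoints -/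

section TwistMap

open Scheme.Modules

variable {X : Scheme.{u}} {q : ℕ} {L : Fin q → X.Modules} {R : Type u} [CommRing R]
  {σ : Type*} [SetLike σ R] [AddSubgroupClass σ R] {𝒜 : (Fin q → ℤ) → σ} [GradedRing 𝒜]
  {s : R →+* ⨁ a, tensorPowSections L a (⊤ : X.Opens)}
  {Y : X.Opens} {α : (Fin q → ℤ) →+ (Fin q → ℤ)}
  (hL : ∀ i, IsInvertible (L i))
  (hs : ∀ a, ∀ r ∈ 𝒜 a, s r ∈ (DirectSum.of (fun a => tensorPowSections L a ⊤) (α a)).range)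

/-- The sections of `L^b` whose coefficients are the values of a given section of `𝒪(a)`. -/
def IsTwistImage (s : R →+* ⨁ a, tensorPowSections L a (⊤ : X.Opens)) (β : Y → Point 𝒜)
    {a b : Fin q → ℤ} {V : Opens (space 𝒜)} (z : twistSections 𝒜 a V)
    {O : X.Opens} (c : tensorPowSections L b O) : Prop :=
  ∀ (W : {W : X.Opens // W ≤ O}) (e : ∀ i, Frame (L i) W.1) (y : X) (hy : y ∈ W.1) (h : y ∈ Y)
    (hV : β ⟨y, h⟩ ∈ V), FracRel 𝒜 (germHom s e y hy) a (z.1 ⟨β ⟨y, h⟩, hV⟩)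
      (X.presheaf.germ W.1 y hy (c.1 W e))

lemma IsTwistImage.unique {β : Y → Point 𝒜} (hβ : IsVanishingMap s β) {a b : Fin q → ℤ}
    {V : Opens (space 𝒜)} {z : twistSections 𝒜 a V} {O : X.Opens}
    (hO : ∀ x ∈ O, ∃ h : x ∈ Y, β ⟨x, h⟩ ∈ V) {c d : tensorPowSections L b O}
    (hc : IsTwistImage s β z c) (hd : IsTwistImage s β z d) : c = d :=
  coeff_ext_germ fun W e y hy => by
    obtain ⟨h, hV⟩ := hO y (W.2 hy)
    exact (hc W e y hy h hV).unique (β ⟨y, h⟩).isHomogeneous (hβ.invertsAt _ e hy)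
      (hd W e y hy h hV)

-- For fixed frames the values of `z` glue to a function on `W`. A change of frames by `v`
-- multiplies this function by `∏ v_i ^ (-(α a)_i)`, which is the transformation rule for
-- coefficients of sections of `L^{α a}`; hence the functions for all frames form such a section.
include hL hs in
lemma exists_isTwistImage {β : Y → Point 𝒜} (hβ : IsVanishingMap s β) {a : Fin q → ℤ}
    {V : Opens (space 𝒜)} (z : twistSections 𝒜 a V) {O : X.Opens}
    (hO : ∀ x ∈ O, ∃ h : x ∈ Y, β ⟨x, h⟩ ∈ V) :
    ∃ c : tensorPowSections L (α a) O, IsTwistImage s β z c := by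
  have key : ∀ (W : {W : X.Opens // W ≤ O}) (e : ∀ i, Frame (L i) W.1),
      ∃! g : Γ(X, W.1), ∀ y (hy : y ∈ W.1), ∀ (h : y ∈ Y) (hV : β ⟨y, h⟩ ∈ V),
        FracRel 𝒜 (germHom s e y hy) a (z.1 ⟨β ⟨y, h⟩, hV⟩) (X.presheaf.germ W.1 y hy g) := by
    intro W e
    refine existsUnique_of_germ W.1 (fun y hy γ => ∀ (h : y ∈ Y) (hV : β ⟨y, h⟩ ∈ V),
        FracRel 𝒜 (germHom s e y hy) a (z.1 ⟨β ⟨y, h⟩, hV⟩) γ) ?_ ?_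
    · intro x hx γ γ' hγ hγ'
      obtain ⟨h, hV⟩ := hO x (W.2 hx)
      exact (hγ h hV).unique (β ⟨x, h⟩).isHomogeneous (hβ.invertsAt _ e hx) (hγ' h hV)
    · intro x hx
      obtain ⟨h, hV⟩ := hO x (W.2 hx)
      obtain ⟨N, hxN, hNW, hNV, g, hg⟩ := exists_local_fracRel hL hβ z e ⟨x, h⟩ hV hx
      exact ⟨N, hxN, hNW, g, fun y hy _ _ => hg y hy⟩
  choose c hc hc' using key
  refine ⟨⟨c, fun W W' h e => hc' ⟨W', h.trans W.2⟩ _ _ fun y hy hyY hV => ?_,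
    fun W v e => (hc' W _ _ fun y hy hyY hV => ?_).symm⟩, hc⟩
  · rw [TopCat.Presheaf.germ_res_apply]
    have h1 := hc W e y (h hy) hyY hV
    obtain ⟨i, r, t, ht, hz, hγ⟩ := h1
    refine ⟨i, r, t, ht, hz, ?_⟩
    rw [germHom_apply, germHom_apply, frameHom_res hs h e r.2, frameHom_res hs h e t.2,
      TopCat.Presheaf.germ_res_apply, TopCat.Presheaf.germ_res_apply]
    exact hγ
  · rw [map_mul]
    refine (hc W e y hy hyY hV).twist (fun b => Units.map ((X.presheaf.germ W.1 y hy).hom : _ →* _)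
      (∏ i, v i ^ (-(α b i)))) (fun b b' => ?_) (fun b r hr => ?_)
    · rw [← map_mul, ← Finset.prod_mul_distrib]
      refine congrArg _ (Finset.prod_congr rfl fun i _ => ?_)
      rw [← zpow_add, map_add, Pi.add_apply, neg_add]
    · rw [germHom_apply, frameHom_smul hs v e hr, map_mul]
      rfl

/-- The restriction of `s r` is the image of the section `r / 1` of `𝒪(a)`. -/
lemma isTwistImage_twistSection {β : Y → Point 𝒜} {a : Fin q → ℤ} (r : 𝒜 a) {O : X.Opens}
    (hs : ∀ a, ∀ r ∈ 𝒜 a, s r ∈ (DirectSum.of (fun a => tensorPowSections L a ⊤) (α a)).range) :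
    IsTwistImage s β (V := ⊤) (show twistSections 𝒜 a ⊤ from twistSection r)
      (show tensorPowSections L (α a) O from
        (tensorPow L (α a)).presheaf.map (homOfLE le_top).op (s r.1 (α a))) := by
  intro W e y hy h hV
  have h1 := frameHom_eq_coeff hs e r.2
  refine Eq.mpr (congrArg (fun g => FracRel 𝒜 _ a _ (X.presheaf.germ W.1 y hy g)) h1.symm) ?_
  exact fracRel_mk_one r.2

variable {f : Y.toScheme ⟶ multiProj 𝒜}

lemma preimage_image_subset (f : Y.toScheme ⟶ multiProj 𝒜) (V : Opens (space 𝒜)) :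
    ∀ x ∈ Y.ι ''ᵁ f ⁻¹ᵁ V, ∃ h : x ∈ Y, toPoint (f (⟨x, h⟩ : Y)) ∈ V := by
  rintro _ ⟨y, hy, rfl⟩
  exact ⟨y.2, hy⟩

include hL hs in
/-- For a compatible morphism `f` there is a homomorphism `𝒪(a) → f_* L^{a'}` which maps `r / t`
to `s r / s t`. -/
lemma IsCompatible.exists_twistMap (hf : IsCompatible s f) (a : Fin q → ℤ) :
    ∃ E : twist 𝒜 a ⟶ (pushforward f).obj ((tensorPow L (α a)).restrict Y.ι),
      ∀ (V : Opens (space 𝒜)) (z : twistSections 𝒜 a V),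
        IsTwistImage s (fun y : Y => toPoint (f y)) z
          (show tensorPowSections L (α a) (Y.ι ''ᵁ f ⁻¹ᵁ V) from E.app V z) := by
  choose F hF using fun (V : Opens (space 𝒜)) (z : twistSections 𝒜 a V) =>
    exists_isTwistImage hL hs hf.isVanishingMap z (preimage_image_subset f V)
  -- Since a section of `𝒪(a)` has only one image, additivity, compatibility with restriction and
  -- linearity are checked on values of fractions.
  have huniq : ∀ (V : Opens (space 𝒜)) (z : twistSections 𝒜 a V)
      (c : tensorPowSections L (α a) (Y.ι ''ᵁ f ⁻¹ᵁ V)),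
      IsTwistImage s (fun y : Y => toPoint (f y)) z c → F V z = c := fun V z c hc =>
    (hF V z).unique hf.isVanishingMap (preimage_image_subset f V) hc
  have hadd : ∀ V z z', F V (z + z') = F V z + F V z' := fun V z z' =>
    huniq V _ _ fun W e y hy h hV => by
      refine Eq.mpr (congrArg (FracRel 𝒜 _ a _) (map_add (X.presheaf.germ W.1 y hy).hom _ _)) ?_
      exact (hF V z W e y hy h hV).add (hF V z' W e y hy h hV)
  have hres : ∀ (V V' : Opens (space 𝒜)) (h : V' ≤ V) (z : twistSections 𝒜 a V),
      F V' (show twistSections 𝒜 a V' from (twist 𝒜 a).presheaf.map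
        (homOfLE (show (show (multiProj 𝒜).Opens from V') ≤ V from h)).op z) =
      (show tensorPowSections L (α a) (Y.ι ''ᵁ f ⁻¹ᵁ V') from
        (tensorPow L (α a)).presheaf.map
          (homOfLE (show Y.ι ''ᵁ f ⁻¹ᵁ V' ≤ Y.ι ''ᵁ f ⁻¹ᵁ V from by
            rintro _ ⟨y, hy, rfl⟩; exact ⟨y, h hy, rfl⟩)).op (F V z)) := fun V V' h z =>
    huniq V' _ _ fun W e y hy hyY hV => hF V z ⟨W.1, _⟩ e y hy hyY (h hV)
  have hsmul : ∀ (V : Opens (space 𝒜)) (ρ : sections 𝒜 V) (z : twistSections 𝒜 a V),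
      F V (ρ • z) = (show tensorPowSections L (α a) (Y.ι ''ᵁ f ⁻¹ᵁ V) from
        ((show Γ(X, Y.ι ''ᵁ f ⁻¹ᵁ V) from f.app V ρ) •
          (show Γ(tensorPow L (α a), Y.ι ''ᵁ f ⁻¹ᵁ V) from F V z))) := fun V ρ z =>
    huniq V _ _ fun W e y hy hyY hV => by
      rw [tensorPow_smul_coeff, map_mul, TopCat.Presheaf.germ_res_apply]
      exact (hf.fracRel V ρ ⟨y, hyY⟩ hV W.1 e hy).mul_zero_left (hF V z W e y hy hyY hV)
  refine ⟨modulesHomMk (fun V => AddMonoidHom.mk' (F V) (hadd V)) (fun V V' h z => hres V V' h z)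
    (fun V ρ z => ?_), hF⟩
  refine (hsmul V ρ z).trans ?_
  exact (pushforward_restrict_smul f (tensorPow L (α a)) (V := V) ρ
    (show Γ(tensorPow L (α a), Y.ι ''ᵁ f ⁻¹ᵁ V) from F V z)).symm

include hL hs in
/-- A compatible morphism satisfies the conditions on the pullbacks of the sheaves `𝒪(a)`. -/
lemma IsCompatible.exists_pullback_twist (hf : IsCompatible s f) (a : Fin q → ℤ) :
    ∃ e : (Scheme.Modules.pullback f).obj (twist 𝒜 a) ⟶ (tensorPow L (α a)).restrict Y.ι,
      IsIso ((restrictFunctor (f ⁻¹ᵁ unitLocus 𝒜 a).ι).map e) ∧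
      ∀ r : 𝒜 a, e.app ⊤ (pullbackSection f (twistSection r)) =
        (tensorPow L (α a)).presheaf.map (homOfLE le_top).op (s r.1 (α a)) := by
  obtain ⟨E, hE⟩ := hf.exists_twistMap hL hs a
  let e := ((pullbackPushforwardAdjunction f).homEquiv _ _).symm E
  have he : ∀ (V : (multiProj 𝒜).Opens) (m : Γ(twist 𝒜 a, V)),
      e.app (f ⁻¹ᵁ V) (pullbackSectionOn f m) = E.app V m := fun V m => by
    rw [← homEquiv_app, Equiv.apply_symm_apply]
  refine ⟨e, isIso_restrict_of_bijective e _ fun y hy => ?_, fun r => ?_⟩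
  · obtain ⟨f₀, hy⟩ := Opens.mem_iSup.mp (show f y ∈ unitLocus 𝒜 a from hy)
    obtain ⟨⟨-, -, ha⟩, hy⟩ := Opens.mem_iSup.mp hy
    -- On `D₊(f₀)` neither `r` nor `t` vanishes, so `r / t` generates `𝒪(a)` there. Its image has
    -- coefficients `s r / s t`, which are units over the preimage, and so generates `L^{α a}`.
    obtain ⟨i, r, t, hr, ht, hrt⟩ := exists_fraction_of_mem_unitDegrees ha
    let D : Opens (space 𝒜) := basicOpen f₀
    let g := twistFrame hr ht D (fun p hp => (hrt p hp).2) (fun p hp => (hrt p hp).1)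
    refine ⟨f ⁻¹ᵁ D, hy, fun W' hW' => ?_⟩
    let n : tensorPowSections L (α a) (Y.ι ''ᵁ f ⁻¹ᵁ D) := E.app D g.gen
    have hn : ∀ (W : {W : X.Opens // W ≤ Y.ι ''ᵁ f ⁻¹ᵁ D}) (e : ∀ i, Frame (L i) W.1) (y : X)
        (hy : y ∈ W.1), IsUnit (X.presheaf.germ W.1 y hy (n.1 W e)) := fun W e y hy => by
      obtain ⟨hyY, hyD⟩ := preimage_image_subset f D y (W.2 hy)
      have h1 := hE D g.gen W e y hy hyY hyD
      have h2 := hf.isVanishingMap ⟨y, hyY⟩ W.1 e hy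
      exact h1.isUnit (toPoint (f (⟨y, hyY⟩ : Y))).isHomogeneous
        (hf.isVanishingMap.invertsAt ⟨y, hyY⟩ e hy) hr ht
        ((h2 _ _ hr).mp (hrt _ hyD).1)
    let nf : Frame ((tensorPow L (α a)).restrict Y.ι) (f ⁻¹ᵁ D) :=
      { gen := n
        bijective := fun V hV => by
          have h1 : Y.ι ''ᵁ V ≤ Y.ι ''ᵁ f ⁻¹ᵁ D := Scheme.Hom.image_mono _ hV
          have h2 := bijective_smul_of_isUnit_germ hL
            (show tensorPowSections L (α a) (Y.ι ''ᵁ V) from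
              (tensorPow L (α a)).presheaf.map (homOfLE h1).op n)
            (fun W e y hy => hn ⟨W.1, W.2.trans h1⟩ e y hy)
          refine Eq.mpr (congrArg Function.Bijective (funext fun r => ?_)) h2
          exact restrict_smul (tensorPow L (α a)) r _ }
    exact bijective_app_of_frame e g nf (he D g.gen) hW'
  -- Both sides are images of the section `r / 1`.
  · refine (he ⊤ (twistSection r)).trans ?_
    exact (hE ⊤ (twistSection r)).unique hf.isVanishingMap (preimage_image_subset f ⊤)
      (isTwistImage_twistSection r hs)

end TwistMap

/-! ### Recovering compatibility from condition (2) -/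

section Uniqueness

open Scheme.Modules

variable {X : Scheme.{u}} {q : ℕ} {L : Fin q → X.Modules}

/-- The germ at `y` of the coefficient of a section with respect to frames near `y`. -/
def germCoeff {b : Fin q → ℤ} {O W : X.Opens} (c : tensorPowSections L b O)
    (e : ∀ i, Frame (L i) W) (y : X) (hyW : y ∈ W) (hyO : y ∈ O) : X.presheaf.stalk y :=
  X.presheaf.germ (W ⊓ O) y (Opens.mem_inf.mpr ⟨hyW, hyO⟩)
    (c.1 ⟨W ⊓ O, inf_le_right⟩ fun i => (e i).res inf_le_left)

lemma germCoeff_smul {b : Fin q → ℤ} {O W : X.Opens} (r : Γ(X, O)) (c : Γ(tensorPow L b, O))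
    (e : ∀ i, Frame (L i) W) (y : X) (hyW : y ∈ W) (hyO : y ∈ O) :
    germCoeff (show tensorPowSections L b O from r • c) e y hyW hyO =
      X.presheaf.germ O y hyO r *
        germCoeff (show tensorPowSections L b O from c) e y hyW hyO := by
  unfold germCoeff
  rw [tensorPow_smul_coeff, map_mul, TopCat.Presheaf.germ_res_apply]

lemma germCoeff_res {b : Fin q → ℤ} {O O' W : X.Opens} (h : O' ≤ O)
    (c : tensorPowSections L b O) (e : ∀ i, Frame (L i) W) (y : X) (hyW : y ∈ W) (hyO : y ∈ O') :
    germCoeff (show tensorPowSections L b O' from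
      (tensorPow L b).presheaf.map (homOfLE h).op c) e y hyW hyO =
      germCoeff c e y hyW (h hyO) := by
  have h1 := c.2.1 ⟨W ⊓ O, inf_le_right⟩ (W ⊓ O') (inf_le_inf_left W h)
    (fun i => (e i).res inf_le_left)
  simp only [Frame.res_res] at h1
  have h2 := congrArg (X.presheaf.germ (W ⊓ O') y (Opens.mem_inf.mpr ⟨hyW, hyO⟩)) h1
  rw [TopCat.Presheaf.germ_res_apply] at h2
  exact h2.symm

variable {R : Type u} [CommRing R] {σ : Type*} [SetLike σ R] {𝒜 : (Fin q → ℤ) → σ}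
  {s : R →+* ⨁ a, tensorPowSections L a (⊤ : X.Opens)}
  {Y : X.Opens} {α : (Fin q → ℤ) →+ (Fin q → ℤ)}
  (hs : ∀ a, ∀ r ∈ 𝒜 a, s r ∈ (DirectSum.of (fun a => tensorPowSections L a ⊤) (α a)).range)

include hs in
lemma germCoeff_map {a : Fin q → ℤ} {r : R} (hr : r ∈ 𝒜 a) {W : X.Opens}
    (e : ∀ i, Frame (L i) W) (y : X) (hyW : y ∈ W) :
    germCoeff (s r (α a)) e y hyW (Opens.mem_top y) = germHom s e y hyW r := by
  rw [germCoeff, germHom_apply, ← TopCat.Presheaf.germ_res_apply X.presheaf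
    (homOfLE (inf_le_left : W ⊓ ⊤ ≤ W)) y (Opens.mem_inf.mpr ⟨hyW, Opens.mem_top y⟩),
    ← frameHom_res hs (inf_le_left : W ⊓ ⊤ ≤ W) e hr, frameHom_eq_coeff hs _ hr]

variable [AddSubgroupClass σ R] [GradedRing 𝒜] {f : Y.toScheme ⟶ multiProj 𝒜}

lemma twist_hom_app_smul {a : Fin q → ℤ} {N : (multiProj 𝒜).Modules} (E : twist 𝒜 a ⟶ N)
    (V : Opens (space 𝒜)) (ρ : sections 𝒜 V) (z : twistSections 𝒜 a V) :
    E.app V (show twistSections 𝒜 a V from ρ • z) =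
      (show Γ(multiProj 𝒜, (show (multiProj 𝒜).Opens from V)) from ρ) •
        (show Γ(N, (show (multiProj 𝒜).Opens from V)) from E.app V z) :=
  (E.val.app (.op V)).hom.map_smul ρ z

/-- A homomorphism `𝒪(a) → f_* L^{a'}` is compatible with `s` if it maps `r` to `s r`. -/
def IsTwistMap (s : R →+* ⨁ a, tensorPowSections L a (⊤ : X.Opens))
    (α : (Fin q → ℤ) →+ (Fin q → ℤ)) (f : Y.toScheme ⟶ multiProj 𝒜) {a : Fin q → ℤ}
    (E : twist 𝒜 a ⟶ (pushforward f).obj ((tensorPow L (α a)).restrict Y.ι)) : Prop :=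
  ∀ r : 𝒜 a, E.app ⊤ (twistSection r) =
    (tensorPow L (α a)).presheaf.map (homOfLE le_top).op (s r.1 (α a))

/-- The restriction of the section `r / 1` of `𝒪(a)` to an open set. -/
def twistSectionOn {a : Fin q → ℤ} (r : 𝒜 a) (V : Opens (space 𝒜)) : twistSections 𝒜 a V :=
  (twist 𝒜 a).presheaf.map (homOfLE (le_top : (show (multiProj 𝒜).Opens from V) ≤ ⊤)).op
    (twistSection r)

section

variable {a : Fin q → ℤ} {E : twist 𝒜 a ⟶ (pushforward f).obj ((tensorPow L (α a)).restrict Y.ι)}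
  (hE : IsTwistMap s α f E) (V : Opens (space 𝒜)) {W : X.Opens} (e : ∀ i, Frame (L i) W)
  (y : Y) (hyV : toPoint (f y) ∈ V) (hyW : y.1 ∈ W)

include hE hs in
lemma IsTwistMap.germCoeff_twistSectionOn (r : 𝒜 a) :
    germCoeff (show tensorPowSections L (α a) (Y.ι ''ᵁ f ⁻¹ᵁ V) from
      E.app V (twistSectionOn r V)) e y.1 hyW ⟨y, hyV, rfl⟩ = germHom s e y.1 hyW r.1 := by
  have h1 := hom_app_res E (le_top : (show (multiProj 𝒜).Opens from V) ≤ ⊤) (twistSection r)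
  rw [hE r] at h1
  have hle : Y.ι ''ᵁ f ⁻¹ᵁ V ≤ Y.ι ''ᵁ f ⁻¹ᵁ ⊤ := by
    rintro _ ⟨y, -, rfl⟩; exact ⟨y, trivial, rfl⟩
  refine (congrArg (fun c : tensorPowSections L (α a) (Y.ι ''ᵁ f ⁻¹ᵁ V) =>
    germCoeff c e y.1 hyW ⟨y, hyV, rfl⟩) h1).trans ?_
  refine (germCoeff_res hle _ e y.1 hyW ⟨y, hyV, rfl⟩).trans ?_
  refine (germCoeff_res (O' := Y.ι ''ᵁ f ⁻¹ᵁ ⊤) le_top (s r.1 (α a)) e y.1 hyW _).trans ?_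
  exact germCoeff_map hs r.2 e y.1 hyW

-- This is linearity of `E`: from `ρ • z = r / 1` it follows that `f^* ρ` times `E z` is `E (r /
-- 1)`, which is `s r`. The image of `z` itself is not known, since `z` need not come from an
-- element of `R`.
include hE hs in
lemma IsTwistMap.germ_mul (r : 𝒜 a) (ρ : sections 𝒜 V) (z : twistSections 𝒜 a V)
    (h : ρ • z = twistSectionOn r V) :
    X.presheaf.germ (Y.ι ''ᵁ f ⁻¹ᵁ V) y.1 ⟨y, hyV, rfl⟩ (f.app V ρ) *
      germCoeff (show tensorPowSections L (α a) (Y.ι ''ᵁ f ⁻¹ᵁ V) from E.app V z) e y.1 hyW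
        ⟨y, hyV, rfl⟩ = germHom s e y.1 hyW r.1 := by
  refine (germCoeff_smul (show Γ(X, Y.ι ''ᵁ f ⁻¹ᵁ V) from f.app V ρ)
    (show Γ(tensorPow L (α a), Y.ι ''ᵁ f ⁻¹ᵁ V) from E.app V z) e y.1 hyW
    ⟨y, hyV, rfl⟩).symm.trans ?_
  refine Eq.trans ?_ (hE.germCoeff_twistSectionOn hs V e y hyV hyW r)
  refine congrArg (fun c : tensorPowSections L (α a) (Y.ι ''ᵁ f ⁻¹ᵁ V) =>
    germCoeff c e y.1 hyW ⟨y, hyV, rfl⟩) ?_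
  refine (pushforward_restrict_smul f (tensorPow L (α a)) (V := V) ρ (E.app V z)).symm.trans ?_
  refine (twist_hom_app_smul E V ρ z).symm.trans ?_
  exact congrArg (E.app V) h

end

section

variable (hE : ∀ a, ∃ E : twist 𝒜 a ⟶ (pushforward f).obj ((tensorPow L (α a)).restrict Y.ι),
  IsTwistMap s α f E) {W : X.Opens} (e : ∀ i, Frame (L i) W) (y : Y) (hyW : y.1 ∈ W)

-- The case `ρ = r / t`, `z = t / 1` of `IsTwistMap.germ_mul`, where the image `s t` of `z` is
-- known.
include hE hs in
lemma germ_fractionSection_mul {i : Fin q → ℤ} (r t : 𝒜 i)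
    (ht : toPoint (f y) ∈ basicOpen t.1) :
    X.presheaf.germ (Y.ι ''ᵁ f ⁻¹ᵁ (basicOpen t.1 : Opens (space 𝒜))) y.1 ⟨y, ht, rfl⟩
      (f.app (basicOpen t.1 : Opens (space 𝒜)) (fractionSection r t)) * germHom s e y.1 hyW t.1 =
      germHom s e y.1 hyW r.1 := by
  obtain ⟨E, hE⟩ := hE i
  rw [← hE.germCoeff_twistSectionOn hs (basicOpen t.1) e y ht hyW t]
  refine hE.germ_mul hs (basicOpen t.1) e y ht hyW r _ _ ?_
  refine Subtype.ext (funext fun p => ?_)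
  change (Localization.mk r.1 ⟨t.1, p.2⟩ : Localization.AtPrime (Point.asIdeal p.1)) *
    Localization.mk t.1 1 = Localization.mk r.1 1
  rw [Localization.mk_mul, Localization.mk_eq_mk_iff, Localization.r_iff_exists]
  exact ⟨1, by simp [mul_comm]⟩

-- The sheaf `𝒪(i)` need not be invertible at `f y`, but near `f y` there is a generator `z` of `𝒪(N
-- i)` for some `N > 0`, and `t^N = ρ z`. If `s t` is invertible at `y`, then so is its power `f^* ρ
-- · E z`, hence `f^* ρ`, hence `ρ` at `f y`. So `t^N` is invertible at `f y`.
include hE hs in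
lemma not_mem_of_isUnit_germHom {i : Fin q → ℤ} {t : R} (ht : t ∈ 𝒜 i)
    (hu : IsUnit (germHom s e y.1 hyW t)) : t ∉ (toPoint (f y)).asIdeal := by
  intro htp
  obtain ⟨f₀, hf₀, hf₀p⟩ := Point.exists_relevant 𝒜 (toPoint (f y))
  have hfin := hf₀.2
  set H := AddSubgroup.closure (unitDegrees 𝒜 f₀)
  -- `N` is the index of the group of degrees of homogeneous units of `R[f₀⁻¹]`, which is finite
  -- because `f₀` is relevant.
  have h1 : H.index • i ∈ unitDegrees 𝒜 f₀ :=
    mem_unitDegrees_of_mem_closure hf₀.1 (H.nsmul_index_mem i)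
  obtain ⟨j, r', t', hr', ht', hrt⟩ := exists_fraction_of_mem_unitDegrees h1
  let D : Opens (space 𝒜) := basicOpen f₀
  let z : twistSections 𝒜 (H.index • i) D := twistFraction hr' ht' D fun p hp => (hrt p hp).2
  have htN : t ^ H.index ∈ 𝒜 (H.index • i) := SetLike.pow_mem_graded _ ht
  obtain ⟨ρ, hρ⟩ := (twistFraction_bijective hr' ht' D (fun p hp => (hrt p hp).2)
    fun p hp => (hrt p hp).1).2 (twistSectionOn ⟨_, htN⟩ D)
  obtain ⟨E, hE⟩ := hE (H.index • i)
  have h2 := hE.germ_mul hs D e y hf₀p hyW ⟨_, htN⟩ ρ z hρ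
  rw [map_pow] at h2
  have h3 := (isUnit_germ_app_iff f D ρ y hf₀p).mp
    (isUnit_of_mul_isUnit_left (h2 ▸ hu.pow H.index))
  have h4 : (ρ.1 ⟨toPoint (f y), hf₀p⟩).val * z.1 ⟨toPoint (f y), hf₀p⟩ =
      Localization.mk (t ^ H.index) 1 := congrFun (congrArg Subtype.val hρ) ⟨toPoint (f y), hf₀p⟩
  have h5 : IsUnit (z.1 ⟨toPoint (f y), hf₀p⟩) := by
    change IsUnit (Localization.mk r' ⟨t', _⟩ : Localization.AtPrime (toPoint (f y)).asIdeal)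
    rw [Localization.mk_eq_mk', IsLocalization.AtPrime.isUnit_mk'_iff]
    exact (hrt _ hf₀p).1
  have h6 := (h3.map (algebraMap (localRing 𝒜 (toPoint (f y)))
    (Localization.AtPrime (toPoint (f y)).asIdeal))).mul h5
  rw [HomogeneousLocalization.algebraMap_apply, h4, Localization.mk_eq_mk',
    IsLocalization.AtPrime.isUnit_mk'_iff] at h6
  -- Positivity of `N` matters here: `t ∈ p` gives `t^N ∈ p` only for `N > 0`.
  exact h6 (Ideal.pow_mem_of_mem _ htp _
    (Nat.pos_of_ne_zero (AddSubgroup.FiniteIndex.index_ne_zero (H := H))))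

include hE hs in
/-- A morphism `f` for which there are homomorphisms `𝒪(a) → f_* L^{a'}` that map `r` to `s r` is
compatible with `s`. -/
lemma isCompatible_of_isTwistMap
    (hY : ∀ y ∈ Y, y ∉ sectionZeroLocus (s '' (irrelevant 𝒜 : Set R))) :
    IsCompatible s f where
  isVanishingMap y W e hyW i t ht := by
    refine ⟨fun htp => ?_, not_mem_of_isUnit_germHom hs hE e y hyW ht⟩
    -- For the converse of `not_mem_of_isUnit_germHom`, a denominator is needed that is invertible
    -- both at `y` and at `f y`. A relevant `h` with `s h` invertible at `y` is one, by the
    -- direction already known.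
    obtain ⟨-, h₀, -, hh₀, hu₀⟩ := exists_isUnit_germHom hs (hY y.1 y.2) e hyW
    obtain ⟨h, hrel, hu⟩ := exists_isRelevant_isUnit ⟨h₀, hh₀, hu₀⟩
    obtain ⟨d, hd⟩ := hrel.1
    have hhp := not_mem_of_isUnit_germHom hs hE e y hyW hd hu
    obtain ⟨N, k, u, hu', hunit⟩ := hrel.exists_unit hd i
    have hup := not_mem_of_isUnit_away hunit hhp
    have htu : t ^ (N + 1) * u ∈ 𝒜 (k • d) := by
      have := SetLike.mul_mem_graded (SetLike.pow_mem_graded (N + 1) ht) hu'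
      rwa [add_sub_cancel] at this
    have hhk : h ^ k ∉ (toPoint (f y)).asIdeal :=
      fun h' => hhp ((toPoint (f y)).isPrime.mem_of_pow_mem _ h')
    -- The fraction `t^(N+1) u / h^k` has degree `0` and is a unit at `f y`. Its pullback times `s h
    -- ^ k` equals `s t ^ (N+1) · s u`, so `s t` divides a unit.
    have h1 := germ_fractionSection_mul hs hE e y hyW ⟨_, htu⟩
      ⟨h ^ k, SetLike.pow_mem_graded k hd⟩ hhk
    have h2 : IsUnit ((fractionSection (𝒜 := 𝒜) ⟨_, htu⟩
        ⟨h ^ k, SetLike.pow_mem_graded k hd⟩).1 ⟨toPoint (f y), hhk⟩) := by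
      refine (isUnit_mk_iff (x := toPoint (f y)) _).mpr fun h' => ?_
      rcases (toPoint (f y)).isPrime.mem_or_mem h' with h' | h'
      · exact htp ((toPoint (f y)).isPrime.mem_of_pow_mem _ h')
      · exact hup h'
    have h3 : IsUnit (germHom s e y.1 hyW (h ^ k)) := by rw [map_pow]; exact hu.pow k
    have h4 := h1 ▸ ((isUnit_germ_app_iff f _ _ y hhk).mpr h2).mul h3
    rw [map_mul, map_pow] at h4
    exact (isUnit_pow_iff (Nat.succ_ne_zero N)).mp (isUnit_of_mul_isUnit_left h4)
  fracRel V z y hyV W e hyW := by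
    obtain ⟨V', hyV', i', i, r, t, ht, hz⟩ := z.2 ⟨toPoint (f y), hyV⟩
    have h1 : z.1 ⟨toPoint (f y), hyV⟩ = _ := hz ⟨toPoint (f y), hyV'⟩
    rw [h1, HomogeneousLocalization.val_mk]
    refine FracRel.of_mk (by rw [add_zero]; exact r.2) t.2 _ ?_
    rw [← germ_fractionSection_mul hs hE e y hyW r t (ht ⟨toPoint (f y), hyV'⟩)]
    refine congrArg (· * _) ?_
    have hle : (show (multiProj 𝒜).Opens from V') ≤ V := leOfHom i'
    have hle' : (show (multiProj 𝒜).Opens from V') ≤ (basicOpen t.1 : Opens (space 𝒜)) :=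
      fun p hp => ht ⟨p, hp⟩
    -- The section `z` equals `r / t` only on `V'`, while the formula for the pullback concerns `r /
    -- t` on all of its domain; the two are compared after restriction to `V'`.
    have h2 : (multiProj 𝒜).presheaf.map (homOfLE hle).op z =
        (multiProj 𝒜).presheaf.map (homOfLE hle').op (fractionSection r t) :=
      sections_ext fun p => hz p
    have h3 : ∀ {V₁ V₂ : (multiProj 𝒜).Opens} (h : V₁ ≤ V₂) (hy : f y ∈ V₁)
        (z : Γ(multiProj 𝒜, V₂)),
        X.presheaf.germ (Y.ι ''ᵁ f ⁻¹ᵁ V₁) y.1 ⟨y, hy, rfl⟩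
          (f.app V₁ ((multiProj 𝒜).presheaf.map (homOfLE h).op z)) =
        X.presheaf.germ (Y.ι ''ᵁ f ⁻¹ᵁ V₂) y.1 ⟨y, h hy, rfl⟩ (f.app V₂ z) := by
      intro V₁ V₂ h hy z
      have h4 := congr($(f.naturality (homOfLE h).op) z)
      refine (congrArg (X.presheaf.germ (Y.ι ''ᵁ f ⁻¹ᵁ V₁) y.1 ⟨y, hy, rfl⟩) h4).trans ?_
      exact TopCat.Presheaf.germ_res_apply X.presheaf
        (homOfLE (by rintro _ ⟨y, hy, rfl⟩; exact ⟨y, h hy, rfl⟩) :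
          Y.ι ''ᵁ f ⁻¹ᵁ V₁ ⟶ Y.ι ''ᵁ f ⁻¹ᵁ V₂) y.1 ⟨y, hy, rfl⟩ (f.app V₂ z)
    rw [← h3 hle hyV' z, h2]
    exact h3 hle' hyV' (fractionSection r t)

end

end Uniqueness

end MultiProj

end

/-! ### The theorem -/

theorem mainTheorem5 {q : ℕ} {R : Type u} {σ : Type*} [CommRing R] [SetLike σ R]
    [AddSubgroupClass σ R] (𝒜 : (Fin q → ℤ) → σ) [GradedRing 𝒜]
    (X : Scheme.{u}) (L : Fin q → X.Modules) (hL : ∀ i, IsInvertible (L i))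
    (U : (multiProj 𝒜).Opens) (J : HomogeneousIdeal 𝒜)
    (hJ : IsGreatest {I : HomogeneousIdeal 𝒜 | zeroLocus I = (U : Set (multiProj 𝒜))ᶜ} J)
    (α : (Fin q → ℤ) →+ (Fin q → ℤ))
    (s : R →+* ⨁ a, tensorPowSections L a (⊤ : X.Opens))
    (hs : ∀ a, ∀ r ∈ 𝒜 a, s r ∈ (DirectSum.of (fun a => tensorPowSections L a ⊤) (α a)).range) :
    ∃! φ : (definedLocus s J).toScheme ⟶ U.toScheme,
      ∀ a, ∃ e : (Scheme.Modules.pullback (φ ≫ U.ι)).obj (twist 𝒜 a) ⟶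
          (tensorPow L (α a)).restrict (definedLocus s J).ι,
        IsIso ((Scheme.Modules.restrictFunctor ((φ ≫ U.ι) ⁻¹ᵁ unitLocus 𝒜 a).ι).map e) ∧
        ∀ r : 𝒜 a, e.app ⊤ (pullbackSection (φ ≫ U.ι) (twistSection r)) =
          (tensorPow L (α a)).presheaf.map (homOfLE le_top).op (s r.1 (α a)) := by
  have hY : ∀ y ∈ definedLocus s J, y ∉ sectionZeroLocus (s '' (irrelevant 𝒜 : Set R)) :=
    fun y hy h => hy (Or.inl h)
  have hJY : ∀ y ∈ definedLocus s J, y ∉ sectionZeroLocus (s '' (J : Set R)) :=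
    fun y hy h => hy (Or.inr h)
  obtain ⟨f, hf⟩ := exists_isCompatible hL hs hY
  -- Outside `V(s(J))` some homogeneous `t ∈ J` has `s t` invertible at `y`. Then `t ∉ f y`, so `f
  -- y` is not in `V(J)`, the complement of `U`.
  have hfU : Set.range f ⊆ (U : Set (multiProj 𝒜)) := by
    rintro _ ⟨y, rfl⟩
    obtain ⟨W, hyW, ⟨e⟩⟩ := exists_frames hL y.1
    obtain ⟨b, t, ht, htJ, hu⟩ := exists_isUnit_germHom hs (hJY y.1 y.2) e hyW
    by_contra hU
    have h1 : f y ∈ zeroLocus J := by rw [hJ.1]; exact hU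
    exact (hf.isVanishingMap y W e hyW b t ht).mpr hu (h1 htJ)
  let φ : (definedLocus s J).toScheme ⟶ U.toScheme :=
    IsOpenImmersion.lift U.ι f (by rwa [Scheme.Opens.range_ι])
  have hφ : φ ≫ U.ι = f := IsOpenImmersion.lift_fac _ _ _
  refine ⟨φ, fun a => ?_, fun ψ hψ => ?_⟩
  · rw [hφ]
    exact hf.exists_pullback_twist hL hs a
  · rw [← cancel_mono U.ι, hφ]
    -- The adjoints of the given `e_a` turn condition (2) into `IsTwistMap`, so `ψ ≫ U.ι` is
    -- compatible with `s` and equals `f`.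
    refine IsCompatible.unique (s := s) hL (isCompatible_of_isTwistMap hs (fun a => ?_) hY) hf
    obtain ⟨e, -, he⟩ := hψ a
    refine ⟨(Scheme.Modules.pullbackPushforwardAdjunction (ψ ≫ U.ι)).homEquiv _ _ e, fun r => ?_⟩
    rw [homEquiv_app]
    exact he r
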